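/- **Setting.** Fix integers $n,m\ge 0$. Let $\prod^{n,m}=\mathrm{span}\{z^iw^j: |i|\le n, |j|\le m\}$ and $p^\dagger(z,w)=\overline{p(1/\bar z,1/\bar w)}$ (for matrices of Laurent polynomials, combined with transposition). A linear functional $\mathcal L:\prod^{n,m}\to\mathbb C$ is *positive* if $\mathcal L(pp^\dagger)>0$ for every nonzero polynomial $p$ of degree at most $(n,m)$. Its moments are $c_{i,j}=\mathcal L(z^{-i}w^{-j})$, and its moment matrix is the doubly Toeplitz matrix (block Toeplitz with Toeplitz blocks) with entry $c_{a-c,b-d}$ at position $((a,b),(c,d))$, $0\le a,c\le n$, $0\le b,d\le m$. Let $\phi^l_{i,j}$ ($0\le l\le j$) be the orthonormal polynomial with leading monomial $z^iw^l$ and positive leading coefficient obtained by Gram–Schmidt from $\{z^aw^b: 0\le a\le i,0\le b\le j\}$ in the lexicographical order ($(a,b)<(a',b')$ iff $a<a'$, or $a=a'$ and $b<b'$), and $\tilde\phi^l_{i,j}$ ($0\le l\le i$) the one with leading monomial $z^lw^j$ for the reverse lexicographical order. For a column $F$ of polynomials of degree at most $(i,j)$, let $F^{\leftarrow}$ be the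 column with entries $z^iw^jf^\dagger$. **Notation.** $U_k=[0,I_k]$ and $U^1_k=[I_k,0]$ are $k\times(k+1)$; $e^k_r$ are standard unit vectors; $M^\dagger$ is the adjoint, $\bar M$ the entrywise conjugate, $\|\cdot\|$ the operator norm. $\mathrm{chol}(M)$ is the upper triangular $B$ with positive diagonal and $M=BB^\dagger$. $\Phi^{j}_{i,i}$ is the matrix of coefficients of $z^i[w^j,\dots,1]^T$ in $\Phi_{i,j}$, and $\tilde\Phi^{i}_{j,j}$ that of $w^j[z^i,\dots,1]^T$ in $\tilde\Phi_{i,j}$. $\hat\Gamma$ is the matrix obtained by stacking the first row of $\Gamma^1$ on $\Gamma$. A tilde denotes the quantity obtained by interchanging the two orders (with $\tilde{\mathcal K}=\mathcal K^\dagger$, $\tilde{\mathcal K}^1=(\mathcal K^1)^T$, $\tilde I=I^\dagger$, $\tilde I^1=(I^1)^T$); every formula below is also used in this form. **Algorithm.** Let $u_{i,j}\in\mathbb C$, $|i|\le n$, $|j|\le m$, satisfy $u_{-i,j}=\overline{u_{i,-j}}$. Level by level one constructs columns $\Phi_{i,j}$ ($j+1$ entries) and $\tilde\Phi_{i,j}$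 ($i+1$ entries) of polynomials and matrices of coefficients. * *Level $(0,0)$*: $\Phi_{0,0}=\tilde\Phi_{0,0}=u_{0,0}^{-1/2}$, $I_{0,0}=I^1_{0,0}=1$. * *Level $(i,0)$, $i\ge1$*: $\hat E_{i,0}=u_{i,0}$, $A_{i,0}=\sqrt{1-|\hat E_{i,0}|^2}$, $A_{i,0}\Phi_{i,0}=z\Phi_{i-1,0}-\hat E_{i,0}\Phi_{i-1,0}^{\leftarrow}$, $\tilde\Phi_{i,0}=[\Phi_{i,0};\tilde\Phi_{i-1,0}]$, $\tilde\Gamma_{i,0}=U_i$, $I_{i,0}=(e_1^{i+1})^T$, $I^1_{i,0}=[-\overline{\hat E_{i,0}},\,A_{i,0}I^1_{i-1,0}]$, and $\tilde\Gamma^1_{i,0}$ has first row $[A_{i,0},\hat E_{i,0}I^1_{i-1,0}]$ and remaining rows $[0,\tilde\Gamma^1_{i-1,0}]$; $\mathcal K,\mathcal K^1,\Gamma,\Gamma^1$ are empty. * *Level $(0,j)$, $j\ge1$*: the same with the two orders interchanged, with $\tilde{\hat E}_{0,j}=u_{0,j}$. * *Level $(i,j)$, $i,j\ge1$*: $\mathcal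 K_{1,1}=u_{-1,1}$, and for $(i,j)\ne(1,1)$ $$\mathcal K_{i,j}=\Phi^{j-1}_{i,i}\big(u_{-i,j}e^j_j(e^i_i)^T+(U^1_{j-1})^TH+e^j_j(e^j_j)^T\tilde H\,U^1_{i-1}\big)(\tilde\Phi^{i-1}_{j,j})^\dagger,$$ $$H=(\Phi^{j-2}_{i,i})^{-1}(\mathcal K_{i,j-1}-\mathcal K^1_{i,j-1}\tilde{\hat E}{}^\dagger_{i-1,j})((\tilde\Phi^{i-1}_{j-1,j-1})^\dagger)^{-1},\quad \tilde H=(\Phi^{j-1}_{i-1,i-1})^{-1}(\mathcal K_{i-1,j}-\hat E_{i,j-1}\overline{\mathcal K^1_{i-1,j}})((\tilde\Phi^{i-2}_{j,j})^\dagger)^{-1}.$$ $\mathcal K^1_{i,j}$ ($j\times i$) has $(1,1)$ entry $\bar u_{i,j}$; the rest of its first row is the first row of $A_{i,j-1}^{-1}(\mathcal K^1_{i-1,j}-\hat E_{i,j-1}\overline{\mathcal K_{i-1,j}})(U_{i-1}\tilde\Gamma_{i-1,j}^T)^{-1}$, and its other rows are $(\Gamma_{i,j-1}U_{j-1}^T)^{-1}(\mathcal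 K^1_{i,j-1}-\mathcal K_{i,j-1}\tilde{\hat E}{}^T_{i-1,j})(\tilde A_{i-1,j}^{-1})^T$. Further (writing $\mathcal K=\mathcal K_{i,j}$, $\mathcal K^1=\mathcal K^1_{i,j}$) $\Gamma_{i,j}=\mathrm{chol}(I-\mathcal K\mathcal K^\dagger)U_j$, $A_{i,j}=\mathrm{chol}(I-\hat E_{i,j}\hat E_{i,j}^\dagger)$, $$\hat E_{i,j}=\hat\Gamma_{i-1,j}^{-1}\big(U_j^T(A_{i,j-1}\mathcal K(I^1_{i-1,j})^\dagger+\hat E_{i,j-1}\overline{\Gamma^1_{i-1,j}})+e^{j+1}_1(e^j_1)^T(A_{i,j-1}\mathcal K^1I_{i-1,j}^T+\hat E_{i,j-1}\overline{\Gamma_{i-1,j}})\big).$$ With $V=(U_j\Gamma_{i,j}^\dagger)^{-1}$ and $X=(\tilde{\hat\Gamma}{}^T_{i,j-1})^{-1}(I^1_{i,j-1})^TV$ put $$H^1_{i,j}=\tilde A_{i-1,j}^Te^i_1(e^{i+1}_1)^TX+\overline{\tilde A_{i-1,j}}^{\,-1}\tilde{\hat E}{}_{i-1,j}^\dagger\tilde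 A_{i-1,j}\mathcal K^\dagger V,$$ $$H^2_{i,j}=I_{i,j-1}\big((I^1_{i,j-1})^\dagger\overline{\mathcal K}\tilde A_{i-1,j}^T+(\tilde\Gamma^1_{i,j-1})^\dagger\tilde{\hat E}_{i-1,j}\big)U_iX,$$ $$H^3_{i,j}=(H^2_{i,j}+\mathcal K^1H^1_{i,j})(H^2_{i,j}+\mathcal K^1H^1_{i,j})^\dagger+\mathcal K^1(\mathcal K^1)^\dagger.$$ The first column of $\Gamma^1_{i,j}$ is $\sqrt{1-(e^j_1)^TH^3_{i,j}e^j_1}\;e^j_1$, and its other columns form $\big(I_{i,j-1}\tilde{\hat E}_{i,j}(I^1_{i,j-1})^T+\Gamma_{i,j-1}^\dagger\Gamma^1_{i,j-1}+\mathcal K^1\overline{\tilde A_{i-1,j}}^{\,-1}\tilde{\hat E}{}_{i-1,j}^\dagger\tilde A_{i-1,j}\mathcal K^\dagger\big)V$. Finally $I_{i,j}=e^{j+1}_1(e^{i+1}_1)^T-\Gamma_{i,j}^\dagger\mathcal K(U_i\tilde\Gamma_{i,j}^\dagger)^{-1}U_i$, $\;I^1_{i,j}=-\bar A_{i,j}^{-1}\hat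 E_{i,j}^\dagger A_{i,j}I_{i,j}+A_{i,j}^TI^1_{i-1,j}\tilde\Gamma_{i,j}$, and $\Phi_{i,j}$ is the solution of $\Gamma_{i,j}\Phi_{i,j}=\Phi_{i,j-1}-\mathcal K\tilde\Phi_{i-1,j}$ together with the first row of $\Gamma^1_{i,j}\Phi_{i,j}=w\Phi_{i,j-1}-\mathcal K^1\tilde\Phi_{i-1,j}^{\leftarrow}$. To have everything defined for all $u$, square roots of nonpositive numbers, inverses of singular matrices and upper Cholesky factors that do not exist are read as $0$; this does not occur under the conditions (1). **Theorem.** Consider the conditions, for $1\le i\le n$ and $1\le j\le m$, $$u_{0,0}>0,\quad |\hat E_{i,0}|<1,\quad |\tilde{\hat E}_{0,j}|<1,\quad \|\mathcal K_{i,j}\|<1,\quad (e^j_1)^TH^3_{i,j}e^j_1<1,\tag{1}$$ and, for a linear functional $\mathcal L$ on $\prod^{n,m}$, the relations $$\mathcal L(\Phi_{i,m}\Phi_{j,m}^\dagger)=\delta_{i,j}I_{m+1}\ (0\le i,j\le n),\qquad \mathcal L(\tilde\Phi_{n,i}\tilde\Phi_{n,j}^\dagger)=\delta_{i,j}I_{n+1}\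 (0\le i,j\le m).\tag{2}$$ 1. If (1) holds, then there is exactly one positive linear functional $\mathcal L$ on $\prod^{n,m}$ that satisfies (2). 2. Conversely, if some positive linear functional $\mathcal L$ on $\prod^{n,m}$ satisfies (2), then (1) holds. Moreover $\Phi_{i,j}=[\phi_{i,j}^j,\dots,\phi^0_{i,j}]^T$ and $\tilde\Phi_{i,j}=[\tilde\phi_{i,j}^i,\dots,\tilde\phi^0_{i,j}]^T$ for all $0\le i\le n$, $0\le j\le m$ are the orthonormal polynomials of $\mathcal L$, and $u_{0,0}=\mathcal L(1)$, $\hat E_{i,0}=\mathcal L(z\Phi_{i-1,0}(\Phi_{i-1,0}^{\leftarrow})^\dagger)$, $\tilde{\hat E}_{0,j}=\mathcal L(w\tilde\Phi_{0,j-1}(\tilde\Phi_{0,j-1}^{\leftarrow})^\dagger)$, $\mathcal K_{i,j}=\mathcal L(\Phi_{i,j-1}\tilde\Phi_{i-1,j}^\dagger)$, $\mathcal K^1_{i,j}=\mathcal L(w\Phi_{i,j-1}(\tilde\Phi_{i-1,j}^{\leftarrow})^\dagger)$ for $1\le i\le n$, $1\le j\le m$. 3. For every positive linear functional $\mathcal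 L$ on $\prod^{n,m}$ there is exactly one array $u$ for which (2) holds, and it satisfies (1). 4. A matrix of size $(n+1)(m+1)$ is doubly Toeplitz and positive definite if and only if it is the moment matrix of a positive linear functional satisfying (2) for some array $u$ with (1). -/

import Mathlib

open Matrix
open scoped ComplexOrder Matrix.Norms.L2Operator

noncomputable section

namespace Bicircle

/-! ## Laurent polynomials in two variables and linear functionals -/

/-- Laurent polynomials in `z` and `w` with complex coefficients; the exponent `(i, j)` stands for
the monomial `z ^ i * w ^ j`. -/
abbrev Laurent : Type := AddMonoidAlgebra ℂ (ℤ × ℤ)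

/-- The monomial `z ^ i * w ^ j`. -/
def mono (i j : ℤ) : Laurent := AddMonoidAlgebra.single (i, j) 1

/-- `p† (z, w)`, the conjugate of `p (1 / conj z, 1 / conj w)`: coefficients are conjugated and
exponents change sign. -/
def dagger (p : Laurent) : Laurent :=
  p.coeff.sum fun k c => AddMonoidAlgebra.single (-k) (star c)

/-- The reverse polynomial `z ^ n * w ^ m * p†` of a polynomial of degree at most `(n, m)`. -/
def rev (n m : ℕ) (p : Laurent) : Laurent := mono n m * dagger p

/-- The Laurent space `∏^{n,m}`, the span of the `z ^ i * w ^ j` with `|i| ≤ n`, `|j| ≤ m`. -/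
def laurentSpace (n m : ℕ) : Submodule ℂ Laurent :=
  Submodule.span ℂ {p | ∃ i j : ℤ, |i| ≤ n ∧ |j| ≤ m ∧ p = mono i j}

/-- The polynomials of degree at most `(n, m)`, the span of the `z ^ i * w ^ j` with
`0 ≤ i ≤ n`, `0 ≤ j ≤ m`. -/
def polySpace (n m : ℕ) : Submodule ℂ Laurent :=
  Submodule.span ℂ {p | ∃ i j : ℕ, i ≤ n ∧ j ≤ m ∧ p = mono i j}

/-- `x` lies in the domain of the functional `L`, and `L x = c`. -/
def HasValue {n m : ℕ} (L : laurentSpace n m →ₗ[ℂ] ℂ) (x : Laurent) (c : ℂ) : Prop :=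
  ∃ h : x ∈ laurentSpace n m, L ⟨x, h⟩ = c

/-- `L (|p|²) > 0` for all nonzero polynomials `p` of degree at most `(n, m)`.
(`0 < c` for complex `c` says that `c` is real and positive, so that the symmetry
`L (z⁻ⁱ w⁻ʲ) = conj (L (zⁱ wʲ))` follows by polarization.) -/
def IsPositive {n m : ℕ} (L : laurentSpace n m →ₗ[ℂ] ℂ) : Prop :=
  ∀ p ∈ polySpace n m, p ≠ 0 → ∃ c : ℂ, HasValue L (p * dagger p) c ∧ 0 < c

/-- `C` is the moment matrix of `L` in the lexicographical ordering: the entry in position `(b, d)`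
of the block in position `(a, c)` is the moment `c_{a-c,b-d} = L (z ^ (c-a) * w ^ (d-b))`. -/
def IsMomentMatrix {n m : ℕ} (L : laurentSpace n m →ₗ[ℂ] ℂ)
    (C : Matrix (Fin (n + 1) × Fin (m + 1)) (Fin (n + 1) × Fin (m + 1)) ℂ) : Prop :=
  ∀ (a c : Fin (n + 1)) (b d : Fin (m + 1)),
    HasValue L (mono ((c : ℤ) - (a : ℤ)) ((d : ℤ) - (b : ℤ))) (C (a, b) (c, d))

/-- Block Toeplitz matrices with Toeplitz blocks. -/
def IsDoublyToeplitz {n m : ℕ}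
    (C : Matrix (Fin (n + 1) × Fin (m + 1)) (Fin (n + 1) × Fin (m + 1)) ℂ) : Prop :=
  ∃ t : ℤ → ℤ → ℂ, ∀ (a c : Fin (n + 1)) (b d : Fin (m + 1)),
    C (a, b) (c, d) = t ((a : ℤ) - (c : ℤ)) ((b : ℤ) - (d : ℤ))

/-- `p` is the orthonormal polynomial `φ_{i,j}^l` of `L` for the lexicographical ordering:
it is a combination of `z ^ i * w ^ l`, with a positive coefficient, and of lexicographically
smaller monomials `z ^ a * w ^ b`, `0 ≤ a`, `0 ≤ b ≤ j`, it is orthogonal to these, and it has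
norm one. -/
def IsLexOrthonormal {n m : ℕ} (L : laurentSpace n m →ₗ[ℂ] ℂ) (i j l : ℕ) (p : Laurent) : Prop :=
  (∀ a b : ℤ, p.coeff (a, b) ≠ 0 → 0 ≤ a ∧ 0 ≤ b ∧ b ≤ j ∧ (a < i ∨ (a = i ∧ b ≤ l))) ∧
  0 < p.coeff ((i : ℤ), (l : ℤ)) ∧
  (∀ a b : ℕ, b ≤ j → (a < i ∨ (a = i ∧ b < l)) → HasValue L (p * dagger (mono a b)) 0) ∧
  HasValue L (p * dagger p) 1

/-- `p` is the orthonormal polynomial `φ̃_{i,j}^l` of `L` for the reverse lexicographical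
ordering. -/
def IsRevLexOrthonormal {n m : ℕ} (L : laurentSpace n m →ₗ[ℂ] ℂ) (i j l : ℕ) (p : Laurent) :
    Prop :=
  (∀ a b : ℤ, p.coeff (a, b) ≠ 0 → 0 ≤ a ∧ 0 ≤ b ∧ a ≤ i ∧ (b < j ∨ (b = j ∧ a ≤ l))) ∧
  0 < p.coeff ((l : ℤ), (j : ℤ)) ∧
  (∀ a b : ℕ, a ≤ i → (b < j ∨ (b = j ∧ a < l)) → HasValue L (p * dagger (mono a b)) 0) ∧
  HasValue L (p * dagger p) 1

/-! ## Matrices -/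

/-- `B` is upper triangular with positive diagonal entries and `M = B B†`. -/
def IsUpperCholesky {k : ℕ} (M B : Matrix (Fin k) (Fin k) ℂ) : Prop :=
  (∀ i j, j < i → B i j = 0) ∧ (∀ i, 0 < B i i) ∧ M = B * Bᴴ

open Classical in
/-- The upper Cholesky factor of a positive definite matrix (and `0` for the matrices that have
none). -/
def upperCholesky {k : ℕ} (M : Matrix (Fin k) (Fin k) ℂ) : Matrix (Fin k) (Fin k) ℂ :=
  if h : ∃ B, IsUpperCholesky M B then h.choose else 0

/-- Entrywise complex conjugation. -/
def conjM {k l : ℕ} (M : Matrix (Fin k) (Fin l) ℂ) : Matrix (Fin k) (Fin l) ℂ := M.map star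

/-- `U_k = [0, I_k]`. -/
def U (k : ℕ) : Matrix (Fin k) (Fin (k + 1)) ℂ := Matrix.of fun i j => if j = i.succ then 1 else 0

/-- `U_k^1 = [I_k, 0]`. -/
def U1 (k : ℕ) : Matrix (Fin k) (Fin (k + 1)) ℂ :=
  Matrix.of fun i j => if j = i.castSucc then 1 else 0

/-- The matrix with a one in the upper left corner and zeros elsewhere. -/
def corner (k l : ℕ) : Matrix (Fin (k + 1)) (Fin (l + 1)) ℂ := Matrix.single 0 0 1

/-- The product of a matrix of scalars and a column of polynomials. -/
def act {k l : ℕ} (M : Matrix (Fin k) (Fin l) ℂ) (v : Fin l → Laurent) : Fin k → Laurent :=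
  fun i => ∑ j, M i j • v j

/-- For a column `v` of `m + 1` polynomials, the coefficient matrix of `zⁿ [wᵐ, …, w, 1]ᵀ`. -/
def lead (n m : ℕ) (v : Fin (m + 1) → Laurent) : Matrix (Fin (m + 1)) (Fin (m + 1)) ℂ :=
  Matrix.of fun i j => (v i).coeff ((n : ℤ), (m : ℤ) - (j : ℤ))

/-- For a column `v` of `n + 1` polynomials, the coefficient matrix of `wᵐ [zⁿ, …, z, 1]ᵀ`. -/
def leadTilde (n m : ℕ) (v : Fin (n + 1) → Laurent) : Matrix (Fin (n + 1)) (Fin (n + 1)) ℂ :=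
  Matrix.of fun i j => (v i).coeff ((n : ℤ) - (j : ℤ), (m : ℤ))

/-! ## The algorithm -/

/-- The recurrence coefficients on level `(n, m)`. The suffix `t` stands for a tilde, `E` and `Et`
are the matrices usually written with a hat. The coefficients `E`, `A` have no meaning
for `n = 0`, and `Et`, `At` have none for `m = 0`; they are set to `0` there and never used. -/
structure Coeffs (n m : ℕ) where
  K : Matrix (Fin m) (Fin n) ℂ
  K1 : Matrix (Fin m) (Fin n) ℂ
  G : Matrix (Fin m) (Fin (m + 1)) ℂ
  Gt : Matrix (Fin n) (Fin (n + 1)) ℂ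
  G1 : Matrix (Fin m) (Fin (m + 1)) ℂ
  G1t : Matrix (Fin n) (Fin (n + 1)) ℂ
  E : Matrix (Fin (m + 1)) (Fin (m + 1)) ℂ
  Et : Matrix (Fin (n + 1)) (Fin (n + 1)) ℂ
  A : Matrix (Fin (m + 1)) (Fin (m + 1)) ℂ
  At : Matrix (Fin (n + 1)) (Fin (n + 1)) ℂ
  I : Matrix (Fin (m + 1)) (Fin (n + 1)) ℂ
  I1 : Matrix (Fin (m + 1)) (Fin (n + 1)) ℂ

/-- Interchange of the two orderings (and of `n` and `m`), which uses `K̃ = K†`, `K̃¹ = (K¹)ᵀ`,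
`Ĩ = I†`, `Ĩ¹ = (I¹)ᵀ`. -/
def Coeffs.swap {n m : ℕ} (c : Coeffs n m) : Coeffs m n where
  K := c.Kᴴ
  K1 := c.K1ᵀ
  G := c.Gt
  Gt := c.G
  G1 := c.G1t
  G1t := c.G1
  E := c.Et
  Et := c.E
  A := c.At
  At := c.A
  I := c.Iᴴ
  I1 := c.I1ᵀ

/-- The coefficients on level `(n, m)` together with the orthonormal polynomials: `P` is the
column `Φ_{n,m} = [φ^m, …, φ^0]ᵀ` and `Pt` the column `Φ̃_{n,m} = [φ̃^n, …, φ̃^0]ᵀ`. Moreover `Q` is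
the matrix `Φ^{m-1}_{n,n}` of the leading coefficients of `Φ_{n,m-1}`, and `Qt` the matrix
`Φ̃^{n-1}_{m,m}` of the leading coefficients of `Φ̃_{n-1,m}`. -/
structure Level (n m : ℕ) extends Coeffs n m where
  P : Fin (m + 1) → Laurent
  Pt : Fin (n + 1) → Laurent
  Q : Matrix (Fin m) (Fin m) ℂ
  Qt : Matrix (Fin n) (Fin n) ℂ

/-- Level `(0, 0)`: `Φ = Φ̃ = 1 / √u₀₀` and `I = I¹ = 1`. -/
def level00 (u : ℤ → ℤ → ℂ) : Level 0 0 where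
  K := 0
  K1 := 0
  G := 0
  Gt := 0
  G1 := 0
  G1t := 0
  E := 0
  Et := 0
  A := 0
  At := 0
  I := 1
  I1 := 1
  P := fun _ => ((1 / Real.sqrt (u 0 0).re : ℝ) : ℂ) • mono 0 0
  Pt := fun _ => ((1 / Real.sqrt (u 0 0).re : ℝ) : ℂ) • mono 0 0
  Q := 0
  Qt := 0

/-- `√(1 - |α|²)`. -/
def rho (α : ℂ) : ℂ := ((Real.sqrt (1 - ‖α‖ ^ 2) : ℝ) : ℂ)

/-- The coefficients on level `(n + 1, 0)`, where the new parameter `α` is the one-dimensional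
recurrence coefficient. -/
def boundaryStep {n : ℕ} (c : Coeffs n 0) (α : ℂ) : Coeffs (n + 1) 0 where
  K := 0
  K1 := 0
  G := 0
  Gt := U (n + 1)
  G1 := 0
  G1t := Matrix.of (Fin.cons (Fin.cons (rho α) fun j => α * c.I1 0 j)
    fun i => Fin.cons 0 (c.G1t i))
  E := Matrix.of fun _ _ => α
  Et := 0
  A := Matrix.of fun _ _ => rho α
  At := 0
  I := corner 0 (n + 1)
  I1 := Matrix.of fun _ => Fin.cons (-star α) fun j => rho α * c.I1 0 j

/-- The step from level `(n, 0)` to level `(n + 1, 0)`. -/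
def stepZ (u : ℤ → ℤ → ℂ) {n : ℕ} (a : Level n 0) : Level (n + 1) 0 :=
  let α := u (n + 1) 0
  let φ : Laurent := (rho α)⁻¹ • (mono 1 0 * a.P 0 - α • rev n 0 (a.P 0))
  { boundaryStep a.toCoeffs α with
    P := fun _ => φ
    Pt := Fin.cons φ a.Pt
    Q := 0
    Qt := leadTilde n 0 a.Pt }

/-- The step from level `(0, m)` to level `(0, m + 1)`. -/
def stepW (u : ℤ → ℤ → ℂ) {m : ℕ} (b : Level 0 m) : Level 0 (m + 1) :=
  let α := u 0 (m + 1)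
  let φ : Laurent := (rho α)⁻¹ • (mono 0 1 * b.Pt 0 - α • rev 0 m (b.Pt 0))
  { (boundaryStep b.toCoeffs.swap α).swap with
    P := Fin.cons φ b.P
    Pt := fun _ => φ
    Q := lead 0 m b.P
    Qt := 0 }

section Interior

/-! In this section `a` is the level `(n, m + 1)`, `b` is the level `(n + 1, m)`, and the data
of level `(n + 1, m + 1)` are computed. -/

variable {n m : ℕ}

/-- `K_{n+1,m+1}`, with the new parameter `u_{-(n+1),m+1}`. -/
def nextK (u : ℤ → ℤ → ℂ) (a : Level n (m + 1)) (b : Level (n + 1) m) :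
    Matrix (Fin (m + 1)) (Fin (n + 1)) ℂ :=
  if n = 0 ∧ m = 0 then Matrix.of fun _ _ => u (-1) 1
  else
    let H : Matrix (Fin m) (Fin (n + 1)) ℂ := b.Q⁻¹ * (b.K - b.K1 * a.Etᴴ) * (b.Qtᴴ)⁻¹
    let Ht : Matrix (Fin (m + 1)) (Fin n) ℂ := a.Q⁻¹ * (a.K - b.E * conjM a.K1) * (a.Qtᴴ)⁻¹
    lead (n + 1) m b.P *
      (u (-((n : ℤ) + 1)) (m + 1) • Matrix.single (Fin.last m) (Fin.last n) (1 : ℂ) + (U1 m)ᵀ * H +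
        Matrix.single (Fin.last m) (Fin.last m) (1 : ℂ) * Ht * U1 n) *
      (leadTilde n (m + 1) a.Pt)ᴴ

/-- `K¹_{n+1,m+1}`, with the new parameter `u_{n+1,m+1}`: the upper left entry is its conjugate,
the remaining first row comes from level `(n, m + 1)`, the other rows from level `(n + 1, m)`. -/
def nextK1 (u : ℤ → ℤ → ℂ) (a : Coeffs n (m + 1)) (b : Coeffs (n + 1) m) :
    Matrix (Fin (m + 1)) (Fin (n + 1)) ℂ :=
  let R : Matrix (Fin m) (Fin (n + 1)) ℂ :=
    (b.G * (U m)ᵀ)⁻¹ * (b.K1 * (a.At⁻¹)ᵀ - b.K * a.Etᵀ * (a.At⁻¹)ᵀ)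
  let C : Matrix (Fin (m + 1)) (Fin n) ℂ :=
    (b.A⁻¹ * a.K1 - b.A⁻¹ * b.E * conjM a.K) * (U n * a.Gtᵀ)⁻¹
  Matrix.of (Fin.cons (Fin.cons (star (u (n + 1) (m + 1))) (C 0)) R)

/-- `Γ` as a function of `K`: the upper Cholesky factor of `1 - K K†`, preceded by a zero column. -/
def gammaOf {k l : ℕ} (K : Matrix (Fin k) (Fin l) ℂ) : Matrix (Fin k) (Fin (k + 1)) ℂ :=
  upperCholesky (1 - K * Kᴴ) * U k

/-- The first row of `Γ¹` stacked on `Γ`. -/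
def hatGamma {k : ℕ} (G1 G : Matrix (Fin (k + 1)) (Fin (k + 2)) ℂ) :
    Matrix (Fin (k + 2)) (Fin (k + 2)) ℂ :=
  Matrix.of (Fin.cons (G1 0) G)

/-- `Ê_{n+1,m+1}`. -/
def nextE (a : Coeffs n (m + 1)) (b : Coeffs (n + 1) m) (K K1 : Matrix (Fin (m + 1)) (Fin (n + 1)) ℂ) :
    Matrix (Fin (m + 2)) (Fin (m + 2)) ℂ :=
  (hatGamma a.G1 a.G)⁻¹ *
    ((U (m + 1))ᵀ * (b.A * K * a.I1ᴴ + b.E * conjM a.G1) +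
      corner (m + 1) m * (b.A * K1 * a.Iᵀ + b.E * conjM a.G))

/-- `H¹_{n+1,m+1}`. -/
def H1 (a : Coeffs n (m + 1)) (b : Coeffs (n + 1) m) (K : Matrix (Fin (m + 1)) (Fin (n + 1)) ℂ) :
    Matrix (Fin (n + 1)) (Fin (m + 1)) ℂ :=
  a.Atᵀ * corner n (n + 1) * ((hatGamma b.G1t b.Gt)ᵀ)⁻¹ * b.I1ᵀ * (U (m + 1) * (gammaOf K)ᴴ)⁻¹ +
    (conjM a.At)⁻¹ * a.Etᴴ * a.At * Kᴴ * (U (m + 1) * (gammaOf K)ᴴ)⁻¹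

/-- `H²_{n+1,m+1}`. -/
def H2 (a : Coeffs n (m + 1)) (b : Coeffs (n + 1) m) (K : Matrix (Fin (m + 1)) (Fin (n + 1)) ℂ) :
    Matrix (Fin (m + 1)) (Fin (m + 1)) ℂ :=
  b.I * (b.I1ᴴ * conjM K * a.Atᵀ + b.G1tᴴ * a.Et) * U (n + 1) *
    ((hatGamma b.G1t b.Gt)ᵀ)⁻¹ * b.I1ᵀ * (U (m + 1) * (gammaOf K)ᴴ)⁻¹

/-- `H³_{n+1,m+1}`. -/
def H3 (a : Coeffs n (m + 1)) (b : Coeffs (n + 1) m)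
    (K K1 : Matrix (Fin (m + 1)) (Fin (n + 1)) ℂ) : Matrix (Fin (m + 1)) (Fin (m + 1)) ℂ :=
  (H2 a b K + K1 * H1 a b K) * (H2 a b K + K1 * H1 a b K)ᴴ + K1 * K1ᴴ

/-- `Γ¹_{n+1,m+1}`: the first column is `√(1 - e₁ᵀ H³ e₁) e₁`; `Et` is `Ẽ_{n+1,m+1}` (with hat). -/
def nextG1 (a : Coeffs n (m + 1)) (b : Coeffs (n + 1) m)
    (K K1 : Matrix (Fin (m + 1)) (Fin (n + 1)) ℂ) (Et : Matrix (Fin (n + 2)) (Fin (n + 2)) ℂ) :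
    Matrix (Fin (m + 1)) (Fin (m + 2)) ℂ :=
  let W : Matrix (Fin (m + 1)) (Fin (m + 1)) ℂ :=
    (b.I * Et * b.I1ᵀ + b.Gᴴ * b.G1 + K1 * (conjM a.At)⁻¹ * a.Etᴴ * a.At * Kᴴ) *
      (U (m + 1) * (gammaOf K)ᴴ)⁻¹
  Matrix.of fun i => Fin.cons
    (if i = 0 then ((Real.sqrt (1 - (H3 a b K K1 0 0).re) : ℝ) : ℂ) else 0) (W i)

/-- The polynomials `Φ_{n+1,m+1}`, obtained from the recurrences
`Γ Φ_{n+1,m+1} = Φ_{n+1,m} - K Φ̃_{n,m+1}` and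
`Γ¹ Φ_{n+1,m+1} = w Φ_{n+1,m} - K¹ (reverse of Φ̃_{n,m+1})`, of the latter only the first row;
here `x` is `w`, `p` is `Φ_{n+1,m}`, `q` is `Φ̃_{n,m+1}` and `qr` consists of the reverse
polynomials of `q`. -/
def nextP {k l : ℕ} (x : Laurent) (p : Fin (k + 1) → Laurent) (q qr : Fin (l + 1) → Laurent)
    (K K1 : Matrix (Fin (k + 1)) (Fin (l + 1)) ℂ) (G1 : Matrix (Fin (k + 1)) (Fin (k + 2)) ℂ) :
    Fin (k + 2) → Laurent :=
  act (hatGamma G1 (gammaOf K))⁻¹ (Fin.cons (x * p 0 - act K1 qr 0) fun i => p i - act K q i)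

/-- The step to level `(n + 1, m + 1)`. The quantities with a tilde are obtained from the formulas
for those without one by interchanging the two orderings. -/
def stepZW (u : ℤ → ℤ → ℂ) (a : Level n (m + 1)) (b : Level (n + 1) m) :
    Level (n + 1) (m + 1) :=
  let a₀ := a.toCoeffs
  let b₀ := b.toCoeffs
  let K := nextK u a b
  let K1 := nextK1 u a₀ b₀
  let E := nextE a₀ b₀ K K1
  let Et := nextE b₀.swap a₀.swap Kᴴ K1ᵀ
  let A := upperCholesky (1 - E * Eᴴ)
  let At := upperCholesky (1 - Et * Etᴴ)
  let G := gammaOf K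
  let Gt := gammaOf Kᴴ
  let G1 := nextG1 a₀ b₀ K K1 Et
  let G1t := nextG1 b₀.swap a₀.swap Kᴴ K1ᵀ E
  let I := corner (m + 1) (n + 1) - Gᴴ * K * (U (n + 1) * Gtᴴ)⁻¹ * U (n + 1)
  { K := K
    K1 := K1
    G := G
    Gt := Gt
    G1 := G1
    G1t := G1t
    E := E
    Et := Et
    A := A
    At := At
    I := I
    I1 := -((conjM A)⁻¹ * Eᴴ * A * I) + Aᵀ * a.I1 * Gt
    P := nextP (mono 0 1) b.P a.Pt (fun k => rev n (m + 1) (a.Pt k)) K K1 G1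
    Pt := nextP (mono 1 0) a.Pt b.P (fun k => rev (n + 1) m (b.P k)) Kᴴ K1ᵀ G1t
    Q := lead (n + 1) m b.P
    Qt := leadTilde n (m + 1) a.Pt }

end Interior

/-- The levels `(0, m)`. -/
def row0 (u : ℤ → ℤ → ℂ) : (m : ℕ) → Level 0 m
  | 0 => level00 u
  | m + 1 => stepW u (row0 u m)

/-- The levels `(n + 1, m)` from the levels `(n, m)`. -/
def nextRow (u : ℤ → ℤ → ℂ) {n : ℕ} (prev : (m : ℕ) → Level n m) : (m : ℕ) → Level (n + 1) m
  | 0 => stepZ u (prev 0)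
  | m + 1 => stepZW u (prev (m + 1)) (nextRow u prev m)

/-- All data that the algorithm produces on level `(n, m)` from the parameters `u`. -/
def level (u : ℤ → ℤ → ℂ) : (n : ℕ) → (m : ℕ) → Level n m
  | 0 => row0 u
  | n + 1 => nextRow u (level u n)

/-- The matrix `H³_{i+1,j+1}` of the algorithm. -/
def levelH3 (u : ℤ → ℤ → ℂ) (i j : ℕ) : Matrix (Fin (j + 1)) (Fin (j + 1)) ℂ :=
  H3 (level u i (j + 1)).toCoeffs (level u (i + 1) j).toCoeffs
    (level u (i + 1) (j + 1)).K (level u (i + 1) (j + 1)).K1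

/-! ## Parameters, conditions and orthonormality -/

/-- `u_{-i,j} = conj u_{i,-j}` for `|i| ≤ n`, `|j| ≤ m`. -/
def IsParameterArray (n m : ℕ) (u : ℤ → ℤ → ℂ) : Prop :=
  ∀ i j : ℤ, |i| ≤ n → |j| ≤ m → u (-i) j = star (u i (-j))

/-- The conditions `u_{0,0} > 0`, `|Ê_{i,0}| < 1`, `|Ẽ_{0,j}| < 1`, `‖K_{i,j}‖ < 1` (operator norm)
and `e₁ᵀ H³_{i,j} e₁ < 1` for `1 ≤ i ≤ n`, `1 ≤ j ≤ m`. -/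
def Admissible (n m : ℕ) (u : ℤ → ℤ → ℂ) : Prop :=
  0 < u 0 0 ∧
  (∀ i, 1 ≤ i → i ≤ n → ‖(level u i 0).E 0 0‖ < 1) ∧
  (∀ j, 1 ≤ j → j ≤ m → ‖(level u 0 j).Et 0 0‖ < 1) ∧
  (∀ i j, 1 ≤ i → i ≤ n → 1 ≤ j → j ≤ m → ‖(level u i j).K‖ < 1) ∧
  (∀ i j, i < n → j < m → (levelH3 u i j 0 0).re < 1)

/-- `L (Φ_{i,m} Φ_{j,m}†) = δ_{i,j} I_{m+1}` for `0 ≤ i, j ≤ n` and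
`L (Φ̃_{n,i} Φ̃_{n,j}†) = δ_{i,j} I_{n+1}` for `0 ≤ i, j ≤ m`, where `Φ` and `Φ̃` are constructed
from `u`. -/
def OrthonormalFor {n m : ℕ} (u : ℤ → ℤ → ℂ) (L : laurentSpace n m →ₗ[ℂ] ℂ) : Prop :=
  (∀ i j, i ≤ n → j ≤ n → ∀ k l : Fin (m + 1),
    HasValue L ((level u i m).P k * dagger ((level u j m).P l)) (if i = j ∧ k = l then 1 else 0)) ∧
  (∀ i j, i ≤ m → j ≤ m → ∀ k l : Fin (n + 1),
    HasValue L ((level u n i).Pt k * dagger ((level u n j).Pt l))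
      (if i = j ∧ k = l then 1 else 0))

/-- The data constructed from `u` on all levels up to `(n, m)` are those of the functional `L`:
`Φ_{i,j}` and `Φ̃_{i,j}` consist of the orthonormal polynomials of `L`, and the parameters
`u_{0,0}`, `Ê_{i,0}`, `Ẽ_{0,j}` and the matrices `K_{i,j}`, `K¹_{i,j}` are the corresponding
moment and recurrence coefficients. -/
def IsRecurrenceDataOf {n m : ℕ} (u : ℤ → ℤ → ℂ) (L : laurentSpace n m →ₗ[ℂ] ℂ) : Prop :=
  (∀ i j, i ≤ n → j ≤ m →
    (∀ k : Fin (j + 1), IsLexOrthonormal L i j (j - (k : ℕ)) ((level u i j).P k)) ∧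
    (∀ k : Fin (i + 1), IsRevLexOrthonormal L i j (i - (k : ℕ)) ((level u i j).Pt k))) ∧
  HasValue L 1 (u 0 0) ∧
  (∀ i, i < n → HasValue L
    (mono 1 0 * (level u i 0).P 0 * dagger (rev i 0 ((level u i 0).P 0)))
    ((level u (i + 1) 0).E 0 0)) ∧
  (∀ j, j < m → HasValue L
    (mono 0 1 * (level u 0 j).Pt 0 * dagger (rev 0 j ((level u 0 j).Pt 0)))
    ((level u 0 (j + 1)).Et 0 0)) ∧
  (∀ i j, i < n → j < m → ∀ (k : Fin (j + 1)) (l : Fin (i + 1)),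
    HasValue L ((level u (i + 1) j).P k * dagger ((level u i (j + 1)).Pt l))
      ((level u (i + 1) (j + 1)).K k l) ∧
    HasValue L
      (mono 0 1 * (level u (i + 1) j).P k * dagger (rev i (j + 1) ((level u i (j + 1)).Pt l)))
      ((level u (i + 1) (j + 1)).K1 k l))

end Bicircle

end

namespace Bicircle

/-! ## Laurent polynomials, adjoints and supports -/

/-! A functional is encoded by its array of moments `c`, and everything is expressed through the
sesquilinear form `pair c p q = L (p q†)`. For hermitian `c` this form is hermitian. It is always
invariant under multiplication by monomials (the doubly Toeplitz property), and reversal exchanges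
its arguments. These symmetries are what makes the recurrences work.

If the form is positive, it has unique orthonormal columns `Phi` and `Phit`, and the "true"
coefficients `trueL c i j` are Gram matrices between neighbouring columns. Every formula of the
algorithm is an identity between such Gram matrices. It comes from expanding a column whose degree
and orthogonality leave no other choice (`Phi_expand`, `RPhi_expand`, `Phit_expand`), or from
inserting an orthonormal column (`gram_eq_mul`). Tilde quantities are plain quantities of the
functional `sw c` with interchanged variables, so each identity is proved once. The lower levels
force all entries of `K` and `K¹` up to a single degree of freedom each; these two are the new
parameters (`nextK_eq_iff`, `nextK1_eq_iff`). Hence the algorithm, run on the parameters of a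
positive functional, returns the data of that functional (`level_eq_trueL`).

Positivity is extended from degrees `(n+1,m)` and `(n,m+1)` to `(n+1,m+1)` by two orthogonal
decompositions (`pos_succ_iff`). Adjoining to degree `(n,m+1)` all monomials of degree at most
`(n+1,m+1)` except the corner `z^(n+1) w^(m+1)` amounts to adjoining the residuals `Φ_{n+1,m} - K
Φ̃_{n,m+1}`, whose Gram matrix `1 - K K†` is positive definite exactly when `‖K‖ < 1`. The corner
then contributes one polynomial of squared norm `1 - e₁ᵀ H³ e₁`.

Sufficiency is an induction over levels. Functionals for the two lower rectangles agree on the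
overlap and are glued (`exists_glue`). The moments at `±(n+1,m+1)` and `±(n+1,-(m+1))` are still
free; each pair moves one of the two parameters, affinely with nonzero slope, and leaves the other
alone (`exists_moment_interior`). Uniqueness holds because the orthonormal columns span all
polynomials of the given degree (`agreeOn_of_orthonormal`).

Necessity exploits the default values (`admissible_of_orthonormal`). When a condition fails, a
Cholesky factor, a square root or an inverse is read as zero and a whole column of polynomials
vanishes. Its successors then have too small a degree, and (2) would put too many orthonormal
polynomials into a space of too small dimension. Once the conditions hold, the functional built from
`u` has to be the given one, so `u` consists of its parameters (`matches_of_orthonormalFor`). The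
remaining two statements read the parameters off the moments (`params`) and identify the quadratic
form of the moment matrix with `pair c` (`posDef_iff_pos`). -/

theorem coeff_single_apply' (k l : ℤ × ℤ) (a : ℂ) :
    (AddMonoidAlgebra.single k a : Laurent).coeff l = if k = l then a else 0 := by
  classical
  rw [AddMonoidAlgebra.coeff_single, Finsupp.single_apply]

theorem laurent_ext {p q : Laurent} (h : ∀ k, p.coeff k = q.coeff k) : p = q :=
  AddMonoidAlgebra.ext (Finsupp.ext h)

theorem dagger_single (k : ℤ × ℤ) (a : ℂ) :
    dagger (AddMonoidAlgebra.single k a) = AddMonoidAlgebra.single (-k) (star a) := by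
  unfold dagger
  rw [AddMonoidAlgebra.coeff_single, Finsupp.sum_single_index]
  simp

theorem dagger_zero : dagger 0 = 0 := by
  simp [dagger]

theorem dagger_add (p q : Laurent) : dagger (p + q) = dagger p + dagger q := by
  unfold dagger
  rw [AddMonoidAlgebra.coeff_add]
  refine Finsupp.sum_add_index' (by simp) fun k a b => ?_
  rw [star_add, AddMonoidAlgebra.single_add]

theorem coeff_dagger (p : Laurent) (k : ℤ × ℤ) :
    (dagger p).coeff k = star (p.coeff (-k)) := by
  induction p using AddMonoidAlgebra.induction_linear with
  | zero => simp [dagger_zero]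
  | add p q hp hq => simp only [dagger_add, AddMonoidAlgebra.coeff_add, Finsupp.add_apply, hp, hq, star_add]
  | single l a =>
    rw [dagger_single, coeff_single_apply', coeff_single_apply']
    by_cases h : l = -k
    · simp [h]
    · rw [if_neg h, if_neg (fun h' => h (by rw [← h', neg_neg])), star_zero]

theorem dagger_dagger (p : Laurent) : dagger (dagger p) = p :=
  laurent_ext fun k => by rw [coeff_dagger, coeff_dagger, neg_neg, star_star]

theorem dagger_smul (a : ℂ) (p : Laurent) : dagger (a • p) = star a • dagger p :=
  laurent_ext fun k => by
    simp [coeff_dagger]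

theorem dagger_neg (p : Laurent) : dagger (-p) = -dagger p :=
  laurent_ext fun k => by simp [coeff_dagger]

theorem dagger_sub (p q : Laurent) : dagger (p - q) = dagger p - dagger q := by
  rw [sub_eq_add_neg, dagger_add, dagger_neg, sub_eq_add_neg]

theorem dagger_mul (p q : Laurent) : dagger (p * q) = dagger p * dagger q := by
  induction p using AddMonoidAlgebra.induction_linear with
  | zero => simp [dagger_zero]
  | add p p' hp hp' => simp only [add_mul, dagger_add, hp, hp']
  | single k a =>
    induction q using AddMonoidAlgebra.induction_linear with
    | zero => simp [dagger_zero]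
    | add p p' hp hp' => simp only [mul_add, dagger_add, hp, hp']
    | single l b =>
      simp only [AddMonoidAlgebra.single_mul_single, dagger_single, star_mul', neg_add]

theorem dagger_mono (i j : ℤ) : dagger (mono i j) = mono (-i) (-j) := by
  rw [mono, dagger_single, star_one]
  rfl

theorem mono_mul_mono (i j k l : ℤ) : mono i j * mono k l = mono (i + k) (j + l) := by
  simp [mono, AddMonoidAlgebra.single_mul_single]

theorem mono_zero_zero : mono 0 0 = 1 := rfl

theorem coeff_mono (i j : ℤ) (k : ℤ × ℤ) : (mono i j).coeff k = if (i, j) = k then 1 else 0 :=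
  coeff_single_apply' _ _ _

theorem coeff_mono_mul (i j : ℤ) (p : Laurent) (k : ℤ × ℤ) :
    (mono i j * p).coeff k = p.coeff (k - (i, j)) := by
  rw [mono, AddMonoidAlgebra.coeff_single_mul_apply, one_mul]
  congr 1
  abel

theorem coeff_rev (n m : ℕ) (p : Laurent) (k : ℤ × ℤ) :
    (rev n m p).coeff k = star (p.coeff (((n : ℤ), (m : ℤ)) - k)) := by
  rw [rev, coeff_mono_mul, coeff_dagger, neg_sub]

theorem rev_add (n m : ℕ) (p q : Laurent) : rev n m (p + q) = rev n m p + rev n m q := by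
  simp only [rev, dagger_add, mul_add]

theorem rev_sub (n m : ℕ) (p q : Laurent) : rev n m (p - q) = rev n m p - rev n m q := by
  simp only [rev, dagger_sub, mul_sub]

theorem rev_smul (n m : ℕ) (a : ℂ) (p : Laurent) : rev n m (a • p) = star a • rev n m p := by
  simp only [rev, dagger_smul, mul_smul_comm]

theorem rev_zero (n m : ℕ) : rev n m 0 = 0 := by
  simp only [rev, dagger_zero, mul_zero]

theorem rev_rev (n m : ℕ) (p : Laurent) : rev n m (rev n m p) = p :=
  laurent_ext fun k => by rw [coeff_rev, coeff_rev, sub_sub_cancel, star_star]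

theorem rev_sum {ι : Type*} (n m : ℕ) (s : Finset ι) (f : ι → Laurent) :
    rev n m (∑ x ∈ s, f x) = ∑ x ∈ s, rev n m (f x) := by
  classical
  induction s using Finset.induction_on with
  | empty => simp [rev_zero]
  | insert a s ha ih => rw [Finset.sum_insert ha, Finset.sum_insert ha, rev_add, ih]

/-- Multiplication by `z ^ a * w ^ b` before reversing in a larger degree. -/
theorem rev_mono_mul (a b n m : ℕ) (p : Laurent) :
    rev (n + a) (m + b) (mono a b * p) = rev n m p := by
  rw [rev, rev, dagger_mul, dagger_mono, ← mul_assoc, mono_mul_mono]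
  push_cast
  simp

theorem rev_eq_mono_mul_rev (a b n m : ℕ) (p : Laurent) :
    rev (n + a) (m + b) p = mono a b * rev n m p := by
  rw [rev, rev, ← mul_assoc, mono_mul_mono]
  push_cast
  rw [add_comm (n : ℤ), add_comm (m : ℤ)]

/-- The Laurent polynomials all of whose exponents lie in `S`. -/
def spc (S : Set (ℤ × ℤ)) : Submodule ℂ Laurent where
  carrier := {p | ∀ k, k ∉ S → p.coeff k = 0}
  zero_mem' := fun k _ => by simp
  add_mem' := fun {p q} hp hq k hk => by
    rw [AddMonoidAlgebra.coeff_add, Finsupp.add_apply, hp k hk, hq k hk, add_zero]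
  smul_mem' := fun a p hp k hk => by
    rw [AddMonoidAlgebra.coeff_smul_apply, hp k hk, smul_zero]

theorem spc_mono {S T : Set (ℤ × ℤ)} (h : S ⊆ T) : spc S ≤ spc T :=
  fun _ hp k hk => hp k fun h' => hk (h h')

theorem mono_mem_spc {S : Set (ℤ × ℤ)} {i j : ℤ} (h : (i, j) ∈ S) : mono i j ∈ spc S := by
  intro k hk
  rw [coeff_mono, if_neg]
  rintro rfl
  exact hk h

theorem mono_mul_mem_spc {S T : Set (ℤ × ℤ)} {i j : ℤ} {p : Laurent} (hp : p ∈ spc S)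
    (h : ∀ k ∈ S, k + (i, j) ∈ T) : mono i j * p ∈ spc T := by
  intro k hk
  rw [coeff_mono_mul]
  refine hp _ fun h' => hk ?_
  simpa using h _ h'

theorem rev_mem_spc {S T : Set (ℤ × ℤ)} {n m : ℕ} {p : Laurent} (hp : p ∈ spc S)
    (h : ∀ k ∈ S, ((n : ℤ), (m : ℤ)) - k ∈ T) : rev n m p ∈ spc T := by
  intro k hk
  rw [coeff_rev, hp, star_zero]
  intro h'
  apply hk
  simpa using h _ h'

theorem laurent_eq_sum_mono (p : Laurent) :
    p = ∑ k ∈ p.coeff.support, p.coeff k • mono k.1 k.2 := by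
  conv_lhs => rw [← AddMonoidAlgebra.sum_coeff_single p, Finsupp.sum]
  refine Finset.sum_congr rfl fun k _ => ?_
  rw [mono, AddMonoidAlgebra.smul_single, smul_eq_mul, mul_one]

theorem mem_of_forall_mono_mem {S : Set (ℤ × ℤ)} {V : Submodule ℂ Laurent}
    (h : ∀ k ∈ S, mono k.1 k.2 ∈ V) : spc S ≤ V := by
  intro p hp
  rw [laurent_eq_sum_mono p]
  refine Submodule.sum_mem _ fun k hk => V.smul_mem _ (h k ?_)
  by_contra hS
  exact (Finsupp.mem_support_iff.mp hk) (hp k hS)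

/-! ## Linear functionals given by moments -/

/-- The linear functional with `z ^ i * w ^ j ↦ c (i, j)`. -/
noncomputable def functional (c : ℤ × ℤ → ℂ) : Laurent →ₗ[ℂ] ℂ :=
  Finsupp.linearCombination ℂ c ∘ₗ (AddMonoidAlgebra.coeffLinearEquiv ℂ).toLinearMap

theorem functional_apply (c : ℤ × ℤ → ℂ) (p : Laurent) :
    functional c p = ∑ k ∈ p.coeff.support, p.coeff k * c k := rfl

theorem functional_single (c : ℤ × ℤ → ℂ) (k : ℤ × ℤ) (a : ℂ) :
    functional c (AddMonoidAlgebra.single k a) = a * c k := by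
  simp [functional]

theorem functional_mono (c : ℤ × ℤ → ℂ) (i j : ℤ) : functional c (mono i j) = c (i, j) := by
  rw [mono, functional_single, one_mul]

/-- `c (-k) = conj (c k)`. -/
def IsHerm (c : ℤ × ℤ → ℂ) : Prop := ∀ k, c (-k) = star (c k)

theorem functional_dagger {c : ℤ × ℤ → ℂ} (hc : IsHerm c) (p : Laurent) :
    functional c (dagger p) = star (functional c p) := by
  induction p using AddMonoidAlgebra.induction_linear with
  | zero => simp [dagger_zero]
  | add p q hp hq => rw [dagger_add, map_add, map_add, hp, hq, star_add]
  | single k a => rw [dagger_single, functional_single, functional_single, hc, star_mul']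

/-- The sesquilinear form `(p, q) ↦ L (p q†)`. -/
noncomputable def pair (c : ℤ × ℤ → ℂ) (p q : Laurent) : ℂ := functional c (p * dagger q)

section Pair

variable (c : ℤ × ℤ → ℂ)

theorem pair_add_left (p p' q : Laurent) : pair c (p + p') q = pair c p q + pair c p' q := by
  simp only [pair, add_mul, map_add]

theorem pair_sub_left (p p' q : Laurent) : pair c (p - p') q = pair c p q - pair c p' q := by
  simp only [pair, sub_mul, map_sub]

theorem pair_smul_left (a : ℂ) (p q : Laurent) : pair c (a • p) q = a * pair c p q := by
  simp only [pair, smul_mul_assoc, map_smul, smul_eq_mul]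

theorem pair_zero_left (q : Laurent) : pair c 0 q = 0 := by
  simp only [pair, zero_mul, map_zero]

theorem pair_add_right (p q q' : Laurent) : pair c p (q + q') = pair c p q + pair c p q' := by
  simp only [pair, dagger_add, mul_add, map_add]

theorem pair_sub_right (p q q' : Laurent) : pair c p (q - q') = pair c p q - pair c p q' := by
  simp only [pair, dagger_sub, mul_sub, map_sub]

theorem pair_smul_right (a : ℂ) (p q : Laurent) : pair c p (a • q) = star a * pair c p q := by
  simp only [pair, dagger_smul, mul_smul_comm, map_smul, smul_eq_mul]

theorem pair_zero_right (p : Laurent) : pair c p 0 = 0 := by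
  simp only [pair, dagger_zero, mul_zero, map_zero]

theorem pair_sum_left {ι : Type*} (s : Finset ι) (f : ι → Laurent) (q : Laurent) :
    pair c (∑ x ∈ s, f x) q = ∑ x ∈ s, pair c (f x) q := by
  simp only [pair, Finset.sum_mul, map_sum]

theorem pair_sum_right {ι : Type*} (s : Finset ι) (p : Laurent) (f : ι → Laurent) :
    pair c p (∑ x ∈ s, f x) = ∑ x ∈ s, pair c p (f x) := by
  classical
  induction s using Finset.induction_on with
  | empty => simp [pair_zero_right]
  | insert a s ha ih => rw [Finset.sum_insert ha, Finset.sum_insert ha, pair_add_right, ih]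

theorem pair_mono (i j k l : ℤ) : pair c (mono i j) (mono k l) = c (i - k, j - l) := by
  rw [pair, dagger_mono, mono_mul_mono, functional_mono, sub_eq_add_neg, sub_eq_add_neg]

/-- This is the doubly Toeplitz property: on the unit torus monomials have modulus one, so `mono i
j` cancels against its adjoint. -/
theorem pair_mono_mul (i j : ℤ) (p q : Laurent) :
    pair c (mono i j * p) (mono i j * q) = pair c p q := by
  rw [pair, pair, dagger_mul, dagger_mono, mul_mul_mul_comm, mono_mul_mono, add_neg_cancel,
    add_neg_cancel, mono_zero_zero, one_mul]

/-- The monomials cancel and the two daggers interchange the arguments, so reversal is antiunitary.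
No hermitian symmetry of `c` is needed. -/
theorem pair_rev (n m : ℕ) (p q : Laurent) : pair c (rev n m p) (rev n m q) = pair c q p := by
  rw [rev, rev, pair_mono_mul, pair, pair, dagger_dagger, mul_comm]

variable {c}

theorem star_pair (hc : IsHerm c) (p q : Laurent) : star (pair c p q) = pair c q p := by
  rw [pair, ← functional_dagger hc, dagger_mul, dagger_dagger, mul_comm, pair]

theorem pair_eq_zero_of_mono {S : Set (ℤ × ℤ)} {p q : Laurent}
    (h : ∀ k ∈ S, pair c p (mono k.1 k.2) = 0) (hq : q ∈ spc S) : pair c p q = 0 := by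
  rw [laurent_eq_sum_mono q, pair_sum_right]
  refine Finset.sum_eq_zero fun k hk => ?_
  rw [pair_smul_right, h, mul_zero]
  by_contra hS
  exact (Finsupp.mem_support_iff.mp hk) (hq k hS)

end Pair

/-- The form `pair c` is positive definite on the polynomials with exponents in `S`. -/
def PD (c : ℤ × ℤ → ℂ) (S : Set (ℤ × ℤ)) : Prop := ∀ p ∈ spc S, p ≠ 0 → 0 < pair c p p

theorem PD.mono {c : ℤ × ℤ → ℂ} {S T : Set (ℤ × ℤ)} (h : PD c T) (hST : S ⊆ T) : PD c S :=
  fun p hp => h p (spc_mono hST hp)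

theorem PD.eq_zero {c : ℤ × ℤ → ℂ} {S : Set (ℤ × ℤ)} (h : PD c S) {p : Laurent} (hp : p ∈ spc S)
    (h0 : pair c p p = 0) : p = 0 := by
  by_contra hne
  exact (h p hp hne).ne' h0

theorem PD.nonneg {c : ℤ × ℤ → ℂ} {S : Set (ℤ × ℤ)} (h : PD c S) {p : Laurent} (hp : p ∈ spc S) :
    0 ≤ pair c p p := by
  by_cases h0 : p = 0
  · rw [h0, pair_zero_left]
  · exact (h p hp h0).le

/-! ## Lexicographic sections and orthonormal polynomials -/

/-- The exponents in `[0, a] × [0, b]`. -/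
def box (a b : ℤ) : Set (ℤ × ℤ) := {k | 0 ≤ k.1 ∧ k.1 ≤ a ∧ 0 ≤ k.2 ∧ k.2 ≤ b}

/-- The exponents `(a, b)` with `0 ≤ b ≤ j` that precede `(i, s)` lexicographically. -/
def lexSet (i j s : ℤ) : Set (ℤ × ℤ) :=
  {k | 0 ≤ k.1 ∧ 0 ≤ k.2 ∧ k.2 ≤ j ∧ (k.1 < i ∨ (k.1 = i ∧ k.2 < s))}

theorem box_mono {a b a' b' : ℤ} (ha : a ≤ a') (hb : b ≤ b') : box a b ⊆ box a' b' :=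
  fun _ hk => ⟨hk.1, hk.2.1.trans ha, hk.2.2.1, hk.2.2.2.trans hb⟩

theorem finite_box (a b : ℤ) : (box a b).Finite :=
  (Set.finite_Icc ((0 : ℤ), (0 : ℤ)) (a, b)).subset fun _ hk =>
    ⟨⟨hk.1, hk.2.2.1⟩, ⟨hk.2.1, hk.2.2.2⟩⟩

theorem lexSet_subset_box (i j s : ℤ) : lexSet i j s ⊆ box i j := by
  rintro k ⟨h1, h2, h3, h4⟩
  exact ⟨h1, by omega, h2, h3⟩

theorem finite_lexSet (i j s : ℤ) : (lexSet i j s).Finite :=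
  (finite_box i j).subset (lexSet_subset_box i j s)

theorem lexSet_mono {i j s t : ℤ} (h : s ≤ t) : lexSet i j s ⊆ lexSet i j t := by
  rintro k ⟨h1, h2, h3, h4⟩
  exact ⟨h1, h2, h3, by omega⟩

theorem lexSet_zero (i j : ℤ) : lexSet i j 0 = box (i - 1) j := by
  ext k
  simp only [lexSet, box, Set.mem_ofPred_eq]
  omega

theorem lexSet_top (i j : ℤ) : lexSet i j (j + 1) = box i j := by
  ext k
  simp only [lexSet, box, Set.mem_ofPred_eq]
  omega

theorem spc_lexSet_succ {i j s : ℤ} {p : Laurent} (hp : p ∈ spc (lexSet i j (s + 1)))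
    (h0 : p.coeff (i, s) = 0) : p ∈ spc (lexSet i j s) := by
  intro k hk
  by_cases h : k = (i, s)
  · rw [h, h0]
  · refine hp k fun h' => hk ?_
    obtain ⟨h1, h2, h3, h4⟩ := h'
    refine ⟨h1, h2, h3, ?_⟩
    rcases h4 with h4 | h4
    · exact Or.inl h4
    · refine Or.inr ⟨h4.1, lt_of_le_of_ne (by omega) fun h5 => h (Prod.ext h4.1 h5)⟩

/-- A polynomial with leading monomial `z ^ i * w ^ l` (and positive leading coefficient) of norm
one that is orthogonal to all smaller monomials. -/
structure IsPhi (c : ℤ × ℤ → ℂ) (i j l : ℕ) (p : Laurent) : Prop where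
  mem : p ∈ spc (lexSet i j (l + 1))
  pos : 0 < p.coeff ((i : ℤ), (l : ℤ))
  orth : ∀ q ∈ spc (lexSet i j l), pair c p q = 0
  norm : pair c p p = 1

/-- Definiteness makes the linear map from coefficients to pairings with the monomials of `S`
injective. In finite dimension it is then surjective, so the normal equations of the projection are
solvable. -/
theorem exists_projection {c : ℤ × ℤ → ℂ} {S : Set (ℤ × ℤ)} (hS : S.Finite) (h : PD c S)
    (x : Laurent) : ∃ y ∈ spc S, ∀ q ∈ spc S, pair c (x - y) q = 0 := by
  classical
  have : Fintype S := hS.fintype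
  let e : (S → ℂ) → Laurent := fun v => ∑ t : S, v t • mono t.1.1 t.1.2
  have he : ∀ v, e v ∈ spc S := fun v =>
    Submodule.sum_mem _ fun t _ => Submodule.smul_mem _ _ (mono_mem_spc t.2)
  have hcoef : ∀ (v : S → ℂ) (s : S), (e v).coeff s.1 = v s := by
    intro v s
    simp only [e, AddMonoidAlgebra.coeff_sum, Finsupp.finsetSum_apply,
      AddMonoidAlgebra.coeff_smul_apply, coeff_mono]
    rw [Finset.sum_eq_single s]
    · simp
    · intro t _ hts
      rw [if_neg, smul_zero]
      intro h'
      exact hts (Subtype.ext h')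
    · simp
  let T : (S → ℂ) →ₗ[ℂ] (S → ℂ) :=
    { toFun := fun v s => pair c (e v) (mono s.1.1 s.1.2)
      map_add' := fun v v' => by
        ext s
        simp only [e, Pi.add_apply, add_smul, Finset.sum_add_distrib, pair_add_left]
      map_smul' := fun a v => by
        ext s
        simp only [e, Pi.smul_apply, pair_sum_left, pair_smul_left, RingHom.id_apply,
          smul_eq_mul, Finset.mul_sum, mul_assoc] }
  have hinj : Function.Injective T := by
    rw [injective_iff_map_eq_zero]
    intro v hv
    have h1 : pair c (e v) (e v) = 0 :=
      pair_eq_zero_of_mono (fun k hk => congrFun hv ⟨k, hk⟩) (he v)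
    have h2 := h.eq_zero (he v) h1
    ext s
    rw [← hcoef v s, h2]
    rfl
  obtain ⟨v, hv⟩ := (LinearMap.injective_iff_surjective.mp hinj)
    (fun s => pair c x (mono s.1.1 s.1.2))
  refine ⟨e v, he v, fun q hq => pair_eq_zero_of_mono (fun k hk => ?_) hq⟩
  rw [pair_sub_left, sub_eq_zero]
  exact (congrFun hv ⟨k, hk⟩).symm

theorem pair_smul_self (c : ℤ × ℤ → ℂ) (a : ℝ) (p : Laurent) :
    pair c ((a : ℂ) • p) ((a : ℂ) • p) = ((a ^ 2 : ℝ) : ℂ) * pair c p p := by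
  rw [pair_smul_left, pair_smul_right]
  simp only [Complex.star_def, Complex.conj_ofReal]
  push_cast
  ring

theorem pos_eq_ofReal {x : ℂ} (hx : 0 < x) : 0 < x.re ∧ ((x.re : ℝ) : ℂ) = x := by
  rw [Complex.lt_def] at hx
  refine ⟨by simpa using hx.1, Complex.ext (by simp) (by simpa using hx.2)⟩

/-- Normalization of a polynomial orthogonal to the smaller monomials. -/
theorem isPhi_smul {c : ℤ × ℤ → ℂ} {i j l : ℕ} {r : Laurent}
    (hmem : r ∈ spc (lexSet i j (l + 1))) (hpos : 0 < r.coeff ((i : ℤ), (l : ℤ)))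
    (horth : ∀ q ∈ spc (lexSet i j l), pair c r q = 0) (hr : 0 < pair c r r) :
    IsPhi c i j l (((Real.sqrt (pair c r r).re)⁻¹ : ℝ) • r) := by
  obtain ⟨h1, h2⟩ := pos_eq_ofReal hr
  have hs : 0 < Real.sqrt (pair c r r).re := Real.sqrt_pos.mpr h1
  have hcast : ∀ a : ℝ, a • r = (a : ℂ) • r := fun a => (Complex.coe_smul a r).symm
  rw [hcast]
  refine ⟨Submodule.smul_mem _ _ hmem, ?_, fun q hq => ?_, ?_⟩
  · rw [AddMonoidAlgebra.coeff_smul_apply, smul_eq_mul]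
    exact mul_pos (by exact_mod_cast inv_pos.mpr hs) hpos
  · rw [pair_smul_left, horth q hq, mul_zero]
  · rw [pair_smul_self, inv_pow, Real.sq_sqrt h1.le]
    nth_rewrite 2 [← h2]
    rw [← Complex.ofReal_mul, inv_mul_cancel₀ h1.ne', Complex.ofReal_one]

theorem exists_isPhi {c : ℤ × ℤ → ℂ} {i j l : ℕ} (hl : l ≤ j)
    (h : PD c (lexSet i j (l + 1))) : ∃ p, IsPhi c i j l p := by
  obtain ⟨y, hy, hyo⟩ := exists_projection (finite_lexSet i j l)
    (h.mono (lexSet_mono (by omega))) (mono i l)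
  have hmem : mono i l - y ∈ spc (lexSet i j (l + 1)) :=
    Submodule.sub_mem _ (mono_mem_spc ⟨by omega, by omega, by omega, Or.inr ⟨rfl, by omega⟩⟩)
      (spc_mono (lexSet_mono (by omega)) hy)
  have hco : (mono (i : ℤ) (l : ℤ) - y).coeff ((i : ℤ), (l : ℤ)) = 1 := by
    have : y.coeff ((i : ℤ), (l : ℤ)) = 0 := hy _ (by simp [lexSet])
    simp [coeff_mono, this]
  refine ⟨_, isPhi_smul hmem (by rw [hco]; exact zero_lt_one) hyo (h _ hmem ?_)⟩
  intro h0
  rw [h0] at hco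
  simp at hco

/-- With the leading terms matched, the difference is spanned by smaller monomials and also
orthogonal to them, hence zero. The ratio of leading coefficients is positive and, by normalization,
of square one. -/
theorem IsPhi.unique {c : ℤ × ℤ → ℂ} {i j l : ℕ} (h : PD c (lexSet i j (l + 1)))
    {p q : Laurent} (hp : IsPhi c i j l p) (hq : IsPhi c i j l q) : p = q := by
  obtain ⟨a1, a2⟩ := pos_eq_ofReal hp.pos
  obtain ⟨b1, b2⟩ := pos_eq_ofReal hq.pos
  set a := (p.coeff ((i : ℤ), (l : ℤ))).re
  set b := (q.coeff ((i : ℤ), (l : ℤ))).re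
  have hd : p - ((a / b : ℝ) : ℂ) • q ∈ spc (lexSet i j l) := by
    refine spc_lexSet_succ (Submodule.sub_mem _ hp.mem (Submodule.smul_mem _ _ hq.mem)) ?_
    simp only [AddMonoidAlgebra.coeff_sub, Finsupp.sub_apply, AddMonoidAlgebra.coeff_smul_apply]
    rw [← a2, ← b2, smul_eq_mul, ← Complex.ofReal_mul, ← Complex.ofReal_sub,
      div_mul_cancel₀ _ b1.ne', sub_self, Complex.ofReal_zero]
  have h0 : p - ((a / b : ℝ) : ℂ) • q = 0 := by
    refine (h.mono (lexSet_mono (by omega))).eq_zero hd ?_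
    rw [pair_sub_left, pair_smul_left, hp.orth _ hd, hq.orth _ hd, mul_zero, sub_zero]
  have h1 : p = ((a / b : ℝ) : ℂ) • q := sub_eq_zero.mp h0
  have h2 : ((a / b) ^ 2 : ℝ) = 1 := by
    have := hp.norm
    rw [h1, pair_smul_self, hq.norm, mul_one] at this
    exact_mod_cast this
  have h3 : a / b = 1 := by
    have : 0 < a / b := div_pos a1 b1
    nlinarith
  rw [h1, h3, Complex.ofReal_one, one_smul]

open Classical in
/-- The orthonormal polynomial `φ_{i,j}^l`. -/
noncomputable def phi (c : ℤ × ℤ → ℂ) (i j l : ℕ) : Laurent :=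
  if h : ∃ p, IsPhi c i j l p then h.choose else 0

theorem isPhi_phi {c : ℤ × ℤ → ℂ} {i j l : ℕ} (hl : l ≤ j) (h : PD c (lexSet i j (l + 1))) :
    IsPhi c i j l (phi c i j l) := by
  have h' := exists_isPhi hl h
  rw [phi, dif_pos h']
  exact h'.choose_spec

theorem IsPhi.eq_phi {c : ℤ × ℤ → ℂ} {i j l : ℕ} {p : Laurent} (hl : l ≤ j)
    (h : PD c (lexSet i j (l + 1))) (hp : IsPhi c i j l p) : p = phi c i j l :=
  hp.unique h (isPhi_phi hl h)

/-! ## Columns of polynomials -/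

section Columns

variable {k l r s : ℕ}

/-- The Gram matrix of two columns of polynomials. -/
noncomputable def gram (c : ℤ × ℤ → ℂ) (p : Fin k → Laurent) (q : Fin l → Laurent) :
    Matrix (Fin k) (Fin l) ℂ := Matrix.of fun a b => pair c (p a) (q b)

/-- Multiplication of a column by `z ^ a * w ^ b`. -/
noncomputable def shift (a b : ℤ) (p : Fin k → Laurent) : Fin k → Laurent :=
  fun x => mono a b * p x

/-- The column of the reverse polynomials. -/
noncomputable def revF (n m : ℕ) (p : Fin k → Laurent) : Fin k → Laurent :=
  fun x => rev n m (p x)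

theorem act_apply (M : Matrix (Fin k) (Fin l) ℂ) (v : Fin l → Laurent) (x : Fin k) :
    act M v x = ∑ y, M x y • v y := rfl

theorem act_one (v : Fin k → Laurent) : act 1 v = v := by
  ext x : 1
  simp [act, Matrix.one_apply, ite_smul]

theorem act_mul (M : Matrix (Fin k) (Fin l) ℂ) (N : Matrix (Fin l) (Fin r) ℂ)
    (v : Fin r → Laurent) : act (M * N) v = act M (act N v) := by
  ext x : 1
  simp only [act, Matrix.mul_apply, Finset.sum_smul, Finset.smul_sum]
  rw [Finset.sum_comm]
  simp only [smul_smul]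

theorem act_sub (M : Matrix (Fin k) (Fin l) ℂ) (v v' : Fin l → Laurent) :
    act M (v - v') = act M v - act M v' := by
  ext x : 1
  simp [act, smul_sub, Finset.sum_sub_distrib]

theorem act_zero_mat (v : Fin l → Laurent) : act (0 : Matrix (Fin k) (Fin l) ℂ) v = 0 := by
  ext x : 1
  simp [act]

theorem shift_act (a b : ℤ) (M : Matrix (Fin k) (Fin l) ℂ) (v : Fin l → Laurent) :
    shift a b (act M v) = act M (shift a b v) := by
  ext x : 1
  simp [act, shift, Finset.mul_sum]

theorem shift_sub (a b : ℤ) (v v' : Fin l → Laurent) :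
    shift a b (v - v') = shift a b v - shift a b v' := by
  ext x : 1
  simp [shift, mul_sub]

theorem shift_add (a b : ℤ) (v v' : Fin l → Laurent) :
    shift a b (v + v') = shift a b v + shift a b v' := by
  ext x : 1
  simp [shift, mul_add]

theorem revF_act (n m : ℕ) (M : Matrix (Fin k) (Fin l) ℂ) (v : Fin l → Laurent) :
    revF n m (act M v) = act (conjM M) (revF n m v) := by
  ext x : 1
  simp [act, revF, rev_sum, rev_smul, conjM]

theorem revF_sub (n m : ℕ) (v v' : Fin l → Laurent) :
    revF n m (v - v') = revF n m v - revF n m v' := by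
  ext x : 1
  simp [revF, rev_sub]

theorem revF_add (n m : ℕ) (v v' : Fin l → Laurent) :
    revF n m (v + v') = revF n m v + revF n m v' := by
  ext x : 1
  simp [revF, rev_add]

theorem revF_revF (n m : ℕ) (v : Fin l → Laurent) : revF n m (revF n m v) = v := by
  ext x : 1
  simp [revF, rev_rev]

theorem act_mem (M : Matrix (Fin k) (Fin l) ℂ) {v : Fin l → Laurent} {V : Submodule ℂ Laurent}
    (h : ∀ y, v y ∈ V) (x : Fin k) : act M v x ∈ V :=
  Submodule.sum_mem _ fun y _ => V.smul_mem _ (h y)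

variable (c : ℤ × ℤ → ℂ)

theorem gram_apply (p : Fin k → Laurent) (q : Fin l → Laurent) (a : Fin k) (b : Fin l) :
    gram c p q a b = pair c (p a) (q b) := rfl

theorem gram_act_left (M : Matrix (Fin r) (Fin k) ℂ) (p : Fin k → Laurent)
    (q : Fin l → Laurent) : gram c (act M p) q = M * gram c p q := by
  ext a b
  simp [gram, act, Matrix.mul_apply, pair_sum_left, pair_smul_left]

theorem gram_act_right (M : Matrix (Fin r) (Fin l) ℂ) (p : Fin k → Laurent)
    (q : Fin l → Laurent) : gram c p (act M q) = gram c p q * Mᴴ := by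
  ext a b
  simp [gram, act, Matrix.mul_apply, pair_sum_right, pair_smul_right, mul_comm]

theorem gram_add_left (p p' : Fin k → Laurent) (q : Fin l → Laurent) :
    gram c (p + p') q = gram c p q + gram c p' q := by
  ext a b
  simp [gram, pair_add_left]

theorem gram_sub_left (p p' : Fin k → Laurent) (q : Fin l → Laurent) :
    gram c (p - p') q = gram c p q - gram c p' q := by
  ext a b
  simp [gram, pair_sub_left]

theorem gram_add_right (p : Fin k → Laurent) (q q' : Fin l → Laurent) :
    gram c p (q + q') = gram c p q + gram c p q' := by
  ext a b
  simp [gram, pair_add_right]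

theorem gram_sub_right (p : Fin k → Laurent) (q q' : Fin l → Laurent) :
    gram c p (q - q') = gram c p q - gram c p q' := by
  ext a b
  simp [gram, pair_sub_right]

theorem gram_shift (i j : ℤ) (p : Fin k → Laurent) (q : Fin l → Laurent) :
    gram c (shift i j p) (shift i j q) = gram c p q := by
  ext a b
  simp [gram, shift, pair_mono_mul]

theorem gram_revF (n m : ℕ) (p : Fin k → Laurent) (q : Fin l → Laurent) :
    gram c (revF n m p) (revF n m q) = (gram c q p)ᵀ := by
  ext a b
  simp [gram, revF, pair_rev]

variable {c}

theorem gram_conjTranspose (hc : IsHerm c) (p : Fin k → Laurent) (q : Fin l → Laurent) :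
    (gram c p q)ᴴ = gram c q p := by
  ext a b
  simp only [gram, conjTranspose_apply, of_apply, star_pair hc]

theorem gram_eq_zero {p : Fin k → Laurent} {q : Fin l → Laurent}
    (h : ∀ a b, pair c (p a) (q b) = 0) : gram c p q = 0 := by
  ext a b
  exact h a b

/-- Insertion of an orthonormal column. -/
theorem gram_eq_mul (hc : IsHerm c) {S : Set (ℤ × ℤ)} {x : Fin k → Laurent} {y : Fin l → Laurent}
    {e : Fin r → Laurent} (hy : ∀ b, (y - act (gram c y e) e) b ∈ spc S)
    (hx : ∀ a, ∀ q ∈ spc S, pair c (x a) q = 0) :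
    gram c x y = gram c x e * gram c e y := by
  -- Up to polynomials on which `x` vanishes, `y` equals its expansion in `e`; only that expansion
  -- is seen by `x`.
  have h : gram c x (y - act (gram c y e) e) = 0 := gram_eq_zero fun a b => hx a _ (hy b)
  rw [gram_sub_right, gram_act_right, sub_eq_zero, gram_conjTranspose hc] at h
  exact h

theorem gram_eq_mul' (hc : IsHerm c) {S : Set (ℤ × ℤ)} {x : Fin k → Laurent} {y : Fin l → Laurent}
    {e : Fin r → Laurent} (hx : ∀ a, (x - act (gram c x e) e) a ∈ spc S)
    (hy : ∀ b, ∀ q ∈ spc S, pair c (y b) q = 0) :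
    gram c x y = gram c x e * gram c e y := by
  have h := gram_eq_mul hc hx hy
  rw [← gram_conjTranspose hc, h, conjTranspose_mul, gram_conjTranspose hc, gram_conjTranspose hc]

end Columns

/-! ## Triangular matrices with positive diagonal -/

/-- Upper triangular with positive diagonal. -/
structure IsUpperPos {k : ℕ} (B : Matrix (Fin k) (Fin k) ℂ) : Prop where
  upper : ∀ i j, j < i → B i j = 0
  pos : ∀ i, 0 < B i i

section Triangular

variable {k : ℕ} {B C : Matrix (Fin k) (Fin k) ℂ}

theorem IsUpperPos.blockTriangular (h : IsUpperPos B) : B.BlockTriangular id :=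
  fun i j hij => h.upper i j hij

theorem IsUpperPos.isUnit_det (h : IsUpperPos B) : IsUnit B.det := by
  rw [Matrix.det_of_isUpperTriangular h.blockTriangular, isUnit_iff_ne_zero]
  exact Finset.prod_ne_zero_iff.mpr fun i _ => (h.pos i).ne'

/-- The quotient `C⁻¹ B` is upper triangular and unitary. Its inverse is upper triangular too and
equals its adjoint, so the quotient is diagonal, with positive entries of modulus one. -/
theorem IsUpperPos.eq_of_mul_conjTranspose (hB : IsUpperPos B) (hC : IsUpperPos C)
    (h : B * Bᴴ = C * Cᴴ) : B = C := by
  have hCu := hC.isUnit_det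
  let _ : Invertible C := C.invertibleOfIsUnitDet hCu
  set T := C⁻¹ * B with hT
  have hBT : B = C * T := by rw [hT, Matrix.mul_nonsing_inv_cancel_left _ _ hCu]
  have hTu : T.BlockTriangular id :=
    (Matrix.blockTriangular_inv_of_blockTriangular hC.blockTriangular).mul hB.blockTriangular
  have hTT : T * Tᴴ = 1 := by
    rw [hT, conjTranspose_mul, Matrix.mul_assoc, ← Matrix.mul_assoc B, h, Matrix.mul_assoc,
      ← Matrix.mul_assoc, Matrix.nonsing_inv_mul _ hCu, Matrix.one_mul, ← conjTranspose_mul,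
      Matrix.nonsing_inv_mul _ hCu, conjTranspose_one]
  have hTi : T⁻¹ = Tᴴ := Matrix.inv_eq_right_inv hTT
  let _ : Invertible T := invertibleOfRightInverse T _ hTT
  have hTl : (Tᴴ).BlockTriangular id := by
    rw [← hTi]
    exact Matrix.blockTriangular_inv_of_blockTriangular hTu
  have hoff : ∀ i j, i ≠ j → T i j = 0 := by
    intro i j hij
    rcases lt_or_gt_of_ne hij with h1 | h1
    · have : Tᴴ j i = 0 := hTl h1
      rwa [conjTranspose_apply, star_eq_zero] at this
    · exact hTu h1
  have hdiag : ∀ i, T i i = 1 := by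
    intro i
    have h1 : B i i = C i i * T i i := by
      rw [hBT, Matrix.mul_apply, Finset.sum_eq_single i]
      · intro j _ hji
        rw [hoff j i hji, mul_zero]
      · simp
    have h2 : T i i * star (T i i) = 1 := by
      have := congrFun (congrFun hTT i) i
      rw [Matrix.mul_apply, Finset.sum_eq_single i] at this
      · simpa using this
      · intro j _ hji
        rw [hoff i j hji.symm, zero_mul]
      · simp
    obtain ⟨b1, b2⟩ := pos_eq_ofReal (hB.pos i)
    obtain ⟨c1, c2⟩ := pos_eq_ofReal (hC.pos i)
    rw [← b2, ← c2] at h1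
    have h3 : T i i = (((B i i).re / (C i i).re : ℝ) : ℂ) := by
      have : (((C i i).re : ℝ) : ℂ) ≠ 0 := by exact_mod_cast c1.ne'
      push_cast
      rw [h1, mul_div_cancel_left₀ _ this]
    rw [h3] at h2 ⊢
    have h4 : 0 < (B i i).re / (C i i).re := div_pos b1 c1
    rw [Complex.star_def, Complex.conj_ofReal] at h2
    have h5 : (B i i).re / (C i i).re * ((B i i).re / (C i i).re) = 1 := by exact_mod_cast h2
    have h6 : (B i i).re / (C i i).re = 1 := by nlinarith
    rw [h6, Complex.ofReal_one]
  have hT1 : T = 1 := by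
    ext i j
    by_cases hij : i = j
    · rw [hij, hdiag, Matrix.one_apply_eq]
    · rw [hoff i j hij, Matrix.one_apply_ne hij]
  rw [hBT, hT1, Matrix.mul_one]

/-- Lets a triangular Gram matrix be recognized as the Cholesky factor that the algorithm takes. -/
theorem upperCholesky_eq {M : Matrix (Fin k) (Fin k) ℂ} (hB : IsUpperPos B) (h : M = B * Bᴴ) :
    upperCholesky M = B := by
  have hex : ∃ B, IsUpperCholesky M B := ⟨B, hB.upper, hB.pos, h⟩
  rw [upperCholesky, dif_pos hex]
  obtain ⟨h1, h2, h3⟩ := hex.choose_spec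
  exact IsUpperPos.eq_of_mul_conjTranspose ⟨h1, h2⟩ hB (h3.symm.trans h)

end Triangular

/-! ## Columns of orthonormal polynomials -/

/-- The column `[φ_{i,j}^{s-1}, …, φ_{i,j}^0]ᵀ`. -/
noncomputable def phiFam (c : ℤ × ℤ → ℂ) (i j s : ℕ) : Fin s → Laurent :=
  fun k => phi c i j (s - 1 - k)

/-- The matrix of the coefficients of `z ^ i * [w ^ (s-1), …, 1]ᵀ`. -/
def leadF {k : ℕ} (i : ℤ) (s : ℕ) (v : Fin k → Laurent) : Matrix (Fin k) (Fin s) ℂ :=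
  Matrix.of fun a b => (v a).coeff (i, (s : ℤ) - 1 - (b : ℕ))

theorem lead_eq_leadF (n m : ℕ) (v : Fin (m + 1) → Laurent) : lead n m v = leadF n (m + 1) v := by
  ext a b
  simp [lead, leadF]

section LeadF

variable {k l s : ℕ} {i : ℤ}

theorem leadF_act (M : Matrix (Fin k) (Fin l) ℂ) (v : Fin l → Laurent) :
    leadF i s (act M v) = M * leadF i s v := by
  ext a b
  simp [leadF, act, Matrix.mul_apply, AddMonoidAlgebra.coeff_sum, Finsupp.finsetSum_apply]

theorem leadF_sub (v v' : Fin k → Laurent) :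
    leadF i s (v - v') = leadF i s v - leadF i s v' := by
  ext a b
  simp [leadF]

theorem mem_box_of_leadF_eq_zero {j : ℤ} {y : Fin k → Laurent}
    (hy : ∀ a, y a ∈ spc (lexSet i j s)) (h : leadF i s y = 0) (a : Fin k) :
    y a ∈ spc (box (i - 1) j) := by
  rw [← lexSet_zero]
  intro x hx
  by_cases hS : x ∈ lexSet i j s
  · obtain ⟨h1, h2, h3, h4⟩ := hS
    have h5 : ¬ x.1 < i := fun h5 => hx ⟨h1, h2, h3, Or.inl h5⟩
    have h6 : x.1 = i ∧ x.2 < s := by omega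
    have h7 := congrFun (congrFun h a) ⟨s - 1 - x.2.toNat, by omega⟩
    simp only [leadF, of_apply, Matrix.zero_apply] at h7
    rw [← h7]
    congr 1
    refine Prod.ext h6.1 ?_
    simp only
    omega
  · exact hy a x hS

end LeadF

section Fam

variable {c : ℤ × ℤ → ℂ} {i j s k : ℕ}

theorem isPhi_phiFam (hs : s ≤ j + 1) (h : PD c (lexSet i j s)) (a : Fin s) :
    IsPhi c i j (s - 1 - a) (phiFam c i j s a) :=
  isPhi_phi (by omega) (h.mono (lexSet_mono (by omega)))

theorem phiFam_mem (hs : s ≤ j + 1) (h : PD c (lexSet i j s)) (a : Fin s) :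
    phiFam c i j s a ∈ spc (lexSet i j s) :=
  spc_mono (lexSet_mono (by omega)) (isPhi_phiFam hs h a).mem

theorem phiFam_orth (hs : s ≤ j + 1) (h : PD c (lexSet i j s)) (a : Fin s) {q : Laurent}
    (hq : q ∈ spc (box ((i : ℤ) - 1) j)) : pair c (phiFam c i j s a) q = 0 :=
  (isPhi_phiFam hs h a).orth q
    (spc_mono (by rw [← lexSet_zero]; exact lexSet_mono (by omega)) hq)

theorem gram_phiFam (hc : IsHerm c) (hs : s ≤ j + 1) (h : PD c (lexSet i j s)) :
    gram c (phiFam c i j s) (phiFam c i j s) = 1 := by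
  -- Leading monomials decrease along the column, so each entry is orthogonal to all later ones.
  have key : ∀ a b : Fin s, a < b → pair c (phiFam c i j s a) (phiFam c i j s b) = 0 := by
    intro a b hab
    exact (isPhi_phiFam hs h a).orth _
      (spc_mono (lexSet_mono (by omega)) (isPhi_phiFam hs h b).mem)
  ext a b
  rw [gram_apply]
  rcases lt_trichotomy a b with hab | hab | hab
  · rw [key a b hab, Matrix.one_apply_ne hab.ne]
  · rw [hab, Matrix.one_apply_eq]
    exact (isPhi_phiFam hs h b).norm
  · rw [← star_pair hc, key b a hab, Matrix.one_apply_ne hab.ne', star_zero]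

theorem isUpperPos_leadF {y : Fin s → Laurent}
    (hy : ∀ a : Fin s, y a ∈ spc (lexSet i j (s - (a : ℕ))))
    (hpos : ∀ a : Fin s, 0 < (y a).coeff ((i : ℤ), (s : ℤ) - 1 - (a : ℕ))) :
    IsUpperPos (leadF i s y) := by
  refine ⟨fun a b hab => hy a _ ?_, hpos⟩
  simp only [lexSet, Set.mem_ofPred_eq]
  omega

theorem isUpperPos_leadF_phiFam (hs : s ≤ j + 1) (h : PD c (lexSet i j s)) :
    IsUpperPos (leadF i s (phiFam c i j s)) := by
  refine isUpperPos_leadF (j := j) (fun a => ?_) fun a => ?_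
  · have := (isPhi_phiFam hs h a).mem
    rwa [show (((s - 1 - a : ℕ) : ℤ) + 1) = (s : ℤ) - (a : ℕ) by omega] at this
  · have := (isPhi_phiFam hs h a).pos
    rwa [show ((s - 1 - a : ℕ) : ℤ) = (s : ℤ) - 1 - (a : ℕ) by omega] at this

/-- The leading coefficient matrix of the column is triangular and invertible, so some matrix
multiple of the column removes all terms with `z ^ i` from `y`. Pairing the remainder with the
column shows that this matrix is the Gram matrix. -/
theorem phiFam_decomp (hc : IsHerm c) (hs : s ≤ j + 1) (h : PD c (lexSet i j s))
    {y : Fin k → Laurent} (hy : ∀ a, y a ∈ spc (lexSet i j s)) (a : Fin k) :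
    (y - act (gram c y (phiFam c i j s)) (phiFam c i j s)) a ∈ spc (box ((i : ℤ) - 1) j) := by
  set e := phiFam c i j s
  have hu := (isUpperPos_leadF_phiFam hs h).isUnit_det
  set M := leadF i s y * (leadF i s e)⁻¹ with hM
  have h1 : ∀ a, (y - act M e) a ∈ spc (box ((i : ℤ) - 1) j) := by
    refine mem_box_of_leadF_eq_zero (fun a => Submodule.sub_mem _ (hy a)
      (act_mem M (phiFam_mem hs h) a)) ?_
    rw [leadF_sub, leadF_act, hM, Matrix.nonsing_inv_mul_cancel_right _ _ hu, sub_self]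
  have h2 : gram c (y - act M e) e = 0 := by
    rw [← gram_conjTranspose hc, gram_eq_zero fun a b => phiFam_orth hs h a (h1 b),
      conjTranspose_zero]
  rw [gram_sub_left, gram_act_left, gram_phiFam hc hs h, Matrix.mul_one, sub_eq_zero] at h2
  rw [h2]
  exact h1 a

/-- The remainder of `phiFam_decomp` lies in a space to which it is also orthogonal. -/
theorem phiFam_expand (hc : IsHerm c) (hs : s ≤ j + 1) (h : PD c (lexSet i j s))
    {y : Fin k → Laurent} (hy : ∀ a, y a ∈ spc (lexSet i j s))
    (ho : ∀ a, ∀ q ∈ spc (box ((i : ℤ) - 1) j), pair c (y a) q = 0) :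
    y = act (gram c y (phiFam c i j s)) (phiFam c i j s) := by
  have h1 := phiFam_decomp hc hs h hy
  rw [← sub_eq_zero]
  ext a : 1
  refine (h.mono ?_).eq_zero (h1 a) ?_
  · rw [← lexSet_zero]
    exact lexSet_mono (by omega)
  · set r := (y - act (gram c y (phiFam c i j s)) (phiFam c i j s)) a with hr
    have : r = y a - act (gram c y (phiFam c i j s)) (phiFam c i j s) a := rfl
    rw [this, pair_sub_left, ← this, ho a r (h1 a), act_apply, pair_sum_left, zero_sub, neg_eq_zero]
    refine Finset.sum_eq_zero fun b _ => ?_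
    rw [pair_smul_left, phiFam_orth hs h b (h1 a), mul_zero]

/-- Gram matrices of columns with the same leading monomials are triangular. -/
theorem isUpperPos_gram_phiFam (hc : IsHerm c) (hs : s ≤ j + 1) (h : PD c (lexSet i j s))
    {y : Fin s → Laurent} (hy : ∀ a : Fin s, y a ∈ spc (lexSet i j (s - (a : ℕ))))
    (hpos : ∀ a : Fin s, 0 < (y a).coeff ((i : ℤ), (s : ℤ) - 1 - (a : ℕ))) :
    IsUpperPos (gram c y (phiFam c i j s)) := by
  refine ⟨fun a b hab => ?_, fun a => ?_⟩
  · rw [gram_apply, ← star_pair hc, (isPhi_phiFam hs h b).orth, star_zero]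
    exact spc_mono (lexSet_mono (by omega)) (hy a)
  · have hφ := isPhi_phiFam hs h a
    set e := phiFam c i j s a
    have e1 : ((s - 1 - a : ℕ) : ℤ) = (s : ℤ) - 1 - (a : ℕ) := by omega
    have hp := hφ.pos
    have hm := hφ.mem
    rw [e1] at hp hm
    set t := (y a).coeff ((i : ℤ), (s : ℤ) - 1 - (a : ℕ)) / e.coeff ((i : ℤ), (s : ℤ) - 1 - (a : ℕ))
      with ht
    -- Subtracting `t • e` cancels the leading term, and what is left is orthogonal to `e`. The
    -- diagonal entry is therefore `t`, a quotient of positive leading coefficients.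
    have hd : y a - t • e ∈ spc (lexSet i j ((s : ℤ) - 1 - (a : ℕ))) := by
      refine spc_lexSet_succ (Submodule.sub_mem _ ?_ (Submodule.smul_mem _ _ hm)) ?_
      · exact spc_mono (lexSet_mono (by omega)) (hy a)
      · rw [AddMonoidAlgebra.coeff_sub, Finsupp.sub_apply, AddMonoidAlgebra.coeff_smul_apply,
          smul_eq_mul, ht, div_mul_cancel₀ _ hp.ne', sub_self]
    have h0 : pair c (y a - t • e) e = 0 := by
      rw [← star_pair hc, hφ.orth _ (by rw [e1]; exact hd), star_zero]
    rw [pair_sub_left, pair_smul_left, hφ.norm, mul_one, sub_eq_zero] at h0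
    rw [gram_apply, h0, ht]
    exact div_pos (hpos a) hp

end Fam

/-! ## Interchange of the variables -/

/-- The moments of the functional with interchanged variables. -/
def sw (c : ℤ × ℤ → ℂ) : ℤ × ℤ → ℂ := fun k => c (k.2, k.1)

/-- Interchange of the variables `z` and `w`. -/
noncomputable def flip : Laurent ≃ₐ[ℂ] Laurent :=
  AddMonoidAlgebra.domCongr ℂ ℂ AddEquiv.prodComm

theorem coeff_flip (p : Laurent) (k : ℤ × ℤ) : (flip p).coeff k = p.coeff (k.2, k.1) := by
  rw [flip, AddMonoidAlgebra.coeff_domCongr]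
  rfl

theorem flip_flip (p : Laurent) : flip (flip p) = p :=
  laurent_ext fun k => by rw [coeff_flip, coeff_flip]

theorem flip_dagger (p : Laurent) : flip (dagger p) = dagger (flip p) :=
  laurent_ext fun k => by
    rw [coeff_flip, coeff_dagger, coeff_dagger, coeff_flip]
    rfl

theorem flip_mono (i j : ℤ) : flip (mono i j) = mono j i :=
  laurent_ext fun k => by
    rw [coeff_flip, coeff_mono, coeff_mono]
    refine if_congr ?_ rfl rfl
    rw [Prod.ext_iff, Prod.ext_iff]
    exact and_comm

theorem flip_rev (n m : ℕ) (p : Laurent) : flip (rev n m p) = rev m n (flip p) := by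
  rw [rev, map_mul, flip_dagger, flip_mono, rev]

theorem functional_flip (c : ℤ × ℤ → ℂ) (p : Laurent) :
    functional (sw c) (flip p) = functional c p := by
  rw [laurent_eq_sum_mono p]
  simp only [map_sum, map_smul, flip_mono, functional_mono, sw]

theorem pair_flip (c : ℤ × ℤ → ℂ) (p q : Laurent) :
    pair (sw c) (flip p) (flip q) = pair c p q := by
  rw [pair, ← flip_dagger, ← map_mul, functional_flip, pair]

theorem IsHerm.sw {c : ℤ × ℤ → ℂ} (hc : IsHerm c) : IsHerm (sw c) := fun k => hc (k.2, k.1)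

/-! ## Rectangles of exponents -/

/-- The exponents in `[a, a'] × [b, b']`. -/
def rect (a a' b b' : ℤ) : Set (ℤ × ℤ) := {k | a ≤ k.1 ∧ k.1 ≤ a' ∧ b ≤ k.2 ∧ k.2 ≤ b'}

/-- All entries of a column have exponents in `S`. -/
def MemF {k : ℕ} (y : Fin k → Laurent) (S : Set (ℤ × ℤ)) : Prop := ∀ x, y x ∈ spc S

/-- All entries of a column are orthogonal to the polynomials with exponents in `S`. -/
def OrthF {k : ℕ} (c : ℤ × ℤ → ℂ) (y : Fin k → Laurent) (S : Set (ℤ × ℤ)) : Prop :=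
  ∀ x, ∀ q ∈ spc S, pair c (y x) q = 0

/-- Interchange of the variables in a column. -/
noncomputable def flipF {k : ℕ} (y : Fin k → Laurent) : Fin k → Laurent := fun x => flip (y x)

section Rect

variable {k l : ℕ} {y v : Fin k → Laurent} {a a' b b' e e' f f' : ℤ} {c : ℤ × ℤ → ℂ}
  {S : Set (ℤ × ℤ)}

theorem flipF_flipF (y : Fin k → Laurent) : flipF (flipF y) = y :=
  funext fun x => flip_flip (y x)

theorem flipF_act (M : Matrix (Fin l) (Fin k) ℂ) (y : Fin k → Laurent) :
    flipF (act M y) = act M (flipF y) := by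
  ext x : 1
  simp [flipF, act]

theorem flipF_sub (y v : Fin k → Laurent) : flipF (y - v) = flipF y - flipF v := by
  ext x : 1
  simp [flipF]

theorem flipF_shift (i j : ℤ) (y : Fin k → Laurent) :
    flipF (shift i j y) = shift j i (flipF y) := by
  ext x : 1
  simp [flipF, shift, flip_mono]

theorem flipF_revF (n m : ℕ) (y : Fin k → Laurent) :
    flipF (revF n m y) = revF m n (flipF y) := by
  ext x : 1
  simp [flipF, revF, flip_rev]

theorem gram_flipF (c : ℤ × ℤ → ℂ) (y : Fin k → Laurent) (q : Fin l → Laurent) :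
    gram (sw c) (flipF y) (flipF q) = gram c y q := by
  ext x x'
  simp [gram, flipF, pair_flip]

theorem rect_mono (h1 : e ≤ a) (h2 : a' ≤ e') (h3 : f ≤ b) (h4 : b' ≤ f') :
    rect a a' b b' ⊆ rect e e' f f' :=
  fun _ hk => ⟨h1.trans hk.1, hk.2.1.trans h2, h3.trans hk.2.2.1, hk.2.2.2.trans h4⟩

theorem MemF.mono_set {T : Set (ℤ × ℤ)} (h : MemF y S) (hST : S ⊆ T) : MemF y T :=
  fun x => spc_mono hST (h x)

theorem MemF.mono (h : MemF y (rect a a' b b')) (h1 : e ≤ a := by omega)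
    (h2 : a' ≤ e' := by omega) (h3 : f ≤ b := by omega) (h4 : b' ≤ f' := by omega) :
    MemF y (rect e e' f f') :=
  h.mono_set (rect_mono h1 h2 h3 h4)

theorem MemF.act (h : MemF y S) (M : Matrix (Fin l) (Fin k) ℂ) : MemF (act M y) S :=
  act_mem M h

theorem MemF.sub (h : MemF y S) (h' : MemF v S) : MemF (y - v) S :=
  fun x => Submodule.sub_mem _ (h x) (h' x)

theorem MemF.shift {i j : ℤ} (h : MemF y (rect a a' b b')) (h1 : e ≤ a + i := by omega)
    (h2 : a' + i ≤ e' := by omega) (h3 : f ≤ b + j := by omega) (h4 : b' + j ≤ f' := by omega) :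
    MemF (shift i j y) (rect e e' f f') := by
  refine fun x => mono_mul_mem_spc (h x) fun k hk => ?_
  obtain ⟨k1, k2, k3, k4⟩ := hk
  exact ⟨by simp only [Prod.fst_add]; omega, by simp only [Prod.fst_add]; omega,
    by simp only [Prod.snd_add]; omega, by simp only [Prod.snd_add]; omega⟩

theorem MemF.revF {n m : ℕ} (h : MemF y (rect a a' b b')) (h1 : e ≤ n - a' := by omega)
    (h2 : n - a ≤ e' := by omega) (h3 : f ≤ m - b' := by omega) (h4 : m - b ≤ f' := by omega) :
    MemF (revF n m y) (rect e e' f f') := by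
  refine fun x => rev_mem_spc (h x) fun k hk => ?_
  obtain ⟨k1, k2, k3, k4⟩ := hk
  exact ⟨by simp only [Prod.fst_sub]; omega, by simp only [Prod.fst_sub]; omega,
    by simp only [Prod.snd_sub]; omega, by simp only [Prod.snd_sub]; omega⟩

theorem MemF.flipF (h : MemF y (rect a a' b b')) : MemF (flipF y) (rect b b' a a') := by
  intro x k hk
  rw [Bicircle.flipF, coeff_flip]
  refine h x _ fun h' => hk ⟨h'.2.2.1, h'.2.2.2, h'.1, h'.2.1⟩

theorem OrthF.mono_set {T : Set (ℤ × ℤ)} (h : OrthF c y T) (hST : S ⊆ T) : OrthF c y S :=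
  fun x q hq => h x q (spc_mono hST hq)

theorem OrthF.mono (h : OrthF c y (rect a a' b b')) (h1 : a ≤ e := by omega)
    (h2 : e' ≤ a' := by omega) (h3 : b ≤ f := by omega) (h4 : f' ≤ b' := by omega) :
    OrthF c y (rect e e' f f') :=
  h.mono_set (rect_mono h1 h2 h3 h4)

theorem OrthF.act (h : OrthF c y S) (M : Matrix (Fin l) (Fin k) ℂ) : OrthF c (act M y) S := by
  intro x q hq
  rw [act_apply, pair_sum_left]
  exact Finset.sum_eq_zero fun z _ => by rw [pair_smul_left, h z q hq, mul_zero]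

theorem OrthF.sub (h : OrthF c y S) (h' : OrthF c v S) : OrthF c (y - v) S := fun x q hq => by
  rw [Pi.sub_apply, pair_sub_left, h x q hq, h' x q hq, sub_zero]

theorem OrthF.shift {i j : ℤ} (h : OrthF c y (rect a a' b b')) (h1 : a + i ≤ e := by omega)
    (h2 : e' ≤ a' + i := by omega) (h3 : b + j ≤ f := by omega) (h4 : f' ≤ b' + j := by omega) :
    OrthF c (shift i j y) (rect e e' f f') := by
  intro x q hq
  have h5 : q = Bicircle.mono i j * (Bicircle.mono (-i) (-j) * q) := by
    rw [← mul_assoc, mono_mul_mono, add_neg_cancel, add_neg_cancel, mono_zero_zero, one_mul]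
  rw [h5, Bicircle.shift, pair_mono_mul]
  refine h x _ (mono_mul_mem_spc hq fun k hk => ?_)
  obtain ⟨k1, k2, k3, k4⟩ := hk
  exact ⟨by simp only [Prod.fst_add]; omega, by simp only [Prod.fst_add]; omega,
    by simp only [Prod.snd_add]; omega, by simp only [Prod.snd_add]; omega⟩

theorem OrthF.revF {n m : ℕ} (hc : IsHerm c) (h : OrthF c y (rect a a' b b'))
    (h1 : n - a' ≤ e := by omega) (h2 : e' ≤ n - a := by omega) (h3 : m - b' ≤ f := by omega)
    (h4 : f' ≤ m - b := by omega) : OrthF c (revF n m y) (rect e e' f f') := by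
  intro x q hq
  have h5 : q = rev n m (rev n m q) := (rev_rev n m q).symm
  rw [h5, Bicircle.revF, pair_rev, ← star_pair hc, h x, star_zero]
  refine rev_mem_spc hq fun k hk => ?_
  obtain ⟨k1, k2, k3, k4⟩ := hk
  exact ⟨by simp only [Prod.fst_sub]; omega, by simp only [Prod.fst_sub]; omega,
    by simp only [Prod.snd_sub]; omega, by simp only [Prod.snd_sub]; omega⟩

theorem OrthF.flipF (h : OrthF c y (rect a a' b b')) :
    OrthF (sw c) (flipF y) (rect b b' a a') := by
  intro x q hq
  rw [← flip_flip q, Bicircle.flipF, pair_flip]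
  have hq' : MemF (fun _ : Fin 1 => q) (rect b b' a a') := fun _ => hq
  exact h x _ (hq'.flipF 0)

theorem gram_zero {q : Fin l → Laurent} (h : OrthF c y S) (hq : MemF q S) : gram c y q = 0 :=
  gram_eq_zero fun x x' => h x _ (hq x')

theorem gram_zero' {q : Fin l → Laurent} (hc : IsHerm c) (hy : MemF y S) (h : OrthF c q S) :
    gram c y q = 0 := by
  rw [← gram_conjTranspose hc, gram_zero h hy, conjTranspose_zero]

end Rect

/-- The form `pair c` is positive definite on the polynomials of degree at most `(i, j)`. -/
def Pos (c : ℤ × ℤ → ℂ) (i j : ℕ) : Prop := PD c (rect 0 i 0 j)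

theorem Pos.sw {c : ℤ × ℤ → ℂ} {i j : ℕ} (h : Pos c i j) : Pos (sw c) j i := by
  intro p hp hne
  rw [← flip_flip p, pair_flip]
  have hp' : MemF (fun _ : Fin 1 => p) (rect 0 j 0 i) := fun _ => hp
  refine h _ (hp'.flipF 0) fun h0 => hne ?_
  rw [← flip_flip p]
  rw [show flip p = 0 from h0, map_zero]

theorem Pos.mono {c : ℤ × ℤ → ℂ} {i j i' j' : ℕ} (h : Pos c i j) (hi : i' ≤ i) (hj : j' ≤ j) :
    Pos c i' j' :=
  PD.mono h (rect_mono le_rfl (by omega) le_rfl (by omega))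

theorem pos_iff_lexSet {c : ℤ × ℤ → ℂ} {i j : ℕ} : Pos c i j ↔ PD c (lexSet i j ((j + 1 : ℕ) : ℤ)) := by
  rw [Nat.cast_succ, lexSet_top]
  rfl

/-! ## The orthonormal columns of a functional -/

section Data

variable (c : ℤ × ℤ → ℂ) (i j : ℕ)

/-- `Φ_{i,j}`. -/
noncomputable def Phi : Fin (j + 1) → Laurent := phiFam c i j (j + 1)

/-- `Φ̃_{i,j}`. -/
noncomputable def Phit : Fin (i + 1) → Laurent := flipF (Phi (sw c) j i)

/-- `Φ_{i,j-1}`. -/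
noncomputable def Pprev : Fin j → Laurent := phiFam c i (j - 1) j

/-- `Φ̃_{i-1,j}`. -/
noncomputable def Ptprev : Fin i → Laurent := flipF (Pprev (sw c) j i)

end Data

section Expansion

variable {c : ℤ × ℤ → ℂ} {i j k : ℕ} {y : Fin k → Laurent}

theorem Phi_mem (h : Pos c i j) : MemF (Phi c i j) (rect 0 i 0 j) := fun a =>
  spc_mono (lexSet_subset_box _ _ _) (phiFam_mem le_rfl (pos_iff_lexSet.mp h) a)

theorem Phi_orth (h : Pos c i j) : OrthF c (Phi c i j) (rect 0 (i - 1) 0 j) := fun a _ hq =>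
  phiFam_orth le_rfl (pos_iff_lexSet.mp h) a hq

theorem gram_Phi (hc : IsHerm c) (h : Pos c i j) : gram c (Phi c i j) (Phi c i j) = 1 :=
  gram_phiFam hc le_rfl (pos_iff_lexSet.mp h)

theorem Phi_decomp (hc : IsHerm c) (h : Pos c i j) (hy : MemF y (rect 0 i 0 j)) :
    MemF (y - act (gram c y (Phi c i j)) (Phi c i j)) (rect 0 (i - 1) 0 j) := by
  refine phiFam_decomp hc le_rfl (pos_iff_lexSet.mp h) ?_
  rw [Nat.cast_succ, lexSet_top]
  exact hy

theorem Phi_expand (hc : IsHerm c) (h : Pos c i j) (hy : MemF y (rect 0 i 0 j))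
    (ho : OrthF c y (rect 0 (i - 1) 0 j)) : y = act (gram c y (Phi c i j)) (Phi c i j) := by
  refine phiFam_expand hc le_rfl (pos_iff_lexSet.mp h) ?_ ho
  rw [Nat.cast_succ, lexSet_top]
  exact hy

theorem gram_revF_left (hc : IsHerm c) {l : ℕ} (n m : ℕ) (y : Fin k → Laurent)
    (q : Fin l → Laurent) : gram c (revF n m y) q = conjM (gram c y (revF n m q)) := by
  conv_lhs => rw [← revF_revF n m q, gram_revF, ← gram_conjTranspose hc]
  rfl

/-- Conjugation of `Phi_decomp` by reversal, under which "no `z ^ i`" becomes "no `z ^ 0`". The same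
conjugation gives `RPhi_orth` and `RPhi_expand`. -/
theorem RPhi_decomp (hc : IsHerm c) (h : Pos c i j) (hy : MemF y (rect 0 i 0 j)) :
    MemF (y - act (gram c y (revF i j (Phi c i j))) (revF i j (Phi c i j))) (rect 1 i 0 j) := by
  have h1 : MemF (revF i j (revF i j y - act (gram c (revF i j y) (Phi c i j)) (Phi c i j)))
      (rect 1 i 0 j) :=
    (Phi_decomp hc h (hy.revF (n := i) (m := j) : MemF _ (rect 0 i 0 j))).revF
  rw [revF_sub, revF_revF, revF_act, gram_revF_left hc] at h1
  convert h1 using 3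
  ext a b
  simp [conjM]

theorem RPhi_orth (hc : IsHerm c) (h : Pos c i j) :
    OrthF c (revF i j (Phi c i j)) (rect 1 i 0 j) :=
  (Phi_orth h).revF hc

theorem RPhi_expand (hc : IsHerm c) (h : Pos c i j) (hy : MemF y (rect 0 i 0 j))
    (ho : OrthF c y (rect 1 i 0 j)) :
    y = act (gram c y (revF i j (Phi c i j))) (revF i j (Phi c i j)) := by
  have h1 := Phi_expand hc h (hy.revF (n := i) (m := j) : MemF _ (rect 0 i 0 j)) (ho.revF hc)
  apply_fun revF i j at h1
  rw [revF_revF, revF_act, gram_revF_left hc] at h1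
  convert h1 using 2
  ext a b
  simp [conjM]

theorem gram_RPhi (hc : IsHerm c) (h : Pos c i j) :
    gram c (revF i j (Phi c i j)) (revF i j (Phi c i j)) = 1 := by
  rw [gram_revF, gram_Phi hc h, transpose_one]

theorem Phit_mem (h : Pos c i j) : MemF (Phit c i j) (rect 0 i 0 j) := (Phi_mem h.sw).flipF

theorem Phit_orth (h : Pos c i j) : OrthF c (Phit c i j) (rect 0 i 0 (j - 1)) :=
  (Phi_orth h.sw).flipF

theorem gram_Phit (hc : IsHerm c) (h : Pos c i j) : gram c (Phit c i j) (Phit c i j) = 1 :=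
  (gram_flipF (sw c) _ _).trans (gram_Phi hc.sw h.sw)

theorem gram_flipF_left {l : ℕ} (c : ℤ × ℤ → ℂ) (y : Fin k → Laurent) (q : Fin l → Laurent) :
    gram (sw c) (flipF y) q = gram c y (flipF q) := by
  rw [← gram_flipF, flipF_flipF]
  rfl

theorem Phit_decomp (hc : IsHerm c) (h : Pos c i j) (hy : MemF y (rect 0 i 0 j)) :
    MemF (y - act (gram c y (Phit c i j)) (Phit c i j)) (rect 0 i 0 (j - 1)) := by
  have h1 := (Phi_decomp hc.sw h.sw hy.flipF).flipF
  rwa [flipF_sub, flipF_act, flipF_flipF, gram_flipF_left] at h1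

theorem Phit_expand (hc : IsHerm c) (h : Pos c i j) (hy : MemF y (rect 0 i 0 j))
    (ho : OrthF c y (rect 0 i 0 (j - 1))) : y = act (gram c y (Phit c i j)) (Phit c i j) := by
  have h1 := congrArg flipF (Phi_expand hc.sw h.sw hy.flipF ho.flipF)
  rwa [flipF_act, flipF_flipF, gram_flipF_left] at h1

theorem RPhit_decomp (hc : IsHerm c) (h : Pos c i j) (hy : MemF y (rect 0 i 0 j)) :
    MemF (y - act (gram c y (revF i j (Phit c i j))) (revF i j (Phit c i j)))
      (rect 0 i 1 j) := by
  have h1 := (RPhi_decomp hc.sw h.sw hy.flipF).flipF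
  rwa [flipF_sub, flipF_act, flipF_flipF, gram_flipF_left, flipF_revF] at h1

theorem RPhit_orth (hc : IsHerm c) (h : Pos c i j) :
    OrthF c (revF i j (Phit c i j)) (rect 0 i 1 j) :=
  (Phit_orth h).revF hc

theorem gram_RPhit (hc : IsHerm c) (h : Pos c i j) :
    gram c (revF i j (Phit c i j)) (revF i j (Phit c i j)) = 1 := by
  rw [gram_revF, gram_Phit hc h, transpose_one]

theorem Pprev_expand (hc : IsHerm c) (h : Pos c i j) (hy : MemF y (rect 0 i 0 (j - 1)))
    (ho : OrthF c y (rect 0 (i - 1) 0 (j - 1))) :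
    y = act (gram c y (Pprev c i j)) (Pprev c i j) := by
  cases j with
  | zero =>
    -- For `j = 0` the rectangle is empty, so `y` vanishes, in accordance with the empty column
    -- `Pprev c i 0`.
    ext a : 1
    have h1 : y a = 0 := by
      refine laurent_ext fun k => hy a k fun hk => ?_
      obtain ⟨_, _, h3, h4⟩ := hk
      push_cast at h4
      omega
    rw [h1]
    simp [act]
  | succ j =>
    have e : ((j + 1 : ℕ) : ℤ) - 1 = j := by push_cast; ring
    rw [e] at hy ho
    exact Phi_expand hc (h.mono le_rfl (Nat.le_succ j)) hy ho

theorem Pprev_mem (h : Pos c i j) : MemF (Pprev c i j) (rect 0 i 0 (j - 1)) := by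
  cases j with
  | zero => exact fun a => a.elim0
  | succ j =>
    rw [show ((j + 1 : ℕ) : ℤ) - 1 = j by push_cast; ring]
    exact Phi_mem (h.mono le_rfl (Nat.le_succ j))

end Expansion

/-! ## Entrywise conjugation -/

section Conj

variable {k l r : ℕ}

theorem conjM_apply (M : Matrix (Fin k) (Fin l) ℂ) (a : Fin k) (b : Fin l) :
    conjM M a b = star (M a b) := rfl

theorem conjM_eq (M : Matrix (Fin k) (Fin l) ℂ) : conjM M = (Mᴴ)ᵀ := rfl

theorem conjM_mul (M : Matrix (Fin k) (Fin l) ℂ) (N : Matrix (Fin l) (Fin r) ℂ) :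
    conjM (M * N) = conjM M * conjM N := by
  rw [conjM_eq, conjTranspose_mul, transpose_mul]
  rfl

theorem conjM_conjM (M : Matrix (Fin k) (Fin l) ℂ) : conjM (conjM M) = M := by
  ext a b
  simp [conjM]

theorem conjM_sub (M N : Matrix (Fin k) (Fin l) ℂ) : conjM (M - N) = conjM M - conjM N := by
  ext a b
  simp [conjM]

theorem conjM_conjTranspose (M : Matrix (Fin k) (Fin l) ℂ) : (conjM M)ᴴ = Mᵀ := by
  ext a b
  simp [conjM]

theorem conjM_transpose (M : Matrix (Fin k) (Fin l) ℂ) : (conjM M)ᵀ = Mᴴ := rfl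

theorem isUnit_det_conjM {M : Matrix (Fin k) (Fin k) ℂ} (h : IsUnit M.det) :
    IsUnit (conjM M).det := by
  rw [conjM_eq, det_transpose, det_conjTranspose]
  exact h.star

theorem isUnit_det_conjTranspose {M : Matrix (Fin k) (Fin k) ℂ} (h : IsUnit M.det) :
    IsUnit (Mᴴ).det := by
  rw [det_conjTranspose]
  exact h.star

theorem isUnit_det_transpose' {M : Matrix (Fin k) (Fin k) ℂ} (h : IsUnit M.det) :
    IsUnit (Mᵀ).det := by
  rwa [det_transpose]

end Conj

/-! ### Shifts under reversal -/

section RevShift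

variable {k l : ℕ}

theorem revF_shift (a b n m : ℕ) (p : Fin k → Laurent) :
    revF (n + a) (m + b) (shift a b p) = revF n m p :=
  funext fun x => rev_mono_mul a b n m (p x)

theorem revF_eq_shift_revF (a b n m : ℕ) (p : Fin k → Laurent) :
    revF (n + a) (m + b) p = shift a b (revF n m p) :=
  funext fun x => rev_eq_mono_mul_rev a b n m (p x)

theorem revF_shift_z (n m : ℕ) (p : Fin k → Laurent) :
    revF (n + 1) m (shift 1 0 p) = revF n m p := revF_shift 1 0 n m p

theorem revF_shift_w (n m : ℕ) (p : Fin k → Laurent) :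
    revF n (m + 1) (shift 0 1 p) = revF n m p := revF_shift 0 1 n m p

theorem revF_succ_z (n m : ℕ) (p : Fin k → Laurent) :
    revF (n + 1) m p = shift 1 0 (revF n m p) := revF_eq_shift_revF 1 0 n m p

theorem revF_succ_w (n m : ℕ) (p : Fin k → Laurent) :
    revF n (m + 1) p = shift 0 1 (revF n m p) := revF_eq_shift_revF 0 1 n m p

theorem shift_comm (a b a' b' : ℤ) (p : Fin k → Laurent) :
    shift a b (shift a' b' p) = shift a' b' (shift a b p) := by
  ext x : 1
  simp only [shift]
  ring

end RevShift

/-! ## The coefficients of a functional -/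

section CoeffDefs

variable (c : ℤ × ℤ → ℂ)

/-- `K_{i,j} = L (Φ_{i,j-1} Φ̃_{i-1,j}†)`. -/
noncomputable def dK (i j : ℕ) : Matrix (Fin j) (Fin i) ℂ :=
  gram c (Pprev c i j) (Ptprev c i j)

/-- `K¹_{i,j} = L (w Φ_{i,j-1} (Φ̃_{i-1,j}←)†)`. -/
noncomputable def dK1 (i j : ℕ) : Matrix (Fin j) (Fin i) ℂ :=
  gram c (shift 0 1 (Pprev c i j)) (revF (i - 1) j (Ptprev c i j))

/-- `Γ_{i,j} = L (Φ_{i,j-1} Φ_{i,j}†)`. -/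
noncomputable def dG (i j : ℕ) : Matrix (Fin j) (Fin (j + 1)) ℂ :=
  gram c (Pprev c i j) (Phi c i j)

/-- `Γ¹_{i,j} = L (w Φ_{i,j-1} Φ_{i,j}†)`. -/
noncomputable def dG1 (i j : ℕ) : Matrix (Fin j) (Fin (j + 1)) ℂ :=
  gram c (shift 0 1 (Pprev c i j)) (Phi c i j)

/-- `Ê_{i,j} = L (z Φ_{i-1,j} (Φ_{i-1,j}←)†)`. -/
noncomputable def dE : (i j : ℕ) → Matrix (Fin (j + 1)) (Fin (j + 1)) ℂ
  | 0, _ => 0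
  | i + 1, j => gram c (shift 1 0 (Phi c i j)) (revF i j (Phi c i j))

/-- `A_{i,j} = L (z Φ_{i-1,j} Φ_{i,j}†)`. -/
noncomputable def dA : (i j : ℕ) → Matrix (Fin (j + 1)) (Fin (j + 1)) ℂ
  | 0, _ => 0
  | i + 1, j => gram c (shift 1 0 (Phi c i j)) (Phi c (i + 1) j)

/-- `I_{i,j} = L (Φ_{i,j} Φ̃_{i,j}†)`. -/
noncomputable def dI (i j : ℕ) : Matrix (Fin (j + 1)) (Fin (i + 1)) ℂ :=
  gram c (Phi c i j) (Phit c i j)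

/-- `I¹_{i,j} = L (Φ_{i,j}← Φ̃_{i,j}†)`. -/
noncomputable def dI1 (i j : ℕ) : Matrix (Fin (j + 1)) (Fin (i + 1)) ℂ :=
  gram c (revF i j (Phi c i j)) (Phit c i j)

/-- The leading coefficients of `Φ_{i,j-1}`. -/
noncomputable def dQ (i j : ℕ) : Matrix (Fin j) (Fin j) ℂ := leadF i j (Pprev c i j)

/-- All coefficients of a functional on level `(i, j)`. -/
noncomputable def trueC (i j : ℕ) : Coeffs i j where
  K := dK c i j
  K1 := dK1 c i j
  G := dG c i j
  Gt := dG (sw c) j i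
  G1 := dG1 c i j
  G1t := dG1 (sw c) j i
  E := dE c i j
  Et := dE (sw c) j i
  A := dA c i j
  At := dA (sw c) j i
  I := dI c i j
  I1 := dI1 c i j

/-- The coefficients and the orthonormal polynomials of a functional on level `(i, j)`. -/
noncomputable def trueL (i j : ℕ) : Level i j :=
  { trueC c i j with
    P := Phi c i j
    Pt := Phit c i j
    Q := dQ c i j
    Qt := dQ (sw c) j i }

end CoeffDefs

/-! ### Symmetries of the coefficients and the recurrence in z -/

section Identities

variable {c : ℤ × ℤ → ℂ} {i j n m : ℕ}

theorem dK_sw (hc : IsHerm c) : dK (sw c) j i = (dK c i j)ᴴ := by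
  rw [dK, dK, gram_conjTranspose hc, ← gram_flipF c]
  congr 1
  exact (flipF_flipF _).symm

/-- Reversal in the degree of the new level absorbs the factor `w` on one column and produces a
factor `z` on the other, which is the defining pairing of `K¹` with the variables interchanged. -/
theorem dK1_sw : dK1 (sw c) j i = (dK1 c i j)ᵀ := by
  cases i with
  | zero => ext a b; exact a.elim0
  | succ n =>
    cases j with
    | zero => ext a b; exact b.elim0
    | succ m =>
      simp only [dK1, Nat.add_sub_cancel]
      rw [← gram_revF c (n + 1) (m + 1), revF_shift_w, revF_succ_z, revF_revF, ← gram_flipF c,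
        flipF_shift, flipF_revF]
      congr 2
      exact (flipF_flipF _).symm

theorem dI_sw (hc : IsHerm c) : dI (sw c) j i = (dI c i j)ᴴ := by
  rw [dI, dI, gram_conjTranspose hc, ← gram_flipF c]
  congr 1
  exact (flipF_flipF _).symm

theorem dI1_sw : dI1 (sw c) j i = (dI1 c i j)ᵀ := by
  rw [dI1, dI1, ← gram_revF c i j, revF_revF, ← gram_flipF c, flipF_revF]
  congr 2
  exact (flipF_flipF _).symm

/-- The tilde formulas of the algorithm thereby become the plain formulas for `sw c`. -/
theorem trueC_swap (hc : IsHerm c) (i j : ℕ) : (trueC c i j).swap = trueC (sw c) j i := by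
  simp only [trueC, Coeffs.swap, dK_sw hc, dK1_sw, dI_sw hc, dI1_sw]
  rfl

theorem dEt_eq (c : ℤ × ℤ → ℂ) (i j : ℕ) :
    dE (sw c) (j + 1) i = gram c (shift 0 1 (Phit c i j)) (revF i j (Phit c i j)) := by
  rw [dE, ← gram_flipF, flipF_shift, flipF_revF]
  rfl

/-- Reversal in degree `(i, j)` interchanges the two columns `z Φ_{i-1,j}` and `Φ_{i-1,j}←` that
define `Ê`. -/
theorem dE_transpose : (dE c i j)ᵀ = dE c i j := by
  cases i with
  | zero => rw [dE, transpose_zero]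
  | succ n => rw [dE, ← gram_revF c (n + 1) j, revF_shift_z, revF_succ_z, revF_revF]

theorem conjM_dE : conjM (dE c i j) = (dE c i j)ᴴ := by
  conv_rhs => rw [← dE_transpose]
  rfl

/-- Multiplication by `z` moves the leading monomials of `Φ_{i,j}` to those of `Φ_{i+1,j}`, in the
same order and with the same positive coefficients. -/
theorem isUpperPos_dA (hc : IsHerm c) (h : Pos c (i + 1) j) : IsUpperPos (dA c (i + 1) j) := by
  have h' : Pos c i j := h.mono (Nat.le_succ i) le_rfl
  refine isUpperPos_gram_phiFam hc le_rfl (pos_iff_lexSet.mp h) (fun a => ?_) fun a => ?_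
  · refine mono_mul_mem_spc (isPhi_phiFam le_rfl (pos_iff_lexSet.mp h') a).mem fun k hk => ?_
    simp only [lexSet, Set.mem_ofPred_eq, Prod.fst_add, Prod.snd_add] at hk ⊢
    omega
  · have := (isPhi_phiFam le_rfl (pos_iff_lexSet.mp h') a).pos
    rw [shift, coeff_mono_mul]
    have e : (((i + 1 : ℕ) : ℤ), ((j + 1 : ℕ) : ℤ) - 1 - (a : ℕ)) - (1, 0) =
        ((i : ℤ), ((j + 1 - 1 - a : ℕ) : ℤ)) := by
      refine Prod.ext ?_ ?_
      · change ((i + 1 : ℕ) : ℤ) - 1 = i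
        omega
      · change ((j + 1 : ℕ) : ℤ) - 1 - (a : ℕ) - 0 = ((j + 1 - 1 - a : ℕ) : ℤ)
        omega
    rw [e]
    exact this

/-- Without its `Φ_{i+1,j}` component, `z Φ_{i,j}` has degree at most `(i, j)` and is orthogonal to
all monomials of that degree divisible by `z`. Only combinations of `Φ_{i,j}←` have this property.
-/
theorem shift_Phi_eq (hc : IsHerm c) (h : Pos c (i + 1) j) :
    shift 1 0 (Phi c i j) =
      act (dA c (i + 1) j) (Phi c (i + 1) j) + act (dE c (i + 1) j) (revF i j (Phi c i j)) := by
  have h' : Pos c i j := h.mono (Nat.le_succ i) le_rfl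
  have hm : MemF (shift 1 0 (Phi c i j)) (rect 0 ((i + 1 : ℕ) : ℤ) 0 j) := (Phi_mem h').shift
  have h1 : MemF (shift 1 0 (Phi c i j) - act (dA c (i + 1) j) (Phi c (i + 1) j)) (rect 0 i 0 j) :=
    (Phi_decomp hc h hm).mono
  have h2 : OrthF c (shift 1 0 (Phi c i j) - act (dA c (i + 1) j) (Phi c (i + 1) j))
      (rect 1 i 0 j) :=
    OrthF.sub (Phi_orth h').shift ((Phi_orth h).mono.act _)
  have h3 := RPhi_expand hc h' h1 h2
  rw [gram_sub_left, gram_act_left, gram_zero (S := rect 0 i 0 j) (Phi_orth h).mono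
    (Phi_mem h').revF, Matrix.mul_zero, sub_zero] at h3
  rw [← sub_eq_iff_eq_add']
  exact h3

theorem gram_Phi_RPhi_prev (h : Pos c (i + 1) j) :
    gram c (Phi c (i + 1) j) (revF i j (Phi c i j)) = 0 := by
  have h' : Pos c i j := h.mono (Nat.le_succ i) le_rfl
  exact gram_zero (S := rect 0 i 0 j) (Phi_orth h).mono (Phi_mem h').revF

/-- Pythagoras for the recurrence: `z Φ_{i,j}` is orthonormal and its two components are mutually
orthogonal. -/
theorem dA_mul_conjTranspose (hc : IsHerm c) (h : Pos c (i + 1) j) :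
    1 - dE c (i + 1) j * (dE c (i + 1) j)ᴴ = dA c (i + 1) j * (dA c (i + 1) j)ᴴ := by
  have h' : Pos c i j := h.mono (Nat.le_succ i) le_rfl
  have h1 := gram_shift c 1 0 (Phi c i j) (Phi c i j)
  have h0 := gram_Phi_RPhi_prev h
  have h0' := congrArg conjTranspose h0
  rw [gram_conjTranspose hc, conjTranspose_zero] at h0'
  rw [gram_Phi hc h', shift_Phi_eq hc h, gram_add_left, gram_add_right, gram_add_right,
    gram_act_left, gram_act_left, gram_act_left, gram_act_left, gram_act_right, gram_act_right,
    gram_act_right, gram_act_right, gram_Phi hc h, gram_RPhi hc h', h0, h0'] at h1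
  rw [← h1]
  simp

theorem dA_eq (hc : IsHerm c) (h : Pos c (i + 1) j) :
    upperCholesky (1 - dE c (i + 1) j * (dE c (i + 1) j)ᴴ) = dA c (i + 1) j :=
  upperCholesky_eq (isUpperPos_dA hc h) (dA_mul_conjTranspose hc h)

/-- The reversed recurrence. -/
theorem act_conj_RPhi (hc : IsHerm c) (h : Pos c (i + 1) j) :
    act (conjM (dA c (i + 1) j)) (revF (i + 1) j (Phi c (i + 1) j)) =
      revF i j (Phi c i j) - act (conjM (dE c (i + 1) j)) (shift 1 0 (Phi c i j)) := by
  have h1 := congrArg (revF (i + 1) j) (shift_Phi_eq hc h)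
  rw [revF_shift_z, revF_add, revF_act, revF_act, revF_succ_z i j (revF i j _), revF_revF] at h1
  rw [h1, add_sub_cancel_right]

/-- The reversed recurrence is paired with `Φ_{i+1,j}`; the term with `Φ_{i,j}←` drops out and `z
Φ_{i,j}` contributes `A`. -/
theorem gram_RPhi_Phi (hc : IsHerm c) (h : Pos c (i + 1) j) :
    gram c (revF (i + 1) j (Phi c (i + 1) j)) (Phi c (i + 1) j) =
      -((conjM (dA c (i + 1) j))⁻¹ * (dE c (i + 1) j)ᴴ * dA c (i + 1) j) := by
  have hu := isUnit_det_conjM (isUpperPos_dA hc h).isUnit_det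
  have h1 := congrArg (fun y => gram c y (Phi c (i + 1) j)) (act_conj_RPhi hc h)
  have h0' := congrArg conjTranspose (gram_Phi_RPhi_prev h)
  rw [gram_conjTranspose hc, conjTranspose_zero] at h0'
  simp only [gram_act_left, gram_sub_left, h0', zero_sub, conjM_dE] at h1
  rw [← Matrix.nonsing_inv_mul_cancel_left _ (gram c _ _) hu, h1, Matrix.mul_neg, Matrix.mul_assoc]
  rfl

theorem gram_RPhit_Phit (hc : IsHerm c) (h : Pos c i (j + 1)) :
    gram c (revF i (j + 1) (Phit c i (j + 1))) (Phit c i (j + 1)) =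
      -((conjM (dA (sw c) (j + 1) i))⁻¹ * (dE (sw c) (j + 1) i)ᴴ * dA (sw c) (j + 1) i) := by
  rw [← gram_RPhi_Phi hc.sw h.sw, Phit, ← flipF_revF]
  exact gram_flipF (sw c) _ _

/-! ### The first row and the first column of `I` -/

/-- The monomials before `z ^ i * w ^ j` are all others of the box in either ordering. This makes
the top polynomials of both columns coincide. -/
theorem lexSet_top_flip {i j : ℤ} {k : ℤ × ℤ} :
    (k.2, k.1) ∈ lexSet j i i ↔ k ∈ lexSet i j j := by
  simp only [lexSet, Set.mem_ofPred_eq]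
  omega

theorem Phit_zero (h : Pos c i j) : Phit c i j 0 = Phi c i j 0 := by
  have hP := isPhi_phiFam le_rfl (pos_iff_lexSet.mp h.sw) 0
  simp only [Fin.val_zero, Nat.sub_zero, Nat.add_sub_cancel] at hP
  refine IsPhi.eq_phi (by simp) ?_ ⟨?_, ?_, ?_, ?_⟩
  · simpa using pos_iff_lexSet.mp h
  · simp only [Fin.val_zero, Nat.sub_zero, Nat.add_sub_cancel, lexSet_top]
    exact Phit_mem h 0
  · simp only [Fin.val_zero, Nat.sub_zero, Nat.add_sub_cancel, Phit, flipF, coeff_flip]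
    exact hP.pos
  · simp only [Fin.val_zero, Nat.sub_zero, Nat.add_sub_cancel]
    intro q hq
    rw [← flip_flip q]
    refine (pair_flip (sw c) _ _).trans (hP.orth _ fun k hk => ?_)
    rw [coeff_flip]
    refine hq _ fun h' => hk ?_
    exact lexSet_top_flip.mpr h'
  · exact (pair_flip (sw c) _ _).trans hP.norm

theorem dI_zero_left (hc : IsHerm c) (h : Pos c i j) (b : Fin (i + 1)) :
    dI c i j 0 b = (1 : Matrix (Fin (i + 1)) (Fin (i + 1)) ℂ) 0 b := by
  rw [dI, gram_apply, ← Phit_zero h, ← gram_Phit hc h, gram_apply]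

theorem dI_zero_right (hc : IsHerm c) (h : Pos c i j) (a : Fin (j + 1)) :
    dI c i j a 0 = (1 : Matrix (Fin (j + 1)) (Fin (j + 1)) ℂ) a 0 := by
  rw [dI, gram_apply, Phit_zero h, ← gram_Phi hc h, gram_apply]

/-! ### Relations between neighbouring levels -/

/-- Removing the `Φ̃_{i,j}` component lowers the degree in `w` and keeps the orthogonality to degree
`(i-1, j-1)`, which leaves only combinations of `Φ_{i,j-1}`. -/
theorem Phi_eq (hc : IsHerm c) (h : Pos c i j) :
    Phi c i j = act (dI c i j) (Phit c i j) + act (dG c i j)ᴴ (Pprev c i j) := by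
  have h1 : MemF (Phi c i j - act (dI c i j) (Phit c i j)) (rect 0 i 0 (j - 1)) :=
    Phit_decomp hc h (Phi_mem h)
  have h2 : OrthF c (Phi c i j - act (dI c i j) (Phit c i j)) (rect 0 (i - 1) 0 (j - 1)) :=
    OrthF.sub (Phi_orth h).mono ((Phit_orth h).mono.act _)
  have h3 := Pprev_expand hc h h1 h2
  rw [gram_sub_left, gram_act_left, gram_zero (Phit_orth h) (Pprev_mem h), Matrix.mul_zero,
    sub_zero, ← gram_conjTranspose hc] at h3
  rw [← sub_eq_iff_eq_add']
  exact h3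

theorem gram_RPhit_Phi : gram c (revF i j (Phit c i j)) (Phi c i j) = (dI1 c i j)ᵀ := by
  rw [dI1, ← gram_revF c i j, revF_revF]

/-- The left column is split by `Phi_eq`. In the first part the column `Φ̃_{i,j}←` can be inserted,
since `w Φ̃_{i,j}` is orthogonal to every monomial of degree at most `(i, j)` divisible by `w`. -/
theorem gram_shift_Phi_Phi (hc : IsHerm c) (h : Pos c i j) :
    gram c (shift 0 1 (Phi c i j)) (Phi c i j) =
      dI c i j * dE (sw c) (j + 1) i * (dI1 c i j)ᵀ + (dG c i j)ᴴ * dG1 c i j := by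
  have h1 : gram c (shift 0 1 (Phit c i j)) (Phi c i j) =
      dE (sw c) (j + 1) i * (dI1 c i j)ᵀ := by
    rw [dEt_eq, ← gram_RPhit_Phi]
    exact gram_eq_mul hc (S := rect 0 i 1 j) (RPhit_decomp hc h (Phi_mem h)) (Phit_orth h).shift
  refine (congrArg (fun y => gram c (shift 0 1 y) (Phi c i j)) (Phi_eq hc h)).trans ?_
  rw [shift_add, shift_act, shift_act, gram_add_left, gram_act_left, gram_act_left,
    h1, Matrix.mul_assoc]
  rfl

theorem gram_shift_Phi_Phit (hc : IsHerm c) (h1 : Pos c (n + 1) m) (h2 : Pos c n (m + 1)) :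
    gram c (shift 0 1 (Phi c (n + 1) m)) (Phit c n (m + 1)) =
      -(dK1 c (n + 1) (m + 1) * (conjM (dA (sw c) (m + 1) n))⁻¹ * (dE (sw c) (m + 1) n)ᴴ *
        dA (sw c) (m + 1) n) := by
  have h3 : gram c (shift 0 1 (Phi c (n + 1) m)) (Phit c n (m + 1)) =
      dK1 c (n + 1) (m + 1) * gram c (revF n (m + 1) (Phit c n (m + 1))) (Phit c n (m + 1)) :=
    gram_eq_mul hc (S := rect 0 n 1 ((m + 1 : ℕ) : ℤ)) (RPhit_decomp hc h2 (Phit_mem h2))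
      (Phi_orth h1).shift
  rw [h3, gram_RPhit_Phit hc h2, Matrix.mul_neg, ← Matrix.mul_assoc, ← Matrix.mul_assoc]

theorem gram_RPhi_next_Phit (hc : IsHerm c) (h : Pos c (i + 1) j) :
    gram c (revF i j (Phi c i j)) (Phit c (i + 1) j) = dI1 c i j * dG (sw c) j (i + 1) := by
  have h' : Pos c i j := h.mono (Nat.le_succ i) le_rfl
  have h1 : dG (sw c) j (i + 1) = gram c (Phit c i j) (Phit c (i + 1) j) :=
    (gram_flipF (sw c) _ _).symm
  rw [h1]
  exact gram_eq_mul' hc (S := rect 0 i 0 (j - 1)) (Phit_decomp hc h' (Phi_mem h').revF)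
    (Phit_orth h).mono

/-- The reversed recurrence is paired with `Φ̃_{i+1,j}`, and `z Φ_{i,j}` in it is replaced by the
forward recurrence. -/
theorem dI1_succ (hc : IsHerm c) (h : Pos c (i + 1) j) :
    dI1 c (i + 1) j =
      -((conjM (dA c (i + 1) j))⁻¹ * (dE c (i + 1) j)ᴴ * dA c (i + 1) j * dI c (i + 1) j) +
        (dA c (i + 1) j)ᵀ * dI1 c i j * dG (sw c) j (i + 1) := by
  have hu := isUnit_det_conjM (isUpperPos_dA hc h).isUnit_det
  set A := dA c (i + 1) j
  set E := dE c (i + 1) j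
  have h1 := congrArg (fun y => gram c y (Phit c (i + 1) j)) (act_conj_RPhi hc h)
  simp only [gram_act_left, gram_sub_left, shift_Phi_eq hc h, gram_add_left,
    gram_RPhi_next_Phit hc h, conjM_dE] at h1
  -- The entrywise conjugate of `A A† = 1 - E E†`, rewritten by the symmetry of `E`.
  have h2 : conjM A * Aᵀ = 1 - Eᴴ * E := by
    have h3 := congrArg conjM (dA_mul_conjTranspose hc h)
    rw [conjM_mul, conjM_sub, conjM_mul, conjM_dE] at h3
    have e1 : conjM (Aᴴ) = Aᵀ := by ext a b; simp [conjM]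
    have e2 : conjM (dE c (i + 1) j)ᴴ = E := by
      rw [← conjM_dE, conjM_conjM]
    have e3 : conjM (1 : Matrix (Fin (j + 1)) (Fin (j + 1)) ℂ) = 1 := by
      rw [conjM_eq, conjTranspose_one, transpose_one]
    rw [e1, e2, e3] at h3
    exact h3.symm
  have h4 : conjM A * dI1 c (i + 1) j = conjM A * (-((conjM A)⁻¹ * Eᴴ * A * dI c (i + 1) j) +
      Aᵀ * dI1 c i j * dG (sw c) j (i + 1)) := by
    have e4 : conjM A * dI1 c (i + 1) j = _ := h1
    have e5 : conjM A * ((conjM A)⁻¹ * Eᴴ * A * dI c (i + 1) j) = Eᴴ * A * dI c (i + 1) j := by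
      simp only [Matrix.mul_assoc]
      rw [Matrix.mul_nonsing_inv_cancel_left _ _ hu]
    have e6 : conjM A * (Aᵀ * dI1 c i j * dG (sw c) j (i + 1)) =
        (1 - Eᴴ * E) * (dI1 c i j * dG (sw c) j (i + 1)) := by
      rw [← h2]
      simp only [Matrix.mul_assoc]
    rw [e4, Matrix.mul_add (conjM A), Matrix.mul_neg, e5, e6, Matrix.sub_mul, Matrix.one_mul,
      Matrix.mul_add]
    simp only [Matrix.mul_assoc]
    rw [dI]
    abel
  rw [← Matrix.nonsing_inv_mul_cancel_left _ (dI1 c (i + 1) j) hu, h4,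
    Matrix.nonsing_inv_mul_cancel_left _ _ hu]

end Identities

/-! ## Selection matrices -/

section Selection

variable {k l r : ℕ}

theorem mul_U_transpose (M : Matrix (Fin l) (Fin (k + 1)) ℂ) :
    M * (U k)ᵀ = M.submatrix id Fin.succ := by
  ext a b
  simp [Matrix.mul_apply, U]

theorem mul_U (M : Matrix (Fin l) (Fin k) ℂ) :
    M * U k = Matrix.of fun a => Fin.cons 0 (M a) := by
  ext a b
  refine Fin.cases ?_ (fun b => ?_) b <;> simp [Matrix.mul_apply, U, Fin.succ_ne_zero, eq_comm]

theorem U_transpose_mul (M : Matrix (Fin k) (Fin l) ℂ) :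
    (U k)ᵀ * M = Matrix.of (Fin.cons 0 M) := by
  ext a b
  refine Fin.cases ?_ (fun a => ?_) a <;>
    simp [Matrix.mul_apply, U, Fin.succ_ne_zero, eq_comm] <;> rfl

theorem corner_mul (M : Matrix (Fin (l + 1)) (Fin r) ℂ) :
    corner k l * M = Matrix.of (Fin.cons (M 0) fun _ => 0) := by
  ext a b
  refine Fin.cases ?_ (fun a => ?_) a <;>
    simp [Matrix.mul_apply, corner, Matrix.single_apply, Fin.succ_ne_zero, eq_comm]

theorem U_transpose_mul_add_corner_mul (M : Matrix (Fin k) (Fin r) ℂ)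
    (N : Matrix (Fin (l + 1)) (Fin r) ℂ) :
    (U k)ᵀ * M + corner k l * N = Matrix.of (Fin.cons (N 0) M) := by
  rw [U_transpose_mul, corner_mul]
  ext a b
  refine Fin.cases ?_ (fun a => ?_) a
  · exact zero_add _
  · exact add_zero _

theorem U1_mul (M : Matrix (Fin (k + 1)) (Fin l) ℂ) :
    U1 k * M = M.submatrix Fin.castSucc id := by
  ext a b
  simp [Matrix.mul_apply, U1]

/-- A matrix is determined by its last entry, the rows but the last and the columns but the
last. -/
theorem eq_single_add_U1 (X : Matrix (Fin (k + 1)) (Fin (l + 1)) ℂ)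
    {H : Matrix (Fin k) (Fin (l + 1)) ℂ} {H' : Matrix (Fin (k + 1)) (Fin l) ℂ}
    (h : U1 k * X = H) (h' : X * (U1 l)ᵀ = H') :
    X = X (Fin.last k) (Fin.last l) • Matrix.single (Fin.last k) (Fin.last l) (1 : ℂ) +
      (U1 k)ᵀ * H + Matrix.single (Fin.last k) (Fin.last k) (1 : ℂ) * H' * U1 l := by
  subst h h'
  rw [U1_mul]
  ext a b
  refine Fin.lastCases ?_ (fun a => ?_) a <;> refine Fin.lastCases ?_ (fun b => ?_) b <;>
    simp [Matrix.mul_apply, U1, Matrix.single_apply, Fin.castSucc_ne_last, eq_comm]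

theorem single_smul_add_injective {a : Fin k} {b : Fin l} {x y : ℂ}
    {R R' : Matrix (Fin k) (Fin l) ℂ}
    (h : x • Matrix.single a b (1 : ℂ) + R + R' = y • Matrix.single a b (1 : ℂ) + R + R') :
    x = y := by
  have h1 := congrFun (congrFun h a) b
  simpa using h1

end Selection

section Formulas

variable {c : ℤ × ℤ → ℂ} {i j n m : ℕ}

/-! ## The recurrence with interchanged variables -/

theorem shift_Phit_eq (hc : IsHerm c) (h : Pos c i (j + 1)) :
    shift 0 1 (Phit c i j) = act (dA (sw c) (j + 1) i) (Phit c i (j + 1)) +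
      act (dE (sw c) (j + 1) i) (revF i j (Phit c i j)) := by
  have h1 := congrArg flipF (shift_Phi_eq hc.sw h.sw)
  have h2 : ∀ (v v' : Fin (i + 1) → Laurent), flipF (v + v') = flipF v + flipF v' := by
    intro v v'
    ext x : 1
    simp [flipF]
  rwa [flipF_shift, h2, flipF_act, flipF_act, flipF_revF] at h1

theorem act_conj_RPhit (hc : IsHerm c) (h : Pos c i (j + 1)) :
    act (conjM (dA (sw c) (j + 1) i)) (revF i (j + 1) (Phit c i (j + 1))) =
      revF i j (Phit c i j) - act (conjM (dE (sw c) (j + 1) i)) (shift 0 1 (Phit c i j)) := by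
  have h1 := congrArg flipF (act_conj_RPhi hc.sw h.sw)
  rwa [flipF_sub, flipF_act, flipF_act, flipF_shift, flipF_revF, flipF_revF] at h1

/-! ## The formula for `Ê` -/

/-- `[w φ_{i,j}^j, φ_{i,j}^j, …, φ_{i,j}^0]ᵀ`. -/
noncomputable def consPhi (c : ℤ × ℤ → ℂ) (i j : ℕ) : Fin (j + 2) → Laurent :=
  Fin.cons (shift 0 1 (Phi c i j) 0) (Phi c i j)

theorem hatGamma_eq_gram (c : ℤ × ℤ → ℂ) (i j : ℕ) :
    hatGamma (dG1 c i (j + 1)) (dG c i (j + 1)) = gram c (consPhi c i j) (Phi c i (j + 1)) := by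
  ext a b
  refine Fin.cases ?_ (fun a => ?_) a <;> rfl

/-- The column `consPhi` has the leading monomials `z^i w^(j+1), …, z^i` of `Φ_{i,j+1}`, in the same
order and with positive coefficients. This is the source of the invertibility that the algorithm
relies on. -/
theorem isUpperPos_hatGamma (hc : IsHerm c) (h : Pos c i (j + 1)) :
    IsUpperPos (hatGamma (dG1 c i (j + 1)) (dG c i (j + 1))) := by
  have h' : Pos c i j := h.mono le_rfl (Nat.le_succ j)
  rw [hatGamma_eq_gram]
  refine isUpperPos_gram_phiFam hc le_rfl (pos_iff_lexSet.mp h) (fun a => ?_) fun a => ?_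
  · refine Fin.cases ?_ (fun a => ?_) a
    · refine mono_mul_mem_spc (isPhi_phiFam le_rfl (pos_iff_lexSet.mp h') 0).mem fun k hk => ?_
      simp only [lexSet, Set.mem_ofPred_eq, Prod.fst_add, Prod.snd_add, Fin.val_zero] at hk ⊢
      omega
    · refine spc_mono (fun k hk => ?_) (isPhi_phiFam le_rfl (pos_iff_lexSet.mp h') a).mem
      simp only [lexSet, Set.mem_ofPred_eq, Fin.val_succ] at hk ⊢
      omega
  · refine Fin.cases ?_ (fun a => ?_) a
    · have := (isPhi_phiFam le_rfl (pos_iff_lexSet.mp h') 0).pos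
      change 0 < (mono 0 1 * Phi c i j 0).coeff _
      rw [coeff_mono_mul]
      have e : ((i : ℤ), ((j + 1 + 1 : ℕ) : ℤ) - 1 - ((0 : Fin (j + 1 + 1)) : ℕ)) - (0, 1) =
          ((i : ℤ), ((j + 1 - 1 - (0 : Fin (j + 1)) : ℕ) : ℤ)) := by
        refine Prod.ext (sub_zero _) ?_
        change ((j + 1 + 1 : ℕ) : ℤ) - 1 - ((0 : ℕ) : ℤ) - 1 = ((j + 1 - 1 - 0 : ℕ) : ℤ)
        omega
      rw [e]
      exact this
    · have := (isPhi_phiFam le_rfl (pos_iff_lexSet.mp h') a).pos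
      change 0 < (Phi c i j a).coeff _
      have e : ((j + 1 + 1 : ℕ) : ℤ) - 1 - ((a.succ : Fin (j + 1 + 1)) : ℕ) =
          ((j + 1 - 1 - a : ℕ) : ℤ) := by
        rw [Fin.val_succ]
        omega
      rw [e]
      exact this

theorem gram_shift_Phi_RPhi_w (hc : IsHerm c) (h1 : Pos c (n + 1) m) (h2 : Pos c n (m + 1)) :
    gram c (shift 1 0 (Phi c n m)) (revF n (m + 1) (Phi c n (m + 1))) =
      dA c (n + 1) m * dK c (n + 1) (m + 1) * (dI1 c n (m + 1))ᴴ +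
        dE c (n + 1) m * conjM (dG1 c n (m + 1)) := by
  have e1 : gram c (Phi c (n + 1) m) (revF n (m + 1) (Phi c n (m + 1))) =
      dK c (n + 1) (m + 1) * (dI1 c n (m + 1))ᴴ := by
    rw [dI1, gram_conjTranspose hc]
    refine gram_eq_mul hc (S := rect 0 n 0 m) (e := Phit c n (m + 1))
      (Phit_decomp hc h2 (Phi_mem h2).revF).mono (Phi_orth h1).mono
  have e2 : gram c (revF n m (Phi c n m)) (revF n (m + 1) (Phi c n (m + 1))) =
      conjM (dG1 c n (m + 1)) := by
    rw [← revF_shift_w, gram_revF, ← gram_conjTranspose hc]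
    rfl
  rw [shift_Phi_eq hc h1, gram_add_left, gram_act_left, gram_act_left, e1, e2, Matrix.mul_assoc]

theorem gram_shift_shift_Phi_RPhi (hc : IsHerm c) (h1 : Pos c (n + 1) m) (h2 : Pos c n (m + 1)) :
    gram c (shift 1 0 (shift 0 1 (Phi c n m))) (revF n (m + 1) (Phi c n (m + 1))) =
      dA c (n + 1) m * dK1 c (n + 1) (m + 1) * (dI c n (m + 1))ᵀ +
        dE c (n + 1) m * conjM (dG c n (m + 1)) := by
  have e1 : gram c (shift 0 1 (Phi c (n + 1) m)) (revF n (m + 1) (Phi c n (m + 1))) =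
      dK1 c (n + 1) (m + 1) * (dI c n (m + 1))ᵀ := by
    rw [dI, ← gram_revF c n (m + 1)]
    exact gram_eq_mul hc (S := rect 0 n 1 ((m + 1 : ℕ) : ℤ))
      (RPhit_decomp hc h2 (Phi_mem h2).revF) (Phi_orth h1).shift
  have e2 : gram c (shift 0 1 (revF n m (Phi c n m))) (revF n (m + 1) (Phi c n (m + 1))) =
      conjM (dG c n (m + 1)) := by
    rw [← revF_succ_w, gram_revF, ← gram_conjTranspose hc]
    rfl
  rw [shift_comm, shift_Phi_eq hc h1, shift_add, shift_act, shift_act, gram_add_left,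
    gram_act_left, gram_act_left, e1, e2, Matrix.mul_assoc]

/-- Decompose `consPhi` along `Φ_{n,m+1}` and multiply by `z`: the remainder becomes orthogonal to
`Φ_{n,m+1}←`. Hence `hatGamma * Ê` is the Gram matrix of `z * consPhi` with `Φ_{n,m+1}←`, whose rows
are given by the two preceding lemmas. -/
theorem nextE_eq (hc : IsHerm c) (h1 : Pos c (n + 1) m) (h2 : Pos c n (m + 1)) :
    nextE (trueC c n (m + 1)) (trueC c (n + 1) m) (dK c (n + 1) (m + 1)) (dK1 c (n + 1) (m + 1)) =
      dE c (n + 1) (m + 1) := by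
  have hu := (isUpperPos_hatGamma hc h2).isUnit_det
  have h' : Pos c n m := h2.mono le_rfl (Nat.le_succ m)
  have hm : MemF (consPhi c n m) (rect 0 n 0 ((m + 1 : ℕ) : ℤ)) := by
    intro a
    refine Fin.cases ?_ (fun a => ?_) a
    · have hs : MemF (shift 0 1 (Phi c n m)) (rect 0 n 0 ((m + 1 : ℕ) : ℤ)) := (Phi_mem h').shift
      exact hs 0
    · have hs : MemF (Phi c n m) (rect 0 n 0 ((m + 1 : ℕ) : ℤ)) := (Phi_mem h').mono
      exact hs a
  have hD := Phi_decomp hc h2 hm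
  have h0 : gram c (shift 1 0 (consPhi c n m - act (gram c (consPhi c n m) (Phi c n (m + 1)))
      (Phi c n (m + 1)))) (revF n (m + 1) (Phi c n (m + 1))) = 0 :=
    gram_zero' hc (S := rect 1 n 0 ((m + 1 : ℕ) : ℤ)) hD.shift (RPhi_orth hc h2)
  rw [shift_sub, shift_act, gram_sub_left, gram_act_left, sub_eq_zero, ← hatGamma_eq_gram] at h0
  have h3 : gram c (shift 1 0 (consPhi c n m)) (revF n (m + 1) (Phi c n (m + 1))) =
      (U (m + 1))ᵀ * (dA c (n + 1) m * dK c (n + 1) (m + 1) * (dI1 c n (m + 1))ᴴ +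
        dE c (n + 1) m * conjM (dG1 c n (m + 1))) +
      corner (m + 1) m * (dA c (n + 1) m * dK1 c (n + 1) (m + 1) * (dI c n (m + 1))ᵀ +
        dE c (n + 1) m * conjM (dG c n (m + 1))) := by
    rw [U_transpose_mul_add_corner_mul, ← gram_shift_Phi_RPhi_w hc h1 h2,
      ← gram_shift_shift_Phi_RPhi hc h1 h2]
    ext a b
    refine Fin.cases ?_ (fun a => ?_) a <;> rfl
  change (hatGamma (dG1 c n (m + 1)) (dG c n (m + 1)))⁻¹ * _ = _
  rw [← Matrix.nonsing_inv_mul_cancel_left _ (dE c (n + 1) (m + 1)) hu]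
  congr 1
  rw [show hatGamma (dG1 c n (m + 1)) (dG c n (m + 1)) * dE c (n + 1) (m + 1) = _ from h0.symm, h3]
  rfl

/-! ## The formula for `K` -/

theorem isUnit_dQ (h : Pos c i j) : IsUnit (dQ c i (j + 1)).det :=
  (isUpperPos_leadF_phiFam le_rfl (pos_iff_lexSet.mp h)).isUnit_det

/-- Comparison of the coefficients of `z ^ (i+1)` in the recurrence; the reversed column has none.
-/
theorem dQ_succ (hc : IsHerm c) (h : Pos c (i + 1) j) :
    dQ c i (j + 1) = dA c (i + 1) j * dQ c (i + 1) (j + 1) := by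
  have h' : Pos c i j := h.mono (Nat.le_succ i) le_rfl
  have h1 : leadF ((i + 1 : ℕ) : ℤ) (j + 1) (shift 1 0 (Phi c i j)) = dQ c i (j + 1) := by
    ext a b
    simp only [leadF, of_apply, shift, coeff_mono_mul, dQ]
    congr 1
    refine Prod.ext ?_ (sub_zero _)
    change ((i + 1 : ℕ) : ℤ) - 1 = i
    omega
  have h2 : leadF ((i + 1 : ℕ) : ℤ) (j + 1) (revF i j (Phi c i j)) = 0 := by
    ext a b
    refine ((Phi_mem h').revF (e := 0) (e' := i) (f := 0) (f' := j)) a _ fun hk => ?_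
    have := hk.2.1
    simp only at this
    omega
  rw [← h1, shift_Phi_eq hc h]
  have h3 : ∀ (v v' : Fin (j + 1) → Laurent), leadF ((i + 1 : ℕ) : ℤ) (j + 1) (v + v') =
      leadF ((i + 1 : ℕ) : ℤ) (j + 1) v + leadF ((i + 1 : ℕ) : ℤ) (j + 1) v' := by
    intro v v'
    ext a b
    simp [leadF]
  rw [h3, leadF_act, leadF_act, h2, Matrix.mul_zero, add_zero]
  rfl

theorem gram_shift_Phi_act_Phit (hc : IsHerm c) (h2 : Pos c n (m + 2)) :
    gram c (shift 0 1 (Phi c (n + 1) m)) (Phit c n (m + 2)) * (dA (sw c) (m + 2) n)ᴴ =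
      dK c (n + 1) (m + 1) - dK1 c (n + 1) (m + 1) * (dE (sw c) (m + 2) n)ᴴ := by
  have h3 := shift_Phit_eq hc h2
  rw [← sub_eq_iff_eq_add] at h3
  rw [← gram_act_right, ← h3, gram_sub_right, gram_act_right, gram_shift]
  rfl

/-- `K_{n+1,m+1}` relative to the monic polynomials. -/
noncomputable def monicK (c : ℤ × ℤ → ℂ) (n m : ℕ) : Matrix (Fin (m + 1)) (Fin (n + 1)) ℂ :=
  (dQ c (n + 1) (m + 1))⁻¹ * dK c (n + 1) (m + 1) * ((dQ (sw c) (m + 1) (n + 1))ᴴ)⁻¹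

/-- All entries but the last of the monic version of `Φ_{n+1,m}` agree with `w` times the monic
version of `Φ_{n+1,m-1}` up to polynomials of degree at most `(n, m)`, and these are orthogonal to
`Φ̃_{n,m+1}`. So all rows of the normalized `K` but the last are known from lower levels. -/
theorem U1_mul_monicK (hc : IsHerm c) (h1 : Pos c (n + 1) m) (h2 : Pos c n (m + 1)) :
    U1 m * monicK c n m = (dQ c (n + 1) m)⁻¹ *
      (dK c (n + 1) m - dK1 c (n + 1) m * (dE (sw c) (m + 1) n)ᴴ) *
        ((dQ (sw c) m (n + 1))ᴴ)⁻¹ := by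
  cases m with
  | zero => ext a; exact a.elim0
  | succ m =>
    have h1' : Pos c (n + 1) m := h1.mono le_rfl (Nat.le_succ m)
    have hu := isUnit_dQ h1
    have hu' := isUnit_dQ h1'
    have hA := isUnit_det_conjTranspose (isUpperPos_dA hc.sw h2.sw).isUnit_det
    set B := dQ c (n + 1) (m + 1 + 1) with hB
    set Q := dQ c (n + 1) (m + 1) with hQ
    have hlead : leadF ((n + 1 : ℕ) : ℤ) (m + 1 + 1) (shift 0 1 (Phi c (n + 1) m)) =
        Q * U1 (m + 1) := by
      ext a b
      simp only [leadF, of_apply, shift, coeff_mono_mul]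
      refine Fin.lastCases ?_ (fun b => ?_) b
      · have e1 : (Q * U1 (m + 1)) a (Fin.last (m + 1)) = 0 := by
          simp [Matrix.mul_apply, U1, (Fin.castSucc_ne_last _).symm]
        rw [e1]
        refine (Phi_mem h1') a _ fun hk => ?_
        have h3 := hk.2.2.1
        change 0 ≤ ((m + 1 + 1 : ℕ) : ℤ) - 1 - ((Fin.last (m + 1) : Fin (m + 1 + 1)) : ℕ) - 1 at h3
        rw [Fin.val_last] at h3
        omega
      · have e1 : (Q * U1 (m + 1)) a b.castSucc = Q a b := by
          simp [Matrix.mul_apply, U1]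
        rw [e1, hQ, dQ, leadF, of_apply]
        refine congrArg (Phi c (n + 1) m a).coeff (Prod.ext (sub_zero _) ?_)
        change ((m + 1 + 1 : ℕ) : ℤ) - 1 - (b : ℕ) - 1 = ((m + 1 : ℕ) : ℤ) - 1 - (b : ℕ)
        omega
    have hD : MemF (act (U1 (m + 1) * B⁻¹) (Phi c (n + 1) (m + 1)) -
        act Q⁻¹ (shift 0 1 (Phi c (n + 1) m))) (rect 0 n 0 ((m + 1 : ℕ) : ℤ)) := by
      have hS : ∀ k : ℤ × ℤ, k ∈ rect 0 ((n + 1 : ℕ) : ℤ) 0 ((m + 1 : ℕ) : ℤ) →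
          k ∈ lexSet ((n + 1 : ℕ) : ℤ) ((m + 1 : ℕ) : ℤ) ((m + 1 + 1 : ℕ) : ℤ) := by
        rintro k ⟨k1, k2, k3, k4⟩
        exact ⟨k1, k3, k4, by omega⟩
      have h3 := mem_box_of_leadF_eq_zero (i := ((n + 1 : ℕ) : ℤ)) (j := ((m + 1 : ℕ) : ℤ))
        (s := m + 1 + 1) (y := act (U1 (m + 1) * B⁻¹) (Phi c (n + 1) (m + 1)) -
        act Q⁻¹ (shift 0 1 (Phi c (n + 1) m))) (fun a => spc_mono hS ?_) ?_
      · rw [show ((n + 1 : ℕ) : ℤ) - 1 = n by omega] at h3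
        exact h3
      · refine MemF.sub ((Phi_mem h1).act _) (MemF.act ?_ _) a
        exact (Phi_mem h1').shift
      · rw [leadF_sub, leadF_act, leadF_act, hlead,
          show leadF ((n + 1 : ℕ) : ℤ) (m + 1 + 1) (Phi c (n + 1) (m + 1)) = B from rfl,
          Matrix.nonsing_inv_mul_cancel_right _ _ hu, Matrix.nonsing_inv_mul_cancel_left _ _ hu',
          sub_self]
    have h0 : gram c (act (U1 (m + 1) * B⁻¹) (Phi c (n + 1) (m + 1)) -
        act Q⁻¹ (shift 0 1 (Phi c (n + 1) m))) (Phit c n (m + 2)) = 0 :=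
      gram_zero' hc hD (Phit_orth h2).mono
    rw [gram_sub_left, gram_act_left, gram_act_left, sub_eq_zero] at h0
    have h4 : U1 (m + 1) * B⁻¹ * dK c (n + 1) (m + 1 + 1) =
      Q⁻¹ * gram c (shift 0 1 (Phi c (n + 1) m)) (Phit c n (m + 2)) := h0
    rw [monicK, ← Matrix.mul_assoc, ← Matrix.mul_assoc, h4, dQ_succ hc.sw h2.sw, conjTranspose_mul,
      Matrix.mul_inv_rev, ← gram_shift_Phi_act_Phit hc h2, ← Matrix.mul_assoc, ← Matrix.mul_assoc,
      Matrix.mul_nonsing_inv_cancel_right _ _ hA]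

theorem monicK_sw (hc : IsHerm c) : monicK (sw c) m n = (monicK c n m)ᴴ := by
  rw [monicK, monicK, dK_sw hc, conjTranspose_mul, conjTranspose_mul, conjTranspose_nonsing_inv,
    conjTranspose_nonsing_inv, conjTranspose_conjTranspose, ← Matrix.mul_assoc]
  rfl

/-- The parameter `u_{-(n+1),m+1}` of a functional. -/
noncomputable def kparam (c : ℤ × ℤ → ℂ) (n m : ℕ) : ℂ :=
  if n = 0 ∧ m = 0 then dK c (n + 1) (m + 1) 0 0
  else monicK c n m (Fin.last m) (Fin.last n)

/-- Relative to the monic polynomials all rows but the last are fixed by `U1_mul_monicK`, and all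
columns but the last by the same lemma for `sw c`. The single remaining entry is the parameter. -/
theorem nextK_eq_iff (hc : IsHerm c) (h1 : Pos c (n + 1) m) (h2 : Pos c n (m + 1))
    (u : ℤ → ℤ → ℂ) :
    nextK u (trueL c n (m + 1)) (trueL c (n + 1) m) = dK c (n + 1) (m + 1) ↔
      u (-((n : ℤ) + 1)) (m + 1) = kparam c n m := by
  -- Level `(1, 1)` is exceptional: there the parameter is `K` itself, without normalization by
  -- leading coefficients.
  by_cases h0 : n = 0 ∧ m = 0
  · rw [nextK, if_pos h0, kparam, if_pos h0]
    obtain ⟨rfl, rfl⟩ := h0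
    constructor
    · intro h
      have := congrFun (congrFun h 0) 0
      simpa using this
    · intro h
      ext a b
      rw [Fin.fin_one_eq_zero a, Fin.fin_one_eq_zero b]
      simpa using h
  · have hu := isUnit_dQ h1
    have hut := isUnit_det_conjTranspose (isUnit_dQ h2.sw)
    have e1 : lead (n + 1) m (trueL c (n + 1) m).P = dQ c (n + 1) (m + 1) := lead_eq_leadF _ _ _
    have e2 : leadTilde n (m + 1) (trueL c n (m + 1)).Pt = dQ (sw c) (m + 1) (n + 1) := by
      refine Eq.trans ?_ (lead_eq_leadF (m + 1) n (Phi (sw c) (m + 1) n))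
      ext a b
      simp only [leadTilde, lead, of_apply]
      exact coeff_flip _ _
    have hX := eq_single_add_U1 (monicK c n m) (U1_mul_monicK hc h1 h2)
      (H' := (dQ c n (m + 1))⁻¹ * (dK c n (m + 1) - dE c (n + 1) m * conjM (dK1 c n (m + 1))) *
        ((dQ (sw c) (m + 1) n)ᴴ)⁻¹) (by
        have h3 := congrArg conjTranspose (U1_mul_monicK hc.sw h2.sw h1.sw)
        rw [monicK_sw hc, conjTranspose_mul, conjTranspose_conjTranspose] at h3
        have h4 : (U1 n)ᴴ = (U1 n)ᵀ := by
          ext a b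
          simp [U1, apply_ite star]
        rw [h4] at h3
        rw [h3, conjTranspose_mul, conjTranspose_mul, conjTranspose_nonsing_inv,
          conjTranspose_nonsing_inv, conjTranspose_conjTranspose, conjTranspose_sub,
          conjTranspose_mul, conjTranspose_conjTranspose, dK_sw hc, dK1_sw, ← Matrix.mul_assoc,
          conjTranspose_conjTranspose]
        rfl)
    have hK : dK c (n + 1) (m + 1) = dQ c (n + 1) (m + 1) * monicK c n m *
        (dQ (sw c) (m + 1) (n + 1))ᴴ := by
      rw [monicK, ← Matrix.mul_assoc, Matrix.nonsing_inv_mul_cancel_right _ _ hut,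
        Matrix.mul_nonsing_inv_cancel_left _ _ hu]
    rw [kparam, if_neg h0]
    have hN : nextK u (trueL c n (m + 1)) (trueL c (n + 1) m) = dQ c (n + 1) (m + 1) *
        (u (-((n : ℤ) + 1)) (m + 1) • Matrix.single (Fin.last m) (Fin.last n) (1 : ℂ) +
          (U1 m)ᵀ * ((dQ c (n + 1) m)⁻¹ *
            (dK c (n + 1) m - dK1 c (n + 1) m * (dE (sw c) (m + 1) n)ᴴ) *
            ((dQ (sw c) m (n + 1))ᴴ)⁻¹) +
          Matrix.single (Fin.last m) (Fin.last m) (1 : ℂ) * ((dQ c n (m + 1))⁻¹ *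
            (dK c n (m + 1) - dE c (n + 1) m * conjM (dK1 c n (m + 1))) *
            ((dQ (sw c) (m + 1) n)ᴴ)⁻¹) * U1 n) * (dQ (sw c) (m + 1) (n + 1))ᴴ := by
      rw [nextK, if_neg h0, e1, e2]
      rfl
    rw [hN, hK]
    constructor
    · intro h
      have h3 := congrArg (fun M => (dQ c (n + 1) (m + 1))⁻¹ * (M *
        ((dQ (sw c) (m + 1) (n + 1))ᴴ)⁻¹)) h
      simp only [Matrix.mul_nonsing_inv_cancel_right _ _ hut] at h3
      rw [Matrix.nonsing_inv_mul_cancel_left _ _ hu, Matrix.nonsing_inv_mul_cancel_left _ _ hu]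
        at h3
      exact single_smul_add_injective (h3.trans hX)
    · intro h
      rw [h, ← hX]

end Formulas

section Tail

variable {c : ℤ × ℤ → ℂ} {i j n m : ℕ}

/-! ## The column `[φ_{n+1,m+1}^m, …, φ_{n+1,m+1}^0]ᵀ` -/

/-- The form is positive definite on the polynomials of degree at most `(n+1, m+1)` without the
monomial `z ^ (n+1) * w ^ (m+1)`. -/
def SemiPos (c : ℤ × ℤ → ℂ) (n m : ℕ) : Prop :=
  PD c (lexSet ((n + 1 : ℕ) : ℤ) ((m + 1 : ℕ) : ℤ) ((m + 1 : ℕ) : ℤ))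

/-- `[φ_{n+1,m+1}^m, …, φ_{n+1,m+1}^0]ᵀ`. -/
noncomputable def tailPhi (c : ℤ × ℤ → ℂ) (n m : ℕ) : Fin (m + 1) → Laurent :=
  phiFam c (n + 1) (m + 1) (m + 1)

theorem Pos.semi (h : Pos c (n + 1) (m + 1)) : SemiPos c n m :=
  (pos_iff_lexSet.mp h).mono (lexSet_mono (by omega))

theorem tailPhi_mem (h : SemiPos c n m) :
    MemF (tailPhi c n m) (rect 0 ((n + 1 : ℕ) : ℤ) 0 ((m + 1 : ℕ) : ℤ)) := fun a =>
  spc_mono (lexSet_subset_box _ _ _) (phiFam_mem (Nat.le_succ _) h a)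

theorem tailPhi_orth (h : SemiPos c n m) :
    OrthF c (tailPhi c n m) (rect 0 n 0 ((m + 1 : ℕ) : ℤ)) := fun a q hq => by
  refine phiFam_orth (Nat.le_succ _) h a ?_
  rw [show ((n + 1 : ℕ) : ℤ) - 1 = n by omega]
  exact hq

theorem gram_tailPhi (hc : IsHerm c) (h : SemiPos c n m) :
    gram c (tailPhi c n m) (tailPhi c n m) = 1 :=
  gram_phiFam hc (Nat.le_succ _) h

theorem tailPhi_succ (c : ℤ × ℤ → ℂ) (n m : ℕ) (a : Fin (m + 1)) :
    Phi c (n + 1) (m + 1) a.succ = tailPhi c n m a := by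
  rw [Phi, tailPhi, phiFam, phiFam, Fin.val_succ]
  congr 1
  omega

theorem rect_subset_lexSet (n m : ℕ) : rect 0 ((n + 1 : ℕ) : ℤ) 0 m ⊆
    lexSet ((n + 1 : ℕ) : ℤ) ((m + 1 : ℕ) : ℤ) ((m + 1 : ℕ) : ℤ) := by
  rintro k ⟨k1, k2, k3, k4⟩
  exact ⟨k1, k3, by omega, by omega⟩

theorem tailPhi_decomp (hc : IsHerm c) (h : SemiPos c n m) {k : ℕ} {y : Fin k → Laurent}
    (hy : ∀ a, y a ∈ spc (lexSet ((n + 1 : ℕ) : ℤ) ((m + 1 : ℕ) : ℤ) ((m + 1 : ℕ) : ℤ))) :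
    MemF (y - act (gram c y (tailPhi c n m)) (tailPhi c n m)) (rect 0 n 0 ((m + 1 : ℕ) : ℤ)) := by
  intro a
  have h1 := phiFam_decomp hc (Nat.le_succ _) h hy a
  rw [show ((n + 1 : ℕ) : ℤ) - 1 = n by omega] at h1
  exact h1

/-- The matrix `L (Φ_{n+1,m} [φ_{n+1,m+1}^m, …, φ_{n+1,m+1}^0])`. -/
noncomputable def dB (c : ℤ × ℤ → ℂ) (n m : ℕ) : Matrix (Fin (m + 1)) (Fin (m + 1)) ℂ :=
  gram c (Phi c (n + 1) m) (tailPhi c n m)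

theorem isUpperPos_dB (hc : IsHerm c) (h1 : Pos c (n + 1) m) (h : SemiPos c n m) :
    IsUpperPos (dB c n m) := by
  refine isUpperPos_gram_phiFam hc (Nat.le_succ _) h (fun a => ?_) fun a => ?_
  · refine spc_mono (fun k hk => ?_) (isPhi_phiFam le_rfl (pos_iff_lexSet.mp h1) a).mem
    simp only [lexSet, Set.mem_ofPred_eq] at hk ⊢
    omega
  · have := (isPhi_phiFam le_rfl (pos_iff_lexSet.mp h1) a).pos
    rw [show ((m + 1 - 1 - a : ℕ) : ℤ) = ((m + 1 : ℕ) : ℤ) - 1 - (a : ℕ) by omega] at this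
    exact this

/-- Without the tail component, the degree is at most `(n, m+1)` and orthogonality to degree `(n,
m)` remains, so only `Φ̃_{n,m+1}` is left. `SemiPos` suffices, which matters because positivity on
the whole level has yet to be established when `H³` is analysed. -/
theorem Phi_eq_dB (hc : IsHerm c) (h1 : Pos c (n + 1) m) (h2 : Pos c n (m + 1))
    (h : SemiPos c n m) :
    Phi c (n + 1) m = act (dB c n m) (tailPhi c n m) +
      act (dK c (n + 1) (m + 1)) (Phit c n (m + 1)) := by
  have hm := tailPhi_decomp hc h (y := Phi c (n + 1) m)
    fun a => spc_mono (rect_subset_lexSet n m) (Phi_mem h1 a)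
  have ho : OrthF c (Phi c (n + 1) m - act (dB c n m) (tailPhi c n m))
      (rect 0 n 0 (((m + 1 : ℕ) : ℤ) - 1)) :=
    OrthF.sub (Phi_orth h1).mono ((tailPhi_orth h).mono.act _)
  have h3 := Phit_expand hc h2 hm ho
  rw [gram_sub_left, gram_act_left, gram_zero (tailPhi_orth h) (Phit_mem h2), Matrix.mul_zero,
    sub_zero] at h3
  rw [← sub_eq_iff_eq_add']
  exact h3

/-- Pythagoras for `Phi_eq_dB`. Being triangular with positive diagonal, `dB` is thus the Cholesky
factor in the definition of `Γ`. -/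
theorem dB_mul_conjTranspose (hc : IsHerm c) (h1 : Pos c (n + 1) m) (h2 : Pos c n (m + 1))
    (h : SemiPos c n m) :
    1 - dK c (n + 1) (m + 1) * (dK c (n + 1) (m + 1))ᴴ = dB c n m * (dB c n m)ᴴ := by
  have h3 := gram_Phi hc h1
  have h0 : gram c (tailPhi c n m) (Phit c n (m + 1)) = 0 :=
    gram_zero (tailPhi_orth h) (Phit_mem h2)
  have h0' := congrArg conjTranspose h0
  rw [gram_conjTranspose hc, conjTranspose_zero] at h0'
  rw [Phi_eq_dB hc h1 h2 h, gram_add_left, gram_add_right, gram_add_right,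
    gram_act_left, gram_act_left, gram_act_left, gram_act_left, gram_act_right, gram_act_right,
    gram_act_right, gram_act_right, gram_tailPhi hc h, gram_Phit hc h2, h0, h0'] at h3
  rw [← h3]
  simp

theorem gammaOf_dK (hc : IsHerm c) (h1 : Pos c (n + 1) m) (h2 : Pos c n (m + 1))
    (h : SemiPos c n m) : gammaOf (dK c (n + 1) (m + 1)) = dB c n m * U (m + 1) := by
  rw [gammaOf, upperCholesky_eq (isUpperPos_dB hc h1 h) (dB_mul_conjTranspose hc h1 h2 h)]

theorem dG_mul_U_transpose (c : ℤ × ℤ → ℂ) (n m : ℕ) :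
    dG c (n + 1) (m + 1) * (U (m + 1))ᵀ = dB c n m := by
  rw [mul_U_transpose]
  ext a b
  change pair c _ (Phi c (n + 1) (m + 1) b.succ) = _
  rw [tailPhi_succ]
  rfl

/-! ## The formula for `K¹` -/

theorem gram_shift_Phi_act_RPhit (hc : IsHerm c) (h2 : Pos c n (m + 2)) :
    gram c (shift 0 1 (Phi c (n + 1) m)) (revF n (m + 2) (Phit c n (m + 2))) *
        (dA (sw c) (m + 2) n)ᵀ =
      dK1 c (n + 1) (m + 1) - dK c (n + 1) (m + 1) * (dE (sw c) (m + 2) n)ᵀ := by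
  rw [← conjM_conjTranspose, ← gram_act_right, act_conj_RPhit hc h2, gram_sub_right,
    gram_act_right, gram_shift, conjM_conjTranspose]
  rfl

/-- Multiply `Phi_eq_dB` of the previous level by `w` and pair it with the reversed column
`Φ̃_{n,m+1}←`. The `Φ̃` part is orthogonal to it, and the tail consists of all entries but the first
of `Φ_{n+1,m}`, which yields the lower rows of `K¹`. -/
theorem dK1_rows (hc : IsHerm c) (h1 : Pos c (n + 1) m) (h2 : Pos c n (m + 1)) :
    (dG c (n + 1) m * (U m)ᵀ)⁻¹ * (dK1 c (n + 1) m * ((dA (sw c) (m + 1) n)⁻¹)ᵀ -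
        dK c (n + 1) m * (dE (sw c) (m + 1) n)ᵀ * ((dA (sw c) (m + 1) n)⁻¹)ᵀ) =
      (dK1 c (n + 1) (m + 1)).submatrix Fin.succ id := by
  cases m with
  | zero => ext a; exact a.elim0
  | succ m =>
    have h1' : Pos c (n + 1) m := h1.mono le_rfl (Nat.le_succ m)
    have h2' : Pos c n (m + 1) := h2.mono le_rfl (Nat.le_succ _)
    have hB := (isUpperPos_dB hc h1' h1.semi).isUnit_det
    have hA := isUnit_det_transpose' (isUpperPos_dA hc.sw h2.sw).isUnit_det
    have h3 : gram c (shift 0 1 (Phi c (n + 1) m)) (revF n (m + 2) (Phit c n (m + 2))) =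
        dB c n m * (dK1 c (n + 1) (m + 2)).submatrix Fin.succ id := by
      have e1 : gram c (shift 0 1 (Phit c n (m + 1))) (revF n (m + 2) (Phit c n (m + 2))) = 0 :=
        gram_zero' hc (S := rect 0 n 1 ((m + 2 : ℕ) : ℤ)) (Phit_mem h2').shift (RPhit_orth hc h2)
      have e2 : gram c (shift 0 1 (tailPhi c n m)) (revF n (m + 2) (Phit c n (m + 2))) =
          (dK1 c (n + 1) (m + 2)).submatrix Fin.succ id := by
        ext a b
        change pair c (mono 0 1 * tailPhi c n m a) _ = _
        rw [← tailPhi_succ]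
        rfl
      rw [Phi_eq_dB hc h1' h2' h1.semi, shift_add, shift_act, shift_act, gram_add_left,
        gram_act_left, gram_act_left, e1, e2, Matrix.mul_zero, add_zero]
    rw [dG_mul_U_transpose, ← Matrix.sub_mul, ← gram_shift_Phi_act_RPhit hc h2, h3,
      transpose_nonsing_inv, Matrix.mul_nonsing_inv_cancel_right _ _ hA,
      Matrix.nonsing_inv_mul_cancel_left _ _ hB]

theorem dK1_columns (hc : IsHerm c) (h1 : Pos c (n + 1) m) (h2 : Pos c n (m + 1)) :
    ((dA c (n + 1) m)⁻¹ * dK1 c n (m + 1) -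
        (dA c (n + 1) m)⁻¹ * dE c (n + 1) m * conjM (dK c n (m + 1))) *
        (U n * (dG (sw c) (m + 1) n)ᵀ)⁻¹ =
      (dK1 c (n + 1) (m + 1)).submatrix id Fin.succ := by
  have h3 := congrArg transpose (dK1_rows hc.sw h2.sw h1.sw)
  have e1 : (dK c n (m + 1))ᴴᵀ = conjM (dK c n (m + 1)) := rfl
  have e2 : sw (sw c) = c := rfl
  simp only [transpose_mul, transpose_sub, transpose_nonsing_inv, transpose_transpose, dK1_sw,
    dK_sw hc, e1, e2, ← Matrix.mul_assoc] at h3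
  exact h3

/-- By `dK1_rows` and `dK1_columns` only the upper left entry is free. -/
theorem nextK1_eq_iff (hc : IsHerm c) (h1 : Pos c (n + 1) m) (h2 : Pos c n (m + 1))
    (u : ℤ → ℤ → ℂ) :
    nextK1 u (trueC c n (m + 1)) (trueC c (n + 1) m) = dK1 c (n + 1) (m + 1) ↔
      star (u ((n : ℤ) + 1) ((m : ℤ) + 1)) = dK1 c (n + 1) (m + 1) 0 0 := by
  have hN : nextK1 u (trueC c n (m + 1)) (trueC c (n + 1) m) =
      Matrix.of (Fin.cons (Fin.cons (star (u ((n : ℤ) + 1) ((m : ℤ) + 1)))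
        ((dK1 c (n + 1) (m + 1)).submatrix id Fin.succ 0))
        ((dK1 c (n + 1) (m + 1)).submatrix Fin.succ id)) := by
    rw [← dK1_rows hc h1 h2, ← dK1_columns hc h1 h2]
    rfl
  rw [hN]
  constructor
  · intro h
    exact congrFun (congrFun h 0) 0
  · intro h
    ext a b
    refine Fin.cases ?_ (fun a => ?_) a
    · refine Fin.cases ?_ (fun b => ?_) b
      · exact h
      · rfl
    · rfl

end Tail

/-! ## Contractions -/

section Contraction

variable {k l : ℕ}

theorem star_dotProduct_self (x : Fin k → ℂ) :
    star x ⬝ᵥ x = ((‖WithLp.toLp 2 x‖ ^ 2 : ℝ) : ℂ) := by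
  rw [EuclideanSpace.norm_sq_eq, dotProduct]
  push_cast
  refine Finset.sum_congr rfl fun a _ => ?_
  rw [Pi.star_apply, Complex.star_def, Complex.conj_mul']

/-- The identity says `‖K† x‖² + ‖B† x‖² = ‖x‖²`, and `B†` is bounded below because it is
invertible. -/
theorem norm_lt_one_of_mul_conjTranspose {K : Matrix (Fin k) (Fin l) ℂ}
    {B : Matrix (Fin k) (Fin k) ℂ} (hB : IsUnit B.det) (h : 1 - K * Kᴴ = B * Bᴴ) : ‖K‖ < 1 := by
  have hBh := isUnit_det_conjTranspose hB
  -- The summand `1` ensures `M⁻² ≤ 1`, so that `√(1 - M⁻²)` is a genuine square root, also for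
  -- empty matrices.
  set M : ℝ := ‖(Bᴴ)⁻¹‖ + 1 with hM
  have hM0 : 1 ≤ M := by
    have := norm_nonneg ((Bᴴ)⁻¹)
    linarith
  have key : ∀ x : Fin k → ℂ, ‖WithLp.toLp 2 (Kᴴ *ᵥ x)‖ ^ 2 + ‖WithLp.toLp 2 (Bᴴ *ᵥ x)‖ ^ 2 =
      ‖WithLp.toLp 2 x‖ ^ 2 := by
    intro x
    have h1 : star x ⬝ᵥ ((1 - K * Kᴴ) *ᵥ x) = star x ⬝ᵥ ((B * Bᴴ) *ᵥ x) := by rw [h]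
    have h2 : ∀ {r : ℕ} (N : Matrix (Fin k) (Fin r) ℂ),
        star x ⬝ᵥ ((N * Nᴴ) *ᵥ x) = star (Nᴴ *ᵥ x) ⬝ᵥ (Nᴴ *ᵥ x) := by
      intro r N
      rw [← mulVec_mulVec, dotProduct_mulVec, star_mulVec, conjTranspose_conjTranspose]
    rw [sub_mulVec, one_mulVec, dotProduct_sub, h2, h2, star_dotProduct_self,
      star_dotProduct_self, star_dotProduct_self, sub_eq_iff_eq_add] at h1
    have h3 : ‖WithLp.toLp 2 x‖ ^ 2 =
      ‖WithLp.toLp 2 (Bᴴ *ᵥ x)‖ ^ 2 + ‖WithLp.toLp 2 (Kᴴ *ᵥ x)‖ ^ 2 := by exact_mod_cast h1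
    linarith
  have hBx : ∀ x : Fin k → ℂ, ‖WithLp.toLp 2 x‖ ≤ M * ‖WithLp.toLp 2 (Bᴴ *ᵥ x)‖ := by
    intro x
    have h1 := l2_opNorm_mulVec ((Bᴴ)⁻¹) (WithLp.toLp 2 (Bᴴ *ᵥ x))
    have h2 : (Bᴴ)⁻¹ *ᵥ (Bᴴ *ᵥ x) = x := by
      rw [mulVec_mulVec, Matrix.nonsing_inv_mul _ hBh, one_mulVec]
    change ‖WithLp.toLp 2 ((Bᴴ)⁻¹ *ᵥ (Bᴴ *ᵥ x))‖ ≤ _ at h1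
    rw [h2] at h1
    refine h1.trans (mul_le_mul_of_nonneg_right (by linarith) (norm_nonneg _))
  have hlt : Real.sqrt (1 - (M ^ 2)⁻¹) < 1 := by
    rw [Real.sqrt_lt' one_pos]
    have : 0 < (M ^ 2)⁻¹ := by positivity
    linarith
  have hle : (M ^ 2)⁻¹ ≤ 1 := inv_le_one_of_one_le₀ (by nlinarith)
  rw [← l2_opNorm_conjTranspose]
  refine lt_of_le_of_lt ?_ hlt
  rw [l2_opNorm_def]
  refine ContinuousLinearMap.opNorm_le_bound _ (Real.sqrt_nonneg _) fun x => ?_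
  change ‖WithLp.toLp 2 (Kᴴ *ᵥ x.ofLp)‖ ≤ _ * ‖WithLp.toLp 2 x.ofLp‖
  rw [← Real.sqrt_sq (norm_nonneg (WithLp.toLp 2 x.ofLp)), ← Real.sqrt_mul (by linarith)]
  refine Real.le_sqrt_of_sq_le ?_
  have h1 := key x.ofLp
  have h2 := hBx x.ofLp
  have h3 : ‖WithLp.toLp 2 x.ofLp‖ ^ 2 ≤ M ^ 2 * ‖WithLp.toLp 2 (Bᴴ *ᵥ x.ofLp)‖ ^ 2 := by
    rw [← mul_pow]
    exact pow_le_pow_left₀ (norm_nonneg _) h2 2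
  have h4 : (M ^ 2)⁻¹ * ‖WithLp.toLp 2 x.ofLp‖ ^ 2 ≤ ‖WithLp.toLp 2 (Bᴴ *ᵥ x.ofLp)‖ ^ 2 := by
    rw [inv_mul_le_iff₀ (by positivity)]
    exact h3
  nlinarith

/-- By the C*-identity the operator norm of a row is its Euclidean norm. -/
theorem row_mul_conjTranspose (R : Matrix (Fin 1) (Fin k) ℂ) :
    (R * Rᴴ) 0 0 = ((‖R‖ ^ 2 : ℝ) : ℂ) := by
  have h1 := l2_opNorm_conjTranspose_mul_self (Rᴴ)
  rw [conjTranspose_conjTranspose, l2_opNorm_conjTranspose] at h1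
  have h2 : R * Rᴴ = diagonal fun _ => (R * Rᴴ) 0 0 := by
    ext a b
    rw [Fin.fin_one_eq_zero a, Fin.fin_one_eq_zero b, diagonal_apply_eq]
  have h3 : (R * Rᴴ) 0 0 = ((∑ b, ‖R 0 b‖ ^ 2 : ℝ) : ℂ) := by
    rw [Matrix.mul_apply]
    push_cast
    refine Finset.sum_congr rfl fun a _ => ?_
    rw [conjTranspose_apply, Complex.star_def, Complex.mul_conj']
  have h4 : 0 ≤ ∑ b, ‖R 0 b‖ ^ 2 := Finset.sum_nonneg fun _ _ => by positivity
  rw [h2, l2_opNorm_diagonal, pi_norm_const, h3, Complex.norm_real, Real.norm_of_nonneg h4] at h1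
  rw [h3, h1, sq]

theorem row_pos_of_norm_lt_one {K : Matrix (Fin k) (Fin l) ℂ} (hK : ‖K‖ < 1)
    {R : Matrix (Fin 1) (Fin k) ℂ} (hR : R ≠ 0) : 0 < (R * (1 - K * Kᴴ) * Rᴴ : Matrix (Fin 1) (Fin 1) ℂ) 0 0 := by
  have h1 : R * (1 - K * Kᴴ) * Rᴴ = R * Rᴴ - (R * K) * (R * K)ᴴ := by
    rw [Matrix.mul_sub, Matrix.mul_one, Matrix.sub_mul, conjTranspose_mul]
    simp only [Matrix.mul_assoc]
  have h2 : 0 < ‖R‖ := norm_pos_iff.mpr hR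
  have h3 : ‖R * K‖ < ‖R‖ := (l2_opNorm_mul R K).trans_lt (by nlinarith)
  rw [h1, Matrix.sub_apply, row_mul_conjTranspose, row_mul_conjTranspose, ← Complex.ofReal_sub]
  have h4 : 0 < ‖R‖ ^ 2 - ‖R * K‖ ^ 2 := by
    have := norm_nonneg (R * K)
    nlinarith
  exact_mod_cast h4

end Contraction

/-! ## Extension of positivity -/

section Positivity

variable {c : ℤ × ℤ → ℂ} {i j n m : ℕ}

/-- Every `p` splits orthogonally into a multiple of `r` and a polynomial in the smaller monomials;
both squared norms are nonnegative and one of them is positive. -/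
theorem PD.lexSet_succ (hc : IsHerm c) {i j s : ℤ} (h : PD c (lexSet i j s)) {r : Laurent}
    (hr : r ∈ spc (lexSet i j (s + 1))) (h0 : r.coeff (i, s) ≠ 0)
    (ho : ∀ q ∈ spc (lexSet i j s), pair c r q = 0) (hp : 0 < pair c r r) :
    PD c (lexSet i j (s + 1)) := by
  intro p hpm hne
  set t := p.coeff (i, s) / r.coeff (i, s) with ht
  have hd : p - t • r ∈ spc (lexSet i j s) := by
    refine spc_lexSet_succ (Submodule.sub_mem _ hpm (Submodule.smul_mem _ _ hr)) ?_
    rw [AddMonoidAlgebra.coeff_sub, Finsupp.sub_apply, AddMonoidAlgebra.coeff_smul_apply,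
      smul_eq_mul, ht, div_mul_cancel₀ _ h0, sub_self]
  have h1 : pair c (p - t • r) r = 0 := by rw [← star_pair hc, ho _ hd, star_zero]
  have h2 : pair c p p = pair c (p - t • r) (p - t • r) + t * star t * pair c r r := by
    have h3 : p = (p - t • r) + t • r := (sub_add_cancel p (t • r)).symm
    conv_lhs => rw [h3]
    rw [pair_add_left, pair_add_right, pair_add_right, pair_smul_left, pair_smul_right,
      pair_smul_right, pair_smul_left, h1, ho _ hd]
    ring
  have h4 : 0 ≤ t * star t := mul_star_self_nonneg t
  rw [h2]
  by_cases hz : p - t • r = 0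
  · have ht0 : t ≠ 0 := fun h => hne (by rw [h, zero_smul, sub_zero] at hz; exact hz)
    rw [hz, pair_zero_left, zero_add]
    refine mul_pos ?_ hp
    exact lt_of_le_of_ne h4 (mul_ne_zero ht0 (star_ne_zero.mpr ht0)).symm
  · exact add_pos_of_pos_of_nonneg (h _ hd hz) (mul_nonneg h4 hp.le)

/-- `Φ_{n+1,m} - K Φ̃_{n,m+1}`. -/
noncomputable def resid (c : ℤ × ℤ → ℂ) (n m : ℕ) : Fin (m + 1) → Laurent :=
  Phi c (n + 1) m - act (dK c (n + 1) (m + 1)) (Phit c n (m + 1))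

theorem gram_resid_Phit (hc : IsHerm c) (h2 : Pos c n (m + 1)) :
    gram c (resid c n m) (Phit c n (m + 1)) = 0 := by
  rw [resid, gram_sub_left, gram_act_left, gram_Phit hc h2, Matrix.mul_one]
  exact sub_self (dK c (n + 1) (m + 1))

/-- Both terms are orthogonal to degree `(n, m)`, and the coefficient `K` makes the difference
orthogonal to `Φ̃_{n,m+1}`; together these span degree `(n, m+1)`. -/
theorem resid_orth (hc : IsHerm c) (h1 : Pos c (n + 1) m) (h2 : Pos c n (m + 1)) :
    OrthF c (resid c n m) (rect 0 n 0 ((m + 1 : ℕ) : ℤ)) := by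
  intro a q hq
  have h3 : OrthF c (resid c n m) (rect 0 n 0 (((m + 1 : ℕ) : ℤ) - 1)) :=
    OrthF.sub (Phi_orth h1).mono (((Phit_orth h2).mono).act _)
  have hq' : MemF (fun _ : Fin 1 => q) (rect 0 n 0 ((m + 1 : ℕ) : ℤ)) := fun _ => hq
  have h4 := gram_eq_mul hc (Phit_decomp hc h2 hq') h3
  rw [gram_resid_Phit hc h2, Matrix.zero_mul] at h4
  exact congrFun (congrFun h4 a) 0

theorem gram_resid_resid (hc : IsHerm c) (h1 : Pos c (n + 1) m) (h2 : Pos c n (m + 1)) :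
    gram c (resid c n m) (resid c n m) =
      1 - dK c (n + 1) (m + 1) * (dK c (n + 1) (m + 1))ᴴ := by
  have h3 : gram c (Phit c n (m + 1)) (Phi c (n + 1) m) = (dK c (n + 1) (m + 1))ᴴ :=
    (gram_conjTranspose hc _ _).symm
  conv_lhs => arg 3; rw [resid]
  rw [gram_sub_right, gram_act_right, gram_resid_Phit hc h2, Matrix.zero_mul, sub_zero, resid,
    gram_sub_left, gram_act_left, h3, gram_Phi hc h1]

theorem norm_dK_lt_one (hc : IsHerm c) (h1 : Pos c (n + 1) m) (h2 : Pos c n (m + 1))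
    (h : SemiPos c n m) : ‖dK c (n + 1) (m + 1)‖ < 1 :=
  norm_lt_one_of_mul_conjTranspose (isUpperPos_dB hc h1 h).isUnit_det
    (dB_mul_conjTranspose hc h1 h2 h)

/-- Matching leading coefficients splits `p` orthogonally into a polynomial of degree at most `(n,
m+1)` and a combination of residuals. The residuals have the Gram matrix `1 - K K†`, positive
definite for a strict contraction. -/
theorem semiPos_of_norm_lt_one (hc : IsHerm c) (h1 : Pos c (n + 1) m) (h2 : Pos c n (m + 1))
    (hK : ‖dK c (n + 1) (m + 1)‖ < 1) : SemiPos c n m := by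
  intro p hp hne
  set y : Fin 1 → Laurent := fun _ => p with hy
  obtain ⟨M, hM⟩ : ∃ M : Matrix (Fin 1) (Fin (m + 1)) ℂ,
    M = leadF ((n + 1 : ℕ) : ℤ) (m + 1) y * (dQ c (n + 1) (m + 1))⁻¹ := ⟨_, rfl⟩
  have hu := isUnit_dQ h1
  set g := y - act M (resid c n m) with hg
  have hgm : MemF g (rect 0 n 0 ((m + 1 : ℕ) : ℤ)) := by
    have h3 : MemF (y - act M (Phi c (n + 1) m)) (rect 0 n 0 ((m + 1 : ℕ) : ℤ)) := by
      have h4 := mem_box_of_leadF_eq_zero (y := y - act M (Phi c (n + 1) m))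
        (fun a => Submodule.sub_mem _ hp
          (act_mem M (fun b => spc_mono (rect_subset_lexSet n m) (Phi_mem h1 b)) a)) (by
          rw [leadF_sub, leadF_act, hM, show leadF ((n + 1 : ℕ) : ℤ) (m + 1) (Phi c (n + 1) m) =
            dQ c (n + 1) (m + 1) from rfl, Matrix.nonsing_inv_mul_cancel_right _ _ hu, sub_self])
      rw [show ((n + 1 : ℕ) : ℤ) - 1 = n by omega] at h4
      exact h4
    have h5 : g = (y - act M (Phi c (n + 1) m)) +
        act (M * dK c (n + 1) (m + 1)) (Phit c n (m + 1)) := by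
      rw [hg, resid, act_sub, act_mul]
      abel
    rw [h5]
    exact fun a => Submodule.add_mem _ (h3 a) (((Phit_mem h2).act _) a)
  have hyg : y = g + act M (resid c n m) := (sub_add_cancel _ _).symm
  have e0 : gram c (resid c n m) g = 0 := gram_zero (resid_orth hc h1 h2) hgm
  have e1 : gram c g (resid c n m) = 0 := gram_zero' hc hgm (resid_orth hc h1 h2)
  have h6 : gram c y y = gram c g g +
      M * (1 - dK c (n + 1) (m + 1) * (dK c (n + 1) (m + 1))ᴴ) * Mᴴ := by
    conv_lhs => rw [hyg]
    rw [gram_add_left, gram_add_right, gram_add_right, gram_act_left, gram_act_left,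
      gram_act_right, gram_act_right, e0, e1, gram_resid_resid hc h1 h2, Matrix.zero_mul,
      Matrix.mul_zero, add_zero, zero_add, Matrix.mul_assoc]
  have h7 : pair c p p = pair c (g 0) (g 0) +
      (M * (1 - dK c (n + 1) (m + 1) * (dK c (n + 1) (m + 1))ᴴ) * Mᴴ :
        Matrix (Fin 1) (Fin 1) ℂ) 0 0 :=
    congrFun (congrFun h6 0) 0
  rw [h7]
  by_cases hM0 : M = 0
  · rw [hM0, Matrix.zero_mul, Matrix.zero_mul, Matrix.zero_apply, add_zero]
    refine h2 _ (hgm 0) fun h8 => hne ?_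
    have := congrFun hyg 0
    rw [Pi.add_apply, h8, hM0, act_zero_mat, zero_add] at this
    exact this
  · exact add_pos_of_nonneg_of_pos (h2.nonneg (hgm 0)) (row_pos_of_norm_lt_one hK hM0)

end Positivity

section Next

variable {c : ℤ × ℤ → ℂ} {i j n m : ℕ}

/-! ## The rows of `Γ¹` -/

/-- The top polynomial of `Φ_{i,j}` is orthogonal to everything of degree at most `(i, j-1)`. This
is the zero column produced by `U` in the definition of `Γ`. -/
theorem dG_zero (hc : IsHerm c) (h : Pos c i j) (a : Fin j) : dG c i j a 0 = 0 := by
  cases j with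
  | zero => exact a.elim0
  | succ j =>
    rw [dG, gram_apply]
    have hP := isPhi_phiFam le_rfl (pos_iff_lexSet.mp h) 0
    have hm : Pprev c i (j + 1) a ∈ spc (lexSet i ((j + 1 : ℕ) : ℤ) ((j + 1 : ℕ) : ℤ)) := by
      refine spc_mono ?_ (Pprev_mem h a)
      rintro k ⟨k1, k2, k3, k4⟩
      simp only [lexSet, Set.mem_ofPred_eq]
      omega
    rw [← star_pair hc, Phi, hP.orth _ ?_, star_zero]
    simpa using hm

theorem U_mul_transpose (k : ℕ) : U k * (U k)ᵀ = 1 := by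
  rw [mul_U_transpose]
  ext a b
  simp [U, Matrix.one_apply, eq_comm]

theorem U_conjTranspose (k : ℕ) : (U k)ᴴ = (U k)ᵀ := by
  ext a b
  simp only [U, conjTranspose_apply, transpose_apply, of_apply]
  split_ifs <;> simp

theorem U_mul_gammaOf (hc : IsHerm c) (h1 : Pos c (n + 1) m) (h2 : Pos c n (m + 1))
    (h : SemiPos c n m) : U (m + 1) * (gammaOf (dK c (n + 1) (m + 1)))ᴴ = (dB c n m)ᴴ := by
  rw [gammaOf_dK hc h1 h2 h, conjTranspose_mul, U_conjTranspose, ← Matrix.mul_assoc,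
    U_mul_transpose, Matrix.one_mul]

/-- `L (w Φ_{n+1,m} [φ_{n+1,m+1}^m, …, φ_{n+1,m+1}^0])`. -/
noncomputable def dW (c : ℤ × ℤ → ℂ) (n m : ℕ) : Matrix (Fin (m + 1)) (Fin (m + 1)) ℂ :=
  gram c (shift 0 1 (Phi c (n + 1) m)) (tailPhi c n m)

/-- Pair `w Φ_{n+1,m}` with the splitting `Phi_eq_dB` and solve for the tail component; the other
pairings are `gram_shift_Phi_Phi` and `gram_shift_Phi_Phit`. -/
theorem dW_eq (hc : IsHerm c) (h1 : Pos c (n + 1) m) (h2 : Pos c n (m + 1))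
    (h : SemiPos c n m) :
    (dI c (n + 1) m * dE (sw c) (m + 1) (n + 1) * (dI1 c (n + 1) m)ᵀ +
      (dG c (n + 1) m)ᴴ * dG1 c (n + 1) m +
      dK1 c (n + 1) (m + 1) * (conjM (dA (sw c) (m + 1) n))⁻¹ * (dE (sw c) (m + 1) n)ᴴ *
        dA (sw c) (m + 1) n * (dK c (n + 1) (m + 1))ᴴ) *
      (U (m + 1) * (gammaOf (dK c (n + 1) (m + 1)))ᴴ)⁻¹ = dW c n m := by
  have hB := isUnit_det_conjTranspose (isUpperPos_dB hc h1 h).isUnit_det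
  have h3 : gram c (shift 0 1 (Phi c (n + 1) m)) (Phi c (n + 1) m) =
      dW c n m * (dB c n m)ᴴ +
        gram c (shift 0 1 (Phi c (n + 1) m)) (Phit c n (m + 1)) *
          (dK c (n + 1) (m + 1))ᴴ := by
    conv_lhs => arg 3; rw [Phi_eq_dB hc h1 h2 h]
    rw [gram_add_right, gram_act_right, gram_act_right]
    rfl
  rw [gram_shift_Phi_Phi hc h1, gram_shift_Phi_Phit hc h1 h2, Matrix.neg_mul,
    ← sub_eq_add_neg, eq_sub_iff_add_eq] at h3
  rw [h3, U_mul_gammaOf hc h1 h2 h, Matrix.mul_nonsing_inv_cancel_right _ _ hB]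

theorem corner_mul_dI (hc : IsHerm c) (h : Pos c i j) : corner 0 j * dI c i j = corner 0 i := by
  rw [corner_mul]
  ext a b
  rw [Fin.fin_one_eq_zero a, of_apply, Fin.cons_zero, dI_zero_left hc h]
  simp [corner, Matrix.one_apply, Matrix.single_apply]

theorem corner_mul_dI_conjTranspose (hc : IsHerm c) (h : Pos c i j) :
    corner 0 i * (dI c i j)ᴴ = corner 0 j := by
  rw [← dI_sw hc]
  exact corner_mul_dI hc.sw h.sw

theorem corner_mul_dG (hc : IsHerm c) (h : Pos c i j) : corner 0 j * (dG c i j)ᴴ = 0 := by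
  rw [corner_mul]
  ext a b
  rw [Fin.fin_one_eq_zero a, of_apply, Fin.cons_zero, conjTranspose_apply, dG_zero hc h, star_zero]
  rfl

theorem corner_transpose (k l : ℕ) : (corner k l)ᵀ = corner l k := by
  rw [corner, transpose_single]
  rfl

theorem conjTranspose_transpose_eq {k l : ℕ} (M : Matrix (Fin k) (Fin l) ℂ) : Mᴴᵀ = conjM M := rfl

theorem transpose_conjTranspose_eq {k l : ℕ} (M : Matrix (Fin k) (Fin l) ℂ) : Mᵀᴴ = conjM M := rfl

/-- The first row of `Ẽ_{n+1,m+1}` (with hat). -/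
theorem corner_mul_dEt (hc : IsHerm c) (h1 : Pos c (n + 1) m) (h2 : Pos c n (m + 1)) :
    corner 0 (n + 1) * dE (sw c) (m + 1) (n + 1) =
      (corner 0 (n + 1) * ((dI1 c (n + 1) m)ᴴ * conjM (dK c (n + 1) (m + 1)) *
          (dA (sw c) (m + 1) n)ᵀ + (dG1 (sw c) m (n + 1))ᴴ * dE (sw c) (m + 1) n) * U (n + 1) +
        corner 0 m * dK1 c (n + 1) (m + 1) * (dA (sw c) (m + 1) n)ᵀ * corner n (n + 1)) *
        ((hatGamma (dG1 (sw c) m (n + 1)) (dG (sw c) m (n + 1)))ᵀ)⁻¹ := by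
  have h3 := congrArg transpose (nextE_eq hc.sw h2.sw h1.sw)
  rw [dE_transpose] at h3
  rw [← h3]
  simp only [nextE, trueC, transpose_mul, transpose_add, transpose_nonsing_inv,
    transpose_transpose, corner_transpose, dK_sw hc, dK1_sw, dI_sw hc, dI1_sw, dE_transpose,
    conjTranspose_transpose_eq, transpose_conjTranspose_eq, conjM_transpose]
  simp only [← Matrix.mul_assoc, Matrix.mul_add, Matrix.add_mul]
  -- The first unit row annihilates the adjoint of `Γ̃` and passes through `I†`, so the terms with
  -- `Γ̃†` disappear from the first row.
  rw [corner_mul_dI_conjTranspose hc h1, corner_mul_dG hc.sw h1.sw, Matrix.zero_mul, Matrix.zero_mul,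
    Matrix.zero_mul, add_zero]

/-- Only first rows are compared, which is all that `e₁ᵀ H³ e₁` depends on. They involve only the
first row of the tilde `Ê`, supplied by `corner_mul_dEt`. -/
theorem corner_mul_dW (hc : IsHerm c) (h1 : Pos c (n + 1) m) (h2 : Pos c n (m + 1))
    (h : SemiPos c n m) :
    corner 0 m * (H2 (trueC c n (m + 1)) (trueC c (n + 1) m) (dK c (n + 1) (m + 1)) +
      dK1 c (n + 1) (m + 1) * H1 (trueC c n (m + 1)) (trueC c (n + 1) m)
        (dK c (n + 1) (m + 1))) = corner 0 m * dW c n m := by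
  rw [← dW_eq hc h1 h2 h]
  simp only [H1, H2, trueC]
  simp only [← Matrix.mul_assoc, Matrix.mul_add, Matrix.add_mul]
  rw [corner_mul_dI hc h1, corner_mul_dG hc h1, Matrix.zero_mul, Matrix.zero_mul, add_zero,
    corner_mul_dEt hc h1 h2]
  simp only [← Matrix.mul_assoc, Matrix.mul_add, Matrix.add_mul]
  abel

theorem corner_mul_mul_corner {k : ℕ} (M : Matrix (Fin (k + 1)) (Fin (k + 1)) ℂ) :
    (corner 0 k * M * corner k 0) 0 0 = M 0 0 := by
  rw [Matrix.mul_assoc, corner_mul]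
  simp [Matrix.mul_apply, corner, Matrix.single_apply]

theorem H3_zero (hc : IsHerm c) (h1 : Pos c (n + 1) m) (h2 : Pos c n (m + 1))
    (h : SemiPos c n m) :
    H3 (trueC c n (m + 1)) (trueC c (n + 1) m) (dK c (n + 1) (m + 1)) (dK1 c (n + 1) (m + 1)) 0 0 =
      (dW c n m * (dW c n m)ᴴ + dK1 c (n + 1) (m + 1) * (dK1 c (n + 1) (m + 1))ᴴ) 0 0 := by
  rw [H3, Matrix.add_apply, Matrix.add_apply]
  congr 1
  have h3 : corner m 0 = (corner 0 m)ᴴ := by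
    rw [corner, corner, conjTranspose_single, star_one]
  have h4 : ∀ X : Matrix (Fin (m + 1)) (Fin (m + 1)) ℂ,
      corner 0 m * (X * Xᴴ) * corner m 0 = (corner 0 m * X) * (corner 0 m * X)ᴴ := by
    intro X
    rw [conjTranspose_mul, ← h3]
    simp only [Matrix.mul_assoc]
  have h5 : ∀ X Y : Matrix (Fin (m + 1)) (Fin (m + 1)) ℂ, corner 0 m * X = corner 0 m * Y →
      (X * Xᴴ) 0 0 = (Y * Yᴴ) 0 0 := by
    intro X Y hXY
    rw [← corner_mul_mul_corner (X * Xᴴ), ← corner_mul_mul_corner (Y * Yᴴ), h4, h4, hXY]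
  exact h5 _ _ (corner_mul_dW hc h1 h2 h)

/-! ## The remainder `w Φ_{n+1,m} - K¹ Φ̃_{n,m+1}←` -/

/-- `w Φ_{n+1,m} - K¹ Φ̃_{n,m+1}←`. -/
noncomputable def resid1 (c : ℤ × ℤ → ℂ) (n m : ℕ) : Fin (m + 1) → Laurent :=
  shift 0 1 (Phi c (n + 1) m) -
    act (dK1 c (n + 1) (m + 1)) (revF n (m + 1) (Phit c n (m + 1)))

theorem gram_resid1_RPhit (hc : IsHerm c) (h2 : Pos c n (m + 1)) :
    gram c (resid1 c n m) (revF n (m + 1) (Phit c n (m + 1))) = 0 := by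
  rw [resid1, gram_sub_left, gram_act_left, gram_RPhit hc h2, Matrix.mul_one]
  exact sub_self (dK1 c (n + 1) (m + 1))

theorem resid1_orth (hc : IsHerm c) (h1 : Pos c (n + 1) m) (h2 : Pos c n (m + 1)) :
    OrthF c (resid1 c n m) (rect 0 n 0 ((m + 1 : ℕ) : ℤ)) := by
  intro a q hq
  have h3 : OrthF c (resid1 c n m) (rect 0 n 1 ((m + 1 : ℕ) : ℤ)) :=
    OrthF.sub (Phi_orth h1).shift (((RPhit_orth hc h2).mono).act _)
  have hq' : MemF (fun _ : Fin 1 => q) (rect 0 n 0 ((m + 1 : ℕ) : ℤ)) := fun _ => hq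
  have h4 := gram_eq_mul hc (RPhit_decomp hc h2 hq') h3
  rw [gram_resid1_RPhit hc h2, Matrix.zero_mul] at h4
  exact congrFun (congrFun h4 a) 0

theorem resid1_mem (h1 : Pos c (n + 1) m) (h2 : Pos c n (m + 1)) :
    MemF (resid1 c n m) (rect 0 ((n + 1 : ℕ) : ℤ) 0 ((m + 1 : ℕ) : ℤ)) :=
  MemF.sub (Phi_mem h1).shift
    (((Phit_mem h2).revF : MemF (revF n (m + 1) _) (rect 0 n 0 ((m + 1 : ℕ) : ℤ))).mono.act _)

theorem gram_resid1_resid1 (hc : IsHerm c) (h1 : Pos c (n + 1) m) (h2 : Pos c n (m + 1)) :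
    gram c (resid1 c n m) (resid1 c n m) =
      1 - dK1 c (n + 1) (m + 1) * (dK1 c (n + 1) (m + 1))ᴴ := by
  have h3 : gram c (revF n (m + 1) (Phit c n (m + 1))) (shift 0 1 (Phi c (n + 1) m)) =
    (dK1 c (n + 1) (m + 1))ᴴ := (gram_conjTranspose hc _ _).symm
  conv_lhs => arg 3; rw [resid1]
  rw [gram_sub_right, gram_act_right, gram_resid1_RPhit hc h2, Matrix.zero_mul, sub_zero, resid1,
    gram_sub_left, gram_act_left, h3, gram_shift, gram_Phi hc h1]

theorem gram_resid1 (hc : IsHerm c) {k : ℕ} {y : Fin k → Laurent}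
    (h2 : Pos c n (m + 1)) (hy : OrthF c y (rect 0 n 0 ((m + 1 : ℕ) : ℤ))) :
    gram c (resid1 c n m) y = gram c (shift 0 1 (Phi c (n + 1) m)) y := by
  rw [resid1, gram_sub_left, gram_act_left,
    gram_zero' hc ((Phit_mem h2).revF : MemF (revF n (m + 1) _) (rect 0 n 0 ((m + 1 : ℕ) : ℤ))) hy,
    Matrix.mul_zero, sub_zero]

/-- The multiple of `φ_{n+1,m+1}^{m+1}` that the recurrence for `Γ¹` produces. -/
noncomputable def topResid (c : ℤ × ℤ → ℂ) (n m : ℕ) : Fin (m + 1) → Laurent :=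
  resid1 c n m - act (dW c n m) (tailPhi c n m)

theorem gram_topResid_tailPhi (hc : IsHerm c) (h2 : Pos c n (m + 1)) (h : SemiPos c n m) :
    gram c (topResid c n m) (tailPhi c n m) = 0 := by
  rw [topResid, gram_sub_left, gram_act_left, gram_tailPhi hc h, Matrix.mul_one,
    gram_resid1 hc h2 (tailPhi_orth h)]
  exact sub_self (dW c n m)

/-- `resid1` is orthogonal to degree `(n, m+1)`, and its tail component has been removed; these two
account for all monomials before the corner. -/
theorem topResid_orth (hc : IsHerm c) (h1 : Pos c (n + 1) m) (h2 : Pos c n (m + 1))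
    (h : SemiPos c n m) : OrthF c (topResid c n m)
      (lexSet ((n + 1 : ℕ) : ℤ) ((m + 1 : ℕ) : ℤ) ((m + 1 : ℕ) : ℤ)) := by
  intro a q hq
  have h3 : OrthF c (topResid c n m) (rect 0 n 0 ((m + 1 : ℕ) : ℤ)) :=
    OrthF.sub (resid1_orth hc h1 h2) ((tailPhi_orth h).act _)
  have h4 := gram_eq_mul hc (tailPhi_decomp hc h (y := fun _ : Fin 1 => q) fun _ => hq) h3
  rw [gram_topResid_tailPhi hc h2 h, Matrix.zero_mul] at h4
  exact congrFun (congrFun h4 a) 0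

theorem gram_topResid_topResid (hc : IsHerm c) (h1 : Pos c (n + 1) m) (h2 : Pos c n (m + 1))
    (h : SemiPos c n m) :
    gram c (topResid c n m) (topResid c n m) =
      1 - (dW c n m * (dW c n m)ᴴ + dK1 c (n + 1) (m + 1) * (dK1 c (n + 1) (m + 1))ᴴ) := by
  have h3 : gram c (tailPhi c n m) (resid1 c n m) = (dW c n m)ᴴ := by
    rw [← gram_conjTranspose hc, gram_resid1 hc h2 (tailPhi_orth h)]
    rfl
  conv_lhs => arg 3; rw [topResid]
  rw [gram_sub_right, gram_act_right, gram_topResid_tailPhi hc h2 h, Matrix.zero_mul, sub_zero,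
    topResid, gram_sub_left, gram_act_left, h3, gram_resid1_resid1 hc h1 h2]
  abel

theorem topResid_mem (h1 : Pos c (n + 1) m) (h2 : Pos c n (m + 1)) (h : SemiPos c n m) :
    topResid c n m 0 ∈ spc (lexSet ((n + 1 : ℕ) : ℤ) ((m + 1 : ℕ) : ℤ) ((m + 1 : ℕ) + 1)) := by
  rw [lexSet_top]
  exact Submodule.sub_mem _ (resid1_mem h1 h2 0) ((tailPhi_mem h).act _ 0)

theorem coeff_topResid (h1 : Pos c (n + 1) m) (h2 : Pos c n (m + 1)) (h : SemiPos c n m) :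
    0 < (topResid c n m 0).coeff (((n + 1 : ℕ) : ℤ), ((m + 1 : ℕ) : ℤ)) := by
  have h3 : (act (dK1 c (n + 1) (m + 1)) (revF n (m + 1) (Phit c n (m + 1))) 0).coeff
      (((n + 1 : ℕ) : ℤ), ((m + 1 : ℕ) : ℤ)) = 0 := by
    refine (((Phit_mem h2).revF : MemF (revF n (m + 1) _)
      (rect 0 n 0 ((m + 1 : ℕ) : ℤ))).act _) 0 _ ?_
    rintro ⟨k1, k2, k3, k4⟩
    simp only at k2
    omega
  have h4 : (act (dW c n m) (tailPhi c n m) 0).coeff (((n + 1 : ℕ) : ℤ), ((m + 1 : ℕ) : ℤ)) = 0 := by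
    refine act_mem (V := spc (lexSet ((n + 1 : ℕ) : ℤ) ((m + 1 : ℕ) : ℤ) ((m + 1 : ℕ) : ℤ))) _
      (fun a => phiFam_mem (Nat.le_succ _) h a) 0 _ ?_
    simp only [lexSet, Set.mem_ofPred_eq]
    omega
  have h5 := (isPhi_phiFam le_rfl (pos_iff_lexSet.mp h1) 0).pos
  rw [topResid, resid1, Pi.sub_apply, Pi.sub_apply, AddMonoidAlgebra.coeff_sub, Finsupp.sub_apply,
    AddMonoidAlgebra.coeff_sub, Finsupp.sub_apply, h3, h4, sub_zero, sub_zero, shift,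
    coeff_mono_mul]
  have e : (((n + 1 : ℕ) : ℤ), ((m + 1 : ℕ) : ℤ)) - ((0 : ℤ), (1 : ℤ)) =
      (((n + 1 : ℕ) : ℤ), ((m + 1 - 1 - (0 : Fin (m + 1)) : ℕ) : ℤ)) := by
    refine Prod.ext ?_ ?_
    · exact sub_zero _
    · change ((m + 1 : ℕ) : ℤ) - 1 = ((m + 1 - 1 - 0 : ℕ) : ℤ)
      omega
  rw [e]
  exact h5

/-- This is the meaning of the condition on `H³`: it asks for a positive squared norm of the
polynomial that brings in the corner monomial. -/
theorem one_sub_H3 (hc : IsHerm c) (h1 : Pos c (n + 1) m) (h2 : Pos c n (m + 1))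
    (h : SemiPos c n m) : ((1 - (H3 (trueC c n (m + 1)) (trueC c (n + 1) m)
      (dK c (n + 1) (m + 1)) (dK1 c (n + 1) (m + 1)) 0 0).re : ℝ) : ℂ) =
      pair c (topResid c n m 0) (topResid c n m 0) := by
  have h3 := congrFun (congrFun (gram_topResid_topResid hc h1 h2 h) 0) 0
  rw [gram_apply, Matrix.sub_apply, ← H3_zero hc h1 h2 h, Matrix.one_apply_eq] at h3
  have h4 : (pair c (topResid c n m 0) (topResid c n m 0)).im = 0 :=
    Complex.conj_eq_iff_im.mp (star_pair hc _ _)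
  refine Complex.ext ?_ ?_
  · rw [h3]
    simp
  · rw [h4]
    simp

/-- Positivity on the next level. -/
theorem pos_succ_iff (hc : IsHerm c) (h1 : Pos c (n + 1) m) (h2 : Pos c n (m + 1)) :
    Pos c (n + 1) (m + 1) ↔ ‖dK c (n + 1) (m + 1)‖ < 1 ∧
      (H3 (trueC c n (m + 1)) (trueC c (n + 1) m) (dK c (n + 1) (m + 1))
        (dK1 c (n + 1) (m + 1)) 0 0).re < 1 := by
  constructor
  · intro hp
    refine ⟨norm_dK_lt_one hc h1 h2 hp.semi, ?_⟩
    have h3 := one_sub_H3 hc h1 h2 hp.semi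
    have h4 : topResid c n m 0 ≠ 0 := fun h0 => by
      have := coeff_topResid h1 h2 hp.semi
      rw [h0] at this
      exact lt_irrefl _ this
    have hm := topResid_mem h1 h2 hp.semi
    rw [lexSet_top] at hm
    have h5 := hp _ hm h4
    rw [← h3] at h5
    have : 0 < 1 - (H3 (trueC c n (m + 1)) (trueC c (n + 1) m)
      (dK c (n + 1) (m + 1)) (dK1 c (n + 1) (m + 1)) 0 0).re := by exact_mod_cast h5
    linarith
  · rintro ⟨hK, hH⟩
    have h := semiPos_of_norm_lt_one hc h1 h2 hK
    have h3 := one_sub_H3 hc h1 h2 h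
    rw [pos_iff_lexSet, Nat.cast_succ (m + 1)]
    -- Contractivity has already settled all monomials but the corner, and `topResid` adds the last
    -- one.
    refine PD.lexSet_succ hc h (topResid_mem h1 h2 h) (coeff_topResid h1 h2 h).ne'
      (topResid_orth hc h1 h2 h 0) ?_
    rw [← h3]
    exact_mod_cast sub_pos.mpr hH

end Next

section NextLevel

variable {c : ℤ × ℤ → ℂ} {i j n m : ℕ}

/-! ## The data on the next level -/

theorem mul_U_of_zero {k l : ℕ} {M : Matrix (Fin l) (Fin (k + 1)) ℂ} (h : ∀ a, M a 0 = 0) :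
    M * (U k)ᵀ * U k = M := by
  rw [mul_U_transpose, mul_U]
  ext a b
  refine Fin.cases ?_ (fun b => ?_) b
  · rw [h]
    rfl
  · rfl

theorem dG_eq (hc : IsHerm c) (h : Pos c (n + 1) (m + 1)) :
    gammaOf (dK c (n + 1) (m + 1)) = dG c (n + 1) (m + 1) := by
  rw [gammaOf_dK hc (h.mono le_rfl (Nat.le_succ m)) (h.mono (Nat.le_succ n) le_rfl) h.semi,
    ← dG_mul_U_transpose, mul_U_of_zero (dG_zero hc h)]

theorem dG1_succ (c : ℤ × ℤ → ℂ) (n m : ℕ) (a b : Fin (m + 1)) :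
    dG1 c (n + 1) (m + 1) a b.succ = dW c n m a b := by
  rw [dG1, dW, gram_apply, gram_apply, tailPhi_succ]
  rfl

theorem resid1_eq (hc : IsHerm c) (h : Pos c (n + 1) (m + 1)) :
    resid1 c n m = act (dG1 c (n + 1) (m + 1)) (Phi c (n + 1) (m + 1)) := by
  have h1 : Pos c (n + 1) m := h.mono le_rfl (Nat.le_succ m)
  have h2 : Pos c n (m + 1) := h.mono (Nat.le_succ n) le_rfl
  have h3 := Phi_expand hc h (resid1_mem h1 h2) (resid1_orth hc h1 h2).mono
  rwa [gram_resid1 hc h2 (Phi_orth h).mono] at h3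

theorem dG1_zero_zero (hc : IsHerm c) (h : Pos c (n + 1) (m + 1)) :
    ((Real.sqrt (1 - (H3 (trueC c n (m + 1)) (trueC c (n + 1) m) (dK c (n + 1) (m + 1))
      (dK1 c (n + 1) (m + 1)) 0 0).re) : ℝ) : ℂ) = dG1 c (n + 1) (m + 1) 0 0 := by
  have h1 : Pos c (n + 1) m := h.mono le_rfl (Nat.le_succ m)
  have h2 : Pos c n (m + 1) := h.mono (Nat.le_succ n) le_rfl
  have h3 := one_sub_H3 hc h1 h2 h.semi
  have hpos : 0 < dG1 c (n + 1) (m + 1) 0 0 := (isUpperPos_hatGamma hc h).pos 0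
  obtain ⟨g1, g2⟩ := pos_eq_ofReal hpos
  -- In the expansion of `resid1` only the top polynomial survives removal of the tail, so `1 - e₁ᵀ
  -- H³ e₁` is the square of this positive entry.
  have h4 : topResid c n m 0 = dG1 c (n + 1) (m + 1) 0 0 • Phi c (n + 1) (m + 1) 0 := by
    rw [topResid, resid1_eq hc h, Pi.sub_apply, act_apply, act_apply, Fin.sum_univ_succ]
    simp only [dG1_succ, tailPhi_succ]
    exact add_sub_cancel_right _ _
  have h5 : pair c (Phi c (n + 1) (m + 1) 0) (Phi c (n + 1) (m + 1) 0) = 1 := by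
    rw [← gram_apply, gram_Phi hc h, Matrix.one_apply_eq]
  rw [h4, ← g2, pair_smul_self, h5, mul_one] at h3
  rw [Complex.ofReal_inj.mp h3, Real.sqrt_sq g1.le, g2]

theorem nextG1_eq (hc : IsHerm c) (h : Pos c (n + 1) (m + 1)) :
    nextG1 (trueC c n (m + 1)) (trueC c (n + 1) m) (dK c (n + 1) (m + 1)) (dK1 c (n + 1) (m + 1))
      (dE (sw c) (m + 1) (n + 1)) = dG1 c (n + 1) (m + 1) := by
  have h1 : Pos c (n + 1) m := h.mono le_rfl (Nat.le_succ m)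
  have h2 : Pos c n (m + 1) := h.mono (Nat.le_succ n) le_rfl
  have hW := dW_eq hc h1 h2 h.semi
  ext a b
  refine Fin.cases ?_ (fun b => ?_) b
  · refine Fin.cases ?_ (fun a => ?_) a
    · rw [nextG1, ← dG1_zero_zero hc h]
      rfl
    · have h3 : dG1 c (n + 1) (m + 1) a.succ 0 = 0 := by
        have hP := isPhi_phiFam le_rfl (pos_iff_lexSet.mp h) 0
        have hm : shift 0 1 (Phi c (n + 1) m) a.succ ∈
            spc (lexSet ((n + 1 : ℕ) : ℤ) ((m + 1 : ℕ) : ℤ) ((m + 1 : ℕ) : ℤ)) := by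
          refine mono_mul_mem_spc (isPhi_phiFam le_rfl (pos_iff_lexSet.mp h1) a.succ).mem
            fun k hk => ?_
          have := a.succ.2
          simp only [lexSet, Set.mem_ofPred_eq, Prod.fst_add, Prod.snd_add, Fin.val_succ] at hk ⊢
          omega
        have hm' := hP.orth (shift 0 1 (Phi c (n + 1) m) a.succ) (by simpa using hm)
        rw [dG1, gram_apply, ← star_pair hc]
        exact star_eq_zero.mpr hm'
      rw [h3, nextG1]
      simp [Fin.succ_ne_zero]
  · rw [dG1_succ, ← hW]
    rfl

/-- Since `Φ_{n+1,m+1}` is orthogonal to degree `(n, m+1)`, pairing `Phi_eq` with `Φ̃_{n,m+1}` gives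
zero. This determines all columns of `I` but the first, and the first is a unit vector because the
top polynomials coincide. -/
theorem dI_eq (hc : IsHerm c) (h : Pos c (n + 1) (m + 1)) :
    corner (m + 1) (n + 1) - (dG c (n + 1) (m + 1))ᴴ * dK c (n + 1) (m + 1) *
      (U (n + 1) * (dG (sw c) (m + 1) (n + 1))ᴴ)⁻¹ * U (n + 1) = dI c (n + 1) (m + 1) := by
  have h1 : Pos c (n + 1) m := h.mono le_rfl (Nat.le_succ m)
  have h2 : Pos c n (m + 1) := h.mono (Nat.le_succ n) le_rfl
  have hB := isUnit_det_conjTranspose (isUpperPos_dB hc.sw h2.sw h.sw.semi).isUnit_det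
  set Gt := dG (sw c) (m + 1) (n + 1) with hGt
  have e1 : U (n + 1) * Gtᴴ = (dB (sw c) m n)ᴴ := by
    rw [← dG_mul_U_transpose, conjTranspose_mul, ← U_conjTranspose, conjTranspose_conjTranspose]
  have e2 : Gtᴴ = (U (n + 1))ᵀ * (dB (sw c) m n)ᴴ := by
    rw [← e1, ← Matrix.mul_assoc]
    have := congrArg conjTranspose (mul_U_of_zero (dG_zero hc.sw h.sw))
    rw [conjTranspose_mul, conjTranspose_mul, ← U_conjTranspose, conjTranspose_conjTranspose,
      U_conjTranspose, ← Matrix.mul_assoc] at this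
    exact this.symm
  have e3 : Gtᴴ = gram c (Phit c (n + 1) (m + 1)) (Phit c n (m + 1)) := by
    have := gram_flipF (sw c) (Phit (sw c) m (n+1)) (Phi (sw c) (m + 1) (n + 1))
    rw [hGt, dG, gram_conjTranspose hc.sw, ← gram_flipF]
    rfl
  have h3 : gram c (Phi c (n + 1) (m + 1)) (Phit c n (m + 1)) = 0 :=
    gram_zero (S := rect 0 n 0 ((m + 1 : ℕ) : ℤ)) (Phi_orth h).mono (Phit_mem h2)
  rw [Phi_eq hc h, gram_add_left, gram_act_left, gram_act_left, ← e3, e2, ← Matrix.mul_assoc] at h3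
  have h4 : dI c (n + 1) (m + 1) * (U (n + 1))ᵀ =
      -((dG c (n + 1) (m + 1))ᴴ * dK c (n + 1) (m + 1) * ((dB (sw c) m n)ᴴ)⁻¹) := by
    have h5 := eq_neg_of_add_eq_zero_left h3
    rw [← Matrix.mul_nonsing_inv_cancel_right ((dB (sw c) m n)ᴴ)
      (dI c (n + 1) (m + 1) * (U (n + 1))ᵀ) hB, h5,
      Matrix.neg_mul]
    rfl
  rw [e1, sub_eq_add_neg, ← Matrix.neg_mul, ← h4, mul_U, mul_U_transpose]
  ext a b
  rw [Matrix.add_apply]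
  refine Fin.cases ?_ (fun b => ?_) b
  · rw [dI_zero_right hc h]
    simp [corner, Matrix.one_apply, Matrix.single_apply, eq_comm]
  · simp [corner, (Fin.succ_ne_zero b).symm]

/-- The recurrences solved by `nextP`: all residuals are orthogonal to degree `(n, m+1)` and thus
expand in `Φ_{n+1,m+1}`. -/
theorem act_cons_resid (hc : IsHerm c) (h : Pos c (n + 1) (m + 1)) :
    (Fin.cons (resid1 c n m 0) (resid c n m) : Fin (m + 2) → Laurent) =
      act (hatGamma (dG1 c (n + 1) (m + 1)) (dG c (n + 1) (m + 1))) (Phi c (n + 1) (m + 1)) := by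
  have h1 : Pos c (n + 1) m := h.mono le_rfl (Nat.le_succ m)
  have h2 : Pos c n (m + 1) := h.mono (Nat.le_succ n) le_rfl
  have h3 : resid c n m = act (dG c (n + 1) (m + 1)) (Phi c (n + 1) (m + 1)) := by
    have h4 := Phi_expand hc h (y := resid c n m)
      (MemF.sub (Phi_mem h1).mono ((Phit_mem h2).mono.act _)) (resid_orth hc h1 h2).mono
    conv_lhs at h4 => rw [resid]
    rw [resid, gram_sub_left, gram_act_left, gram_zero' hc (S := rect 0 n 0 ((m + 1 : ℕ) : ℤ))
      (Phit_mem h2) (Phi_orth h).mono, Matrix.mul_zero, sub_zero] at h4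
    exact h4
  rw [h3, resid1_eq hc h]
  ext a : 1
  refine Fin.cases ?_ (fun a => ?_) a <;> rfl

theorem nextP_eq (hc : IsHerm c) (h : Pos c (n + 1) (m + 1)) :
    nextP (mono 0 1) (Phi c (n + 1) m) (Phit c n (m + 1))
      (fun k => rev n (m + 1) (Phit c n (m + 1) k)) (dK c (n + 1) (m + 1)) (dK1 c (n + 1) (m + 1))
      (dG1 c (n + 1) (m + 1)) = Phi c (n + 1) (m + 1) := by
  have hu := (isUpperPos_hatGamma hc h).isUnit_det
  rw [nextP, dG_eq hc h]
  change act _ (Fin.cons (resid1 c n m 0) (resid c n m)) = _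
  rw [act_cons_resid hc h, ← act_mul, Matrix.nonsing_inv_mul _ hu, act_one]

theorem flipF_cons {k : ℕ} (p : Laurent) (y : Fin k → Laurent) :
    flipF (Fin.cons p y : Fin (k + 1) → Laurent) = Fin.cons (flip p) (flipF y) := by
  ext a : 1
  refine Fin.cases ?_ (fun a => ?_) a <;> rfl

theorem flipF_nextP {k l : ℕ} (x : Laurent) (p : Fin (k + 1) → Laurent)
    (q qr : Fin (l + 1) → Laurent) (K K1 : Matrix (Fin (k + 1)) (Fin (l + 1)) ℂ)
    (G1 : Matrix (Fin (k + 1)) (Fin (k + 2)) ℂ) :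
    flipF (nextP x p q qr K K1 G1) = nextP (flip x) (flipF p) (flipF q) (flipF qr) K K1 G1 := by
  rw [nextP, nextP, flipF_act, flipF_cons, map_sub, map_mul]
  congr 3
  · rw [← flipF_act]
    rfl
  · change flipF (p - act K q) = _
    rw [flipF_sub, flipF_act]
    rfl

theorem nextPt_eq (hc : IsHerm c) (h : Pos c (n + 1) (m + 1)) :
    nextP (mono 1 0) (Phit c n (m + 1)) (Phi c (n + 1) m)
      (fun k => rev (n + 1) m (Phi c (n + 1) m k)) (dK c (n + 1) (m + 1))ᴴ
      (dK1 c (n + 1) (m + 1))ᵀ (dG1 (sw c) (m + 1) (n + 1)) = Phit c (n + 1) (m + 1) := by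
  have h1 := congrArg flipF (nextP_eq hc.sw h.sw)
  rw [flipF_nextP, dK_sw hc, dK1_sw, flip_mono] at h1
  change nextP _ _ (flipF (flipF _)) (flipF (revF m (n + 1) (flipF _))) _ _ _ = _ at h1
  rw [flipF_revF, flipF_flipF] at h1
  exact h1

theorem leadTilde_eq (n m : ℕ) (v : Fin (n + 1) → Laurent) :
    leadTilde n m v = lead m n (flipF v) := by
  ext a b
  simp only [leadTilde, lead, of_apply, flipF, coeff_flip]

/-- The parameters enter the step only through `K` and `K¹`; the rest follows from the formulas
above, applied to `c` and to `sw c`. -/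
theorem stepZW_eq (hc : IsHerm c) (h : Pos c (n + 1) (m + 1)) {u : ℤ → ℤ → ℂ}
    (hK : nextK u (trueL c n (m + 1)) (trueL c (n + 1) m) = dK c (n + 1) (m + 1))
    (hK1 : nextK1 u (trueC c n (m + 1)) (trueC c (n + 1) m) = dK1 c (n + 1) (m + 1)) :
    stepZW u (trueL c n (m + 1)) (trueL c (n + 1) m) = trueL c (n + 1) (m + 1) := by
  have h1 : Pos c (n + 1) m := h.mono le_rfl (Nat.le_succ m)
  have h2 : Pos c n (m + 1) := h.mono (Nat.le_succ n) le_rfl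
  have eE := nextE_eq hc h1 h2
  have eEt := nextE_eq hc.sw h2.sw h1.sw
  have eG := dG_eq hc h
  have eGt := dG_eq hc.sw h.sw
  have eG1 := nextG1_eq hc h
  have eG1t := nextG1_eq hc.sw h.sw
  rw [← trueC_swap hc, ← trueC_swap hc, dK_sw hc, dK1_sw] at eEt eG1t
  rw [dK_sw hc] at eGt
  have eI := dI_eq hc h
  have eI1 := dI1_succ hc h
  have eP := nextP_eq hc h
  have ePt := nextPt_eq hc h
  have eA := dA_eq hc h
  have eAt := dA_eq hc.sw h.sw
  have s0 : sw (sw c) = c := rfl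
  have t1 : (trueL c n (m + 1)).toCoeffs = trueC c n (m + 1) := rfl
  have t2 : (trueL c (n + 1) m).toCoeffs = trueC c (n + 1) m := rfl
  rw [s0] at eG1t
  simp only [stepZW, t1, t2, hK, hK1, eE, eEt, eG, eGt, eG1, eG1t, eA, eAt, eI]
  rw [show (trueL c (n + 1) m).P = Phi c (n + 1) m from rfl,
    show (trueL c n (m + 1)).Pt = Phit c n (m + 1) from rfl,
    show (trueC c n (m + 1)).I1 = dI1 c n (m + 1) from rfl, eP, ePt, ← eI1, leadTilde_eq,
    lead_eq_leadF, lead_eq_leadF, show flipF (Phit c n (m + 1)) = Phi (sw c) (m + 1) n from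
      flipF_flipF _]
  rfl

end NextLevel

section Boundary

variable {c : ℤ × ℤ → ℂ} {i j n m : ℕ}

/-! ## The levels `(n, 0)` and `(0, m)` -/

theorem row_mul_conjTranspose_entry (M : Matrix (Fin 1) (Fin 1) ℂ) :
    (M * Mᴴ) 0 0 = ((‖M 0 0‖ ^ 2 : ℝ) : ℂ) := by
  simp [Matrix.mul_apply, Complex.mul_conj']

theorem mul_apply_one {k l : ℕ} (M : Matrix (Fin k) (Fin 1) ℂ) (N : Matrix (Fin 1) (Fin l) ℂ)
    (a : Fin k) (b : Fin l) : (M * N) a b = M a 0 * N 0 b := by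
  simp [Matrix.mul_apply]

theorem Coeffs.eq_of {a b : Coeffs n m} (hK : a.K = b.K) (hK1 : a.K1 = b.K1) (hG : a.G = b.G)
    (hGt : a.Gt = b.Gt) (hG1 : a.G1 = b.G1) (hG1t : a.G1t = b.G1t) (hE : a.E = b.E)
    (hEt : a.Et = b.Et) (hA : a.A = b.A) (hAt : a.At = b.At) (hI : a.I = b.I)
    (hI1 : a.I1 = b.I1) : a = b := by
  cases a
  cases b
  simp_all

theorem Level.eq_of {a b : Level n m} (hC : a.toCoeffs = b.toCoeffs) (hP : a.P = b.P)
    (hPt : a.Pt = b.Pt) (hQ : a.Q = b.Q) (hQt : a.Qt = b.Qt) : a = b := by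
  cases a
  cases b
  simp_all

theorem eq_of_fin_zero {l : ℕ} (M N : Matrix (Fin 0) (Fin l) ℂ) : M = N := by
  ext a
  exact a.elim0

theorem eq_of_fin_one {M N : Matrix (Fin 1) (Fin 1) ℂ} (h : M 0 0 = N 0 0) : M = N := by
  ext a b
  rw [Fin.fin_one_eq_zero a, Fin.fin_one_eq_zero b, h]

theorem coeff_shift_Phi_pos (h : Pos c n m) :
    0 < (shift 1 0 (Phi c n m) 0).coeff (((n + 1 : ℕ) : ℤ), (m : ℤ)) := by
  have h5 := (isPhi_phiFam le_rfl (pos_iff_lexSet.mp h) 0).pos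
  rw [shift, coeff_mono_mul]
  have e : (((n + 1 : ℕ) : ℤ), (m : ℤ)) - ((1 : ℤ), (0 : ℤ)) =
      ((n : ℤ), ((m + 1 - 1 - (0 : Fin (m + 1)) : ℕ) : ℤ)) := by
    refine Prod.ext ?_ ?_
    · change ((n + 1 : ℕ) : ℤ) - 1 = n
      omega
    · change (m : ℤ) - 0 = ((m + 1 - 1 - 0 : ℕ) : ℤ)
      omega
  rw [e]
  exact h5

/-- `z Φ_{n,0} - Ê_{n+1,0} Φ_{n,0}←`. -/
noncomputable def residZ (c : ℤ × ℤ → ℂ) (n : ℕ) : Fin 1 → Laurent :=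
  shift 1 0 (Phi c n 0) - act (dE c (n + 1) 0) (revF n 0 (Phi c n 0))

theorem gram_residZ_RPhi (hc : IsHerm c) (h : Pos c n 0) :
    gram c (residZ c n) (revF n 0 (Phi c n 0)) = 0 := by
  rw [residZ, gram_sub_left, gram_act_left, gram_RPhi hc h, Matrix.mul_one]
  exact sub_self (dE c (n + 1) 0)

theorem residZ_orth (hc : IsHerm c) (h : Pos c n 0) : OrthF c (residZ c n) (rect 0 n 0 0) := by
  intro a q hq
  have h3 : OrthF c (residZ c n) (rect 1 n 0 ((0 : ℕ) : ℤ)) :=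
    OrthF.sub (Phi_orth h).shift ((RPhi_orth hc h).mono.act _)
  have hq' : MemF (fun _ : Fin 1 => q) (rect 0 n 0 ((0 : ℕ) : ℤ)) := fun _ => hq
  have h4 := gram_eq_mul hc (RPhi_decomp hc h hq') h3
  rw [gram_residZ_RPhi hc h, Matrix.zero_mul] at h4
  exact congrFun (congrFun h4 a) 0

theorem gram_residZ_residZ (hc : IsHerm c) (h : Pos c n 0) :
    gram c (residZ c n) (residZ c n) = 1 - dE c (n + 1) 0 * (dE c (n + 1) 0)ᴴ := by
  have h3 : gram c (revF n 0 (Phi c n 0)) (shift 1 0 (Phi c n 0)) = (dE c (n + 1) 0)ᴴ :=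
    (gram_conjTranspose hc _ _).symm
  conv_lhs => arg 3; rw [residZ]
  rw [gram_sub_right, gram_act_right, gram_residZ_RPhi hc h, Matrix.zero_mul, sub_zero, residZ,
    gram_sub_left, gram_act_left, h3, gram_shift, gram_Phi hc h]

theorem pair_residZ (hc : IsHerm c) (h : Pos c n 0) :
    pair c (residZ c n 0) (residZ c n 0) = ((1 - ‖dE c (n + 1) 0 0 0‖ ^ 2 : ℝ) : ℂ) := by
  rw [← gram_apply, gram_residZ_residZ hc h, Matrix.sub_apply, row_mul_conjTranspose_entry]
  simp

theorem residZ_mem (h : Pos c n 0) : MemF (residZ c n) (rect 0 ((n + 1 : ℕ) : ℤ) 0 0) :=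
  MemF.sub (Phi_mem h).shift
    (((Phi_mem h).revF : MemF (revF n 0 _) (rect 0 n 0 0)).mono.act _)

theorem coeff_residZ (h : Pos c n 0) :
    0 < (residZ c n 0).coeff (((n + 1 : ℕ) : ℤ), ((0 : ℕ) : ℤ)) := by
  have h3 : (act (dE c (n + 1) 0) (revF n 0 (Phi c n 0)) 0).coeff
      (((n + 1 : ℕ) : ℤ), ((0 : ℕ) : ℤ)) = 0 := by
    refine (((Phi_mem h).revF : MemF (revF n 0 _) (rect 0 n 0 0)).act _) 0 _ ?_
    rintro ⟨k1, k2, k3, k4⟩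
    simp only at k2
    omega
  rw [residZ, Pi.sub_apply, AddMonoidAlgebra.coeff_sub, Finsupp.sub_apply, h3, sub_zero]
  exact coeff_shift_Phi_pos h

/-- The one-variable counterpart of `pos_succ_iff`: the new polynomial `residZ` has squared norm `1
- |Ê|²`. -/
theorem pos_succ_zero_iff (hc : IsHerm c) (h : Pos c n 0) :
    Pos c (n + 1) 0 ↔ ‖dE c (n + 1) 0 0 0‖ < 1 := by
  have h0 := pair_residZ hc h
  have h4 : residZ c n 0 ≠ 0 := fun h0 => by
    have := coeff_residZ h
    rw [h0] at this
    exact lt_irrefl _ this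
  have h5 : ‖dE c (n + 1) 0 0 0‖ < 1 ↔ 0 < pair c (residZ c n 0) (residZ c n 0) := by
    rw [h0]
    have := norm_nonneg (dE c (n + 1) 0 0 0)
    norm_cast
    constructor <;> intro h <;> nlinarith
  rw [h5]
  constructor
  · intro hp
    exact hp _ (residZ_mem h 0) h4
  · intro hp
    rw [pos_iff_lexSet, Nat.cast_succ 0]
    refine PD.lexSet_succ hc ?_ ?_ (coeff_residZ h).ne' (fun q hq => residZ_orth hc h 0 q ?_) hp
    · rw [Nat.cast_zero, lexSet_zero, show ((n + 1 : ℕ) : ℤ) - 1 = n by omega]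
      exact h
    · rw [lexSet_top]
      exact residZ_mem h 0
    · rw [Nat.cast_zero, lexSet_zero, show ((n + 1 : ℕ) : ℤ) - 1 = n by omega] at hq
      exact hq

theorem rho_eq_dA (hc : IsHerm c) (h : Pos c (n + 1) 0) :
    rho (dE c (n + 1) 0 0 0) = dA c (n + 1) 0 0 0 := by
  have h1 := congrFun (congrFun (dA_mul_conjTranspose hc h) 0) 0
  obtain ⟨g1, g2⟩ := pos_eq_ofReal ((isUpperPos_dA hc h).pos 0)
  rw [Matrix.sub_apply, row_mul_conjTranspose_entry, row_mul_conjTranspose_entry,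
    Matrix.one_apply_eq, ← g2, Complex.norm_real, Real.norm_of_nonneg g1.le] at h1
  have h2 : 1 - ‖dE c (n + 1) 0 0 0‖ ^ 2 = (dA c (n + 1) 0 0 0).re ^ 2 := by exact_mod_cast h1
  rw [rho, h2, Real.sqrt_sq g1.le, g2]

-- With no lower power of `z` available, the monomials up to `w ^ l` do not depend on the bound for
-- the exponent of `w`.
open Classical in
theorem phi_zero_succ {l : ℕ} (c : ℤ × ℤ → ℂ) (hl : l ≤ j) : phi c 0 (j + 1) l = phi c 0 j l := by
  have h1 : ∀ s : ℤ, s ≤ j + 1 →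
      lexSet ((0 : ℕ) : ℤ) ((j + 1 : ℕ) : ℤ) s = lexSet ((0 : ℕ) : ℤ) (j : ℤ) s := by
    intro s hs
    ext k
    simp only [lexSet, Set.mem_ofPred_eq]
    omega
  have h2 : IsPhi c 0 (j + 1) l = IsPhi c 0 j l := by
    funext p
    refine propext ⟨fun h => ⟨?_, h.pos, ?_, h.norm⟩, fun h => ⟨?_, h.pos, ?_, h.norm⟩⟩
    · rw [← h1 _ (by omega)]; exact h.mem
    · rw [← h1 _ (by omega)]; exact h.orth
    · rw [h1 _ (by omega)]; exact h.mem
    · rw [h1 _ (by omega)]; exact h.orth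
  rw [phi, phi]
  exact congrArg (fun P : Laurent → Prop => if h : ∃ p, P p then h.choose else 0) h2

theorem Phi_zero_succ (c : ℤ × ℤ → ℂ) (j : ℕ) (a : Fin (j + 1)) :
    Phi c 0 (j + 1) a.succ = Phi c 0 j a := by
  rw [Phi, Phi, phiFam, phiFam, Fin.val_succ,
    show j + 1 + 1 - 1 - ((a : ℕ) + 1) = j + 1 - 1 - a by omega]
  exact phi_zero_succ c (by omega)

theorem dG_zero_left (hc : IsHerm c) (h : Pos c 0 (j + 1)) : dG c 0 (j + 1) = U (j + 1) := by
  have h1 := gram_Phi hc h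
  ext a b
  have h2 := congrFun (congrFun h1 a.succ) b
  rw [gram_apply, Phi_zero_succ] at h2
  rw [dG, gram_apply]
  refine h2.trans ?_
  simp [U, Matrix.one_apply, eq_comm]

theorem dG1_zero_left_succ (c : ℤ × ℤ → ℂ) (j : ℕ) (a : Fin (j + 1)) (b : Fin (j + 1)) :
    dG1 c 0 (j + 1) a b.succ = gram c (shift 0 1 (Phi c 0 j)) (Phi c 0 j) a b := by
  rw [dG1, gram_apply, Phi_zero_succ]
  rfl

theorem dG1_zero_left_zero (hc : IsHerm c) (h : Pos c 0 (j + 1)) (a : Fin j) :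
    dG1 c 0 (j + 1) a.succ 0 = 0 := by
  have h1 : Pos c 0 j := h.mono le_rfl (Nat.le_succ j)
  have hP := isPhi_phiFam le_rfl (pos_iff_lexSet.mp h) 0
  have hm : shift 0 1 (Phi c 0 j) a.succ ∈
      spc (lexSet ((0 : ℕ) : ℤ) ((j + 1 : ℕ) : ℤ) ((j + 1 : ℕ) : ℤ)) := by
    refine mono_mul_mem_spc (isPhi_phiFam le_rfl (pos_iff_lexSet.mp h1) a.succ).mem
      fun k hk => ?_
    have := a.succ.2
    simp only [lexSet, Set.mem_ofPred_eq, Prod.fst_add, Prod.snd_add, Fin.val_succ] at hk ⊢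
    omega
  have hm' := hP.orth (shift 0 1 (Phi c 0 j) a.succ) (by simpa using hm)
  rw [dG1, gram_apply, ← star_pair hc]
  exact star_eq_zero.mpr hm'

theorem dG1_zero_left_succ_succ (c : ℤ × ℤ → ℂ) (j : ℕ) (a : Fin j) (b : Fin (j + 1)) :
    dG1 c 0 (j + 1) a.succ b.succ = dG1 c 0 j a b := by
  cases j with
  | zero => exact a.elim0
  | succ j =>
    rw [dG1_zero_left_succ, gram_apply, dG1, gram_apply, shift, Phi_zero_succ]
    rfl

theorem gram_shift_Phi_Phit_boundary (hc : IsHerm c) (h : Pos c (n + 1) 0) :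
    gram c (shift 1 0 (Phi c n 0)) (Phit c n 0) = dE c (n + 1) 0 * dI1 c n 0 := by
  have h' : Pos c n 0 := h.mono (Nat.le_succ n) le_rfl
  rw [shift_Phi_eq hc h, gram_add_left, gram_act_left, gram_act_left,
    gram_zero (S := rect 0 n 0 ((0 : ℕ) : ℤ)) (Phi_orth h).mono (Phit_mem h'), Matrix.mul_zero]
  exact zero_add _

/-- After interchanging the variables the old column is the tail of the new one, so the lower rows
are inherited. The first row comes from pairing the scalar recurrence with `Φ_{n+1,0}` and with
`Φ̃_{n,0}`. -/
theorem dG1_boundary (hc : IsHerm c) (h : Pos c (n + 1) 0) :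
    dG1 (sw c) 0 (n + 1) = Matrix.of (Fin.cons (Fin.cons (rho (dE c (n + 1) 0 0 0))
      fun j => dE c (n + 1) 0 0 0 * dI1 c n 0 0 j) fun i => Fin.cons 0 (dG1 (sw c) 0 n i)) := by
  have h' : Pos c n 0 := h.mono (Nat.le_succ n) le_rfl
  have e0 : Phi (sw c) 0 n 0 = flip (Phi c n 0 0) := by
    rw [← Phit_zero h', Phit, flipF, flip_flip]
  have e1 : Phi (sw c) 0 (n + 1) 0 = flip (Phi c (n + 1) 0 0) := by
    rw [← Phit_zero h, Phit, flipF, flip_flip]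
  ext a b
  refine Fin.cases ?_ (fun a => ?_) a
  · have e2 : shift 0 1 (Phi (sw c) 0 n) 0 = flip (shift 1 0 (Phi c n 0) 0) := by
      rw [shift, e0, shift, map_mul, flip_mono]
    refine Fin.cases ?_ (fun b => ?_) b
    · rw [rho_eq_dA hc h]
      change pair (sw c) (shift 0 1 (Phi (sw c) 0 n) 0) (Phi (sw c) 0 (n + 1) 0) = _
      rw [e2, e1, pair_flip]
      rfl
    · rw [dG1_zero_left_succ, gram_apply, e2, ← flip_flip (Phi (sw c) 0 n b), pair_flip]
      change gram c (shift 1 0 (Phi c n 0)) (Phit c n 0) 0 b = _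
      rw [gram_shift_Phi_Phit_boundary hc h, Matrix.mul_apply]
      simp
  · refine Fin.cases ?_ (fun b => ?_) b
    · rw [dG1_zero_left_zero hc.sw h.sw]
      rfl
    · rw [dG1_zero_left_succ_succ]
      rfl

/-- For `1 × 1` blocks `A` is real and commutes with `E†`, so the prefactor `Ā⁻¹ E† A` reduces to
`E†`. -/
theorem I1_formula_of_fin_one {A E : Matrix (Fin 1) (Fin 1) ℂ} {I : Matrix (Fin 1) (Fin (n + 2)) ℂ}
    (I1 : Matrix (Fin 1) (Fin (n + 1)) ℂ) (hA : 0 < A 0 0)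
    (hI : ∀ b, I 0 b = (1 : Matrix (Fin (n + 2)) (Fin (n + 2)) ℂ) 0 b) :
    -((conjM A)⁻¹ * Eᴴ * A * I) + Aᵀ * I1 * U (n + 1) =
      Matrix.of fun _ => Fin.cons (-star (E 0 0)) fun j => A 0 0 * I1 0 j := by
  obtain ⟨g1, g2⟩ := pos_eq_ofReal hA
  have e0 : star (A 0 0) = A 0 0 := by
    rw [← g2, Complex.star_def, Complex.conj_ofReal]
  have hu : IsUnit (conjM A).det := by
    rw [det_fin_one, conjM_apply, e0]
    exact hA.ne'.isUnit
  have e : Eᴴ * A = conjM A * Eᴴ := by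
    refine eq_of_fin_one ?_
    rw [mul_apply_one, mul_apply_one, conjM_apply, e0, mul_comm]
  rw [Matrix.mul_assoc (conjM A)⁻¹, e, Matrix.nonsing_inv_mul_cancel_left _ _ hu, mul_U]
  ext a b
  rw [Fin.fin_one_eq_zero a, Matrix.add_apply, Matrix.neg_apply, mul_apply_one, hI]
  refine Fin.cases ?_ (fun b => ?_) b
  · simp
  · simp [(Fin.succ_ne_zero b).symm, mul_apply_one]

theorem dI1_boundary (hc : IsHerm c) (h : Pos c (n + 1) 0) :
    dI1 c (n + 1) 0 = Matrix.of fun _ => Fin.cons (-star (dE c (n + 1) 0 0 0))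
      fun j => rho (dE c (n + 1) 0 0 0) * dI1 c n 0 0 j := by
  rw [dI1_succ hc h, dG_zero_left hc.sw h.sw, rho_eq_dA hc h]
  exact I1_formula_of_fin_one _ ((isUpperPos_dA hc h).pos 0) (dI_zero_left hc h)

theorem stepZ_eq (hc : IsHerm c) (h : Pos c (n + 1) 0) {u : ℤ → ℤ → ℂ}
    (hu : u ((n : ℤ) + 1) 0 = dE c (n + 1) 0 0 0) :
    stepZ u (trueL c n 0) = trueL c (n + 1) 0 := by
  have hP : (rho (dE c (n + 1) 0 0 0))⁻¹ • (mono 1 0 * Phi c n 0 0 -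
      dE c (n + 1) 0 0 0 • rev n 0 (Phi c n 0 0)) = Phi c (n + 1) 0 0 := by
    have h1 := congrFun (shift_Phi_eq hc h) 0
    have h2 : ∀ (M : Matrix (Fin 1) (Fin 1) ℂ) (y : Fin 1 → Laurent), act M y 0 = M 0 0 • y 0 :=
      fun M y => by simp [act]
    rw [Pi.add_apply, h2, h2] at h1
    have h3 : mono 1 0 * Phi c n 0 0 = _ := h1
    rw [h3, rho_eq_dA hc h, revF, add_sub_cancel_right, smul_smul,
      inv_mul_cancel₀ ((isUpperPos_dA hc h).pos 0).ne', one_smul]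
  refine Level.eq_of (Coeffs.eq_of (eq_of_fin_zero _ _) (eq_of_fin_zero _ _) (eq_of_fin_zero _ _)
    (dG_zero_left hc.sw h.sw).symm (eq_of_fin_zero _ _) ?_ (eq_of_fin_one hu) rfl (eq_of_fin_one ?_)
    rfl ?_ ?_) ?_ ?_ (eq_of_fin_zero _ _) ?_
  · refine Eq.trans ?_ (dG1_boundary hc h).symm
    rw [← hu]
    rfl
  · exact (congrArg rho hu).trans (rho_eq_dA hc h)
  · change corner 0 (n + 1) = dI c (n + 1) 0
    ext a b
    rw [Fin.fin_one_eq_zero a, dI_zero_left hc h]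
    simp [corner, Matrix.one_apply, Matrix.single_apply]
  · refine Eq.trans ?_ (dI1_boundary hc h).symm
    rw [← hu]
    rfl
  · ext a : 1
    rw [Fin.fin_one_eq_zero a, ← hu] at *
    exact hP
  · rw [← hu] at hP
    change Fin.cons _ (Phit c n 0) = Phit c (n + 1) 0
    ext a : 1
    refine Fin.cases ?_ (fun a => ?_) a
    · exact hP.trans (Phit_zero h).symm
    · rw [Fin.cons_succ, Phit, Phit, flipF, flipF, Phi_zero_succ]
  · change leadTilde n 0 (Phit c n 0) = dQ (sw c) 0 (n + 1)
    rw [leadTilde_eq, Phit, flipF_flipF, lead_eq_leadF]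
    rfl

/-- Interchange of the two orderings. -/
noncomputable def Level.swap {n m : ℕ} (a : Level n m) : Level m n :=
  { a.toCoeffs.swap with
    P := flipF a.Pt
    Pt := flipF a.P
    Q := a.Qt
    Qt := a.Q }

theorem trueL_swap (hc : IsHerm c) (i j : ℕ) : (trueL c i j).swap = trueL (sw c) j i := by
  have h1 := trueC_swap hc i j
  have t : (trueL c i j).toCoeffs = trueC c i j := rfl
  rw [Level.swap, t, h1]
  have t1 : flipF (trueL c i j).Pt = Phi (sw c) j i := flipF_flipF _
  rw [t1]
  rfl

theorem stepW_eq_swap (u : ℤ → ℤ → ℂ) {m : ℕ} (b : Level 0 m) :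
    stepW u b = (stepZ (fun x y => u y x) b.swap).swap := by
  have h1 : flip ((rho (u 0 (m + 1)))⁻¹ • (mono 1 0 * flip (b.Pt 0) -
      u 0 (m + 1) • rev m 0 (flip (b.Pt 0)))) = (rho (u 0 (m + 1)))⁻¹ •
        (mono 0 1 * b.Pt 0 - u 0 (m + 1) • rev 0 m (b.Pt 0)) := by
    rw [map_smul, map_sub, map_mul, map_smul, flip_rev, flip_mono, flip_flip]
  refine Level.eq_of rfl ?_ ?_ ?_ rfl
  · refine Eq.trans ?_ (flipF_cons _ _).symm
    refine Eq.trans ?_ (congrArg₂ Fin.cons h1.symm (flipF_flipF b.P).symm)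
    rfl
  · ext a : 1
    exact h1.symm
  · change lead 0 m b.P = leadTilde m 0 (flipF b.P)
    rw [leadTilde_eq, flipF_flipF]

theorem stepW_eq (hc : IsHerm c) (h : Pos c 0 (m + 1)) {u : ℤ → ℤ → ℂ}
    (hu : u 0 ((m : ℤ) + 1) = dE (sw c) (m + 1) 0 0 0) :
    stepW u (trueL c 0 m) = trueL c 0 (m + 1) := by
  rw [stepW_eq_swap, trueL_swap hc, stepZ_eq hc.sw h.sw hu, trueL_swap hc.sw]
  rfl

theorem pos_zero_iff : Pos c 0 0 ↔ 0 < c (0, 0) := by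
  have hz : ∀ p ∈ spc (rect 0 ((0 : ℕ) : ℤ) 0 ((0 : ℕ) : ℤ)), p = p.coeff (0, 0) • mono 0 0 := by
    intro p hp
    refine laurent_ext fun k => ?_
    rw [AddMonoidAlgebra.coeff_smul_apply, coeff_mono]
    by_cases hk : k = (0, 0)
    · simp [hk]
    · rw [if_neg (by simpa using Ne.symm hk), smul_zero]
      refine hp k fun h => hk ?_
      obtain ⟨h1, h2, h3, h4⟩ := h
      exact Prod.ext (by change k.1 = 0; omega) (by change k.2 = 0; omega)
  have h1 : pair c (mono 0 0) (mono 0 0) = c (0, 0) := by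
    rw [pair_mono]
    rfl
  constructor
  · intro h
    rw [← h1]
    refine h _ (mono_mem_spc ⟨le_rfl, le_rfl, le_rfl, le_rfl⟩) fun h0 => ?_
    have := congrArg (fun p : Laurent => p.coeff (0, 0)) h0
    simp [coeff_mono] at this
  · intro h p hp hne
    rw [hz p hp, pair_smul_left, pair_smul_right, h1, ← mul_assoc]
    have h2 : p.coeff (0, 0) ≠ 0 := fun h0 => hne (by rw [hz p hp, h0, zero_smul])
    exact mul_pos (lt_of_le_of_ne (mul_star_self_nonneg _)
      (mul_ne_zero h2 (star_ne_zero.mpr h2)).symm) h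

theorem Phi_zero_zero (h : Pos c 0 0) :
    (fun _ => ((1 / Real.sqrt (c (0, 0)).re : ℝ) : ℂ) • mono 0 0 : Fin 1 → Laurent) =
      Phi c 0 0 := by
  have h0 := pos_zero_iff.mp h
  obtain ⟨h1, h2⟩ := pos_eq_ofReal h0
  have hs := Real.sqrt_pos.mpr h1
  ext a : 1
  rw [Fin.fin_one_eq_zero a]
  refine IsPhi.eq_phi (by simp) ?_ ⟨?_, ?_, ?_, ?_⟩
  · simpa using pos_iff_lexSet.mp h
  · refine Submodule.smul_mem _ _ (mono_mem_spc ?_)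
    simp [lexSet]
  · rw [AddMonoidAlgebra.coeff_smul_apply, coeff_mono]
    simp only [Fin.val_zero, Nat.sub_zero, Nat.add_sub_cancel, Nat.cast_zero, if_true, smul_eq_mul,
      mul_one]
    exact_mod_cast one_div_pos.mpr hs
  · intro q hq
    have hq0 : q = 0 := by
      refine laurent_ext fun k => hq k fun hk => ?_
      simp only [lexSet, Set.mem_ofPred_eq, Fin.val_zero] at hk
      omega
    rw [hq0, pair_zero_right]
  · rw [pair_smul_self, pair_mono]
    change _ * c (0, 0) = 1
    have h3 : (1 / Real.sqrt (c (0, 0)).re) ^ 2 = ((c (0, 0)).re)⁻¹ := by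
      rw [one_div, inv_pow, Real.sq_sqrt h1.le]
    rw [h3]
    conv_lhs => arg 2; rw [← h2]
    rw [← Complex.ofReal_mul, inv_mul_cancel₀ h1.ne', Complex.ofReal_one]

theorem level00_eq (hc : IsHerm c) (h : Pos c 0 0) {u : ℤ → ℤ → ℂ} (hu : u 0 0 = c (0, 0)) :
    level00 u = trueL c 0 0 := by
  have e1 := Phi_zero_zero h
  have e2 : Phit c 0 0 = Phi c 0 0 := by
    ext a : 1
    rw [Fin.fin_one_eq_zero a, Phit_zero h]
  have e3 : (1 : Matrix (Fin 1) (Fin 1) ℂ) = dI c 0 0 := by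
    rw [dI, e2, gram_Phi hc h]
  have e4 : (1 : Matrix (Fin 1) (Fin 1) ℂ) = dI1 c 0 0 := by
    have : revF 0 0 (Phi c 0 0) = Phi c 0 0 := by
      rw [← e1]
      ext a : 1
      rw [revF, rev_smul, Complex.star_def, Complex.conj_ofReal, rev, dagger_mono, mono_mul_mono]
      rfl
    rw [dI1, e2, this, gram_Phi hc h]
  have e5 : (level00 u).P = Phi c 0 0 := by
    rw [← e1, ← hu]
    rfl
  exact Level.eq_of (Coeffs.eq_of (eq_of_fin_zero _ _) (eq_of_fin_zero _ _) (eq_of_fin_zero _ _)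
    (eq_of_fin_zero _ _) (eq_of_fin_zero _ _) (eq_of_fin_zero _ _) rfl rfl rfl rfl e3 e4)
    e5 (e5.trans e2.symm) (eq_of_fin_zero _ _) (eq_of_fin_zero _ _)

end Boundary

/-! ## Dependence on the moments -/

section Moments

variable {c c' : ℤ × ℤ → ℂ} {i j n m : ℕ}

theorem pair_eq_sum (c : ℤ × ℤ → ℂ) (p q : Laurent) :
    pair c p q = ∑ k ∈ p.coeff.support, ∑ l ∈ q.coeff.support,
      p.coeff k * star (q.coeff l) * c (k - l) := by
  conv_lhs => rw [laurent_eq_sum_mono p, laurent_eq_sum_mono q]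
  rw [pair_sum_left]
  refine Finset.sum_congr rfl fun k _ => ?_
  rw [pair_sum_right]
  refine Finset.sum_congr rfl fun l _ => ?_
  rw [pair_smul_left, pair_smul_right, pair_mono, mul_assoc]
  rfl

theorem mem_of_mem_support {S : Set (ℤ × ℤ)} {p : Laurent} (hp : p ∈ spc S) {k : ℤ × ℤ}
    (hk : k ∈ p.coeff.support) : k ∈ S := by
  by_contra h
  exact Finsupp.mem_support_iff.mp hk (hp k h)

theorem pair_congr {S T : Set (ℤ × ℤ)} {p q : Laurent} (hp : p ∈ spc S) (hq : q ∈ spc T)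
    (h : ∀ k ∈ S, ∀ l ∈ T, c (k - l) = c' (k - l)) : pair c p q = pair c' p q := by
  rw [pair_eq_sum, pair_eq_sum]
  refine Finset.sum_congr rfl fun k hk => Finset.sum_congr rfl fun l hl => ?_
  rw [h k (mem_of_mem_support hp hk) l (mem_of_mem_support hq hl)]

/-- Effect of a change of the moments that concerns a single pair of exponents. -/
theorem pair_add_moments {S T : Set (ℤ × ℤ)} {p q : Laurent} (hp : p ∈ spc S) (hq : q ∈ spc T)
    {d : ℤ × ℤ → ℂ} {k₀ l₀ : ℤ × ℤ}
    (h : ∀ k ∈ S, ∀ l ∈ T, d (k - l) ≠ 0 → k = k₀ ∧ l = l₀) :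
    pair (c + d) p q = pair c p q + p.coeff k₀ * star (q.coeff l₀) * d (k₀ - l₀) := by
  have h1 : pair d p q = p.coeff k₀ * star (q.coeff l₀) * d (k₀ - l₀) := by
    rw [pair_eq_sum]
    rw [Finset.sum_eq_single k₀, Finset.sum_eq_single l₀]
    · intro l hl hne
      by_cases hk : k₀ ∈ S
      · by_contra h0
        exact hne (h k₀ hk l (mem_of_mem_support hq hl) (right_ne_zero_of_mul h0)).2
      · rw [hp k₀ hk, zero_mul, zero_mul]
    · intro h0
      rw [Finsupp.notMem_support_iff.mp h0, star_zero, mul_zero, zero_mul]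
    · intro k hk hne
      refine Finset.sum_eq_zero fun l hl => ?_
      by_contra h0
      exact hne (h k (mem_of_mem_support hp hk) l (mem_of_mem_support hq hl)
        (right_ne_zero_of_mul h0)).1
    · intro h0
      rw [Finsupp.notMem_support_iff.mp h0]
      simp
  rw [← h1, pair_eq_sum, pair_eq_sum, pair_eq_sum, ← Finset.sum_add_distrib]
  refine Finset.sum_congr rfl fun k _ => ?_
  rw [← Finset.sum_add_distrib]
  refine Finset.sum_congr rfl fun l _ => ?_
  rw [Pi.add_apply, mul_add]

/-- The moments `c` and `c'` agree for the exponents with `|a| ≤ i`, `|b| ≤ j`. -/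
def AgreeOn (c c' : ℤ × ℤ → ℂ) (i j : ℕ) : Prop := ∀ k ∈ rect (-i) i (-j) j, c k = c' k

theorem AgreeOn.symm (h : AgreeOn c c' i j) : AgreeOn c' c i j := fun k hk => (h k hk).symm

theorem AgreeOn.mono {i' j' : ℕ} (h : AgreeOn c c' i j) (hi : i' ≤ i) (hj : j' ≤ j) :
    AgreeOn c c' i' j' :=
  fun k hk => h k (rect_mono (by omega) (by omega) (by omega) (by omega) hk)

theorem AgreeOn.sw (h : AgreeOn c c' i j) : AgreeOn (sw c) (sw c') j i :=
  fun k hk => h (k.2, k.1) ⟨hk.2.2.1, hk.2.2.2, hk.1, hk.2.1⟩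

theorem AgreeOn.pair_eq (h : AgreeOn c c' i j) {p q : Laurent} (hp : p ∈ spc (rect 0 i 0 j))
    (hq : q ∈ spc (rect 0 i 0 j)) : pair c p q = pair c' p q := by
  refine pair_congr hp hq fun k hk l hl => h _ ?_
  obtain ⟨h1, h2, h3, h4⟩ := hk
  obtain ⟨g1, g2, g3, g4⟩ := hl
  exact ⟨by simp only [Prod.fst_sub]; omega, by simp only [Prod.fst_sub]; omega,
    by simp only [Prod.snd_sub]; omega, by simp only [Prod.snd_sub]; omega⟩

theorem AgreeOn.gram_eq (h : AgreeOn c c' i j) {k l : ℕ} {y : Fin k → Laurent}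
    {q : Fin l → Laurent} (hy : MemF y (rect 0 i 0 j)) (hq : MemF q (rect 0 i 0 j)) :
    gram c y q = gram c' y q := by
  ext a b
  exact h.pair_eq (hy a) (hq b)

theorem Pos.congr (h : Pos c i j) (ha : AgreeOn c c' i j) : Pos c' i j := by
  intro p hp hne
  rw [← ha.pair_eq hp hp]
  exact h p hp hne

open Classical in
theorem AgreeOn.phi_eq {l : ℕ} (h : AgreeOn c c' i j) : phi c i j l = phi c' i j l := by
  have h1 : ∀ s : ℤ, ∀ p ∈ spc (lexSet i j s), p ∈ spc (rect 0 i 0 j) := fun s p hp =>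
    spc_mono (lexSet_subset_box _ _ _) hp
  have h2 : IsPhi c i j l = IsPhi c' i j l := by
    funext p
    refine propext ⟨fun hp => ⟨hp.mem, hp.pos, fun q hq => ?_, ?_⟩,
      fun hp => ⟨hp.mem, hp.pos, fun q hq => ?_, ?_⟩⟩
    · rw [← h.pair_eq (h1 _ _ hp.mem) (h1 _ _ hq), hp.orth q hq]
    · rw [← h.pair_eq (h1 _ _ hp.mem) (h1 _ _ hp.mem), hp.norm]
    · rw [h.pair_eq (h1 _ _ hp.mem) (h1 _ _ hq), hp.orth q hq]
    · rw [h.pair_eq (h1 _ _ hp.mem) (h1 _ _ hp.mem), hp.norm]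
  rw [phi, phi]
  exact congrArg (fun P : Laurent → Prop => if h : ∃ p, P p then h.choose else 0) h2

theorem AgreeOn.Phi_eq (h : AgreeOn c c' i j) : Phi c i j = Phi c' i j :=
  funext fun _ => h.phi_eq

theorem AgreeOn.Phit_eq (h : AgreeOn c c' i j) : Phit c i j = Phit c' i j := by
  rw [Phit, Phit, h.sw.Phi_eq]

theorem AgreeOn.Pprev_eq (h : AgreeOn c c' i j) : Pprev c i j = Pprev c' i j := by
  cases j with
  | zero => exact funext fun a => a.elim0
  | succ j => exact (h.mono le_rfl (Nat.le_succ j)).Phi_eq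

theorem AgreeOn.Ptprev_eq (h : AgreeOn c c' i j) : Ptprev c i j = Ptprev c' i j := by
  rw [Ptprev, Ptprev, h.sw.Pprev_eq]

theorem Ptprev_mem (h : Pos c i j) : MemF (Ptprev c i j) (rect 0 (i - 1) 0 j) :=
  (Pprev_mem h.sw).flipF

theorem shift_Pprev_mem (hp : Pos c i j) :
    MemF (shift 0 1 (Pprev c i j)) (rect 0 i 0 j) := (Pprev_mem hp).shift

theorem AgreeOn.dE_eq (h : AgreeOn c c' i j) (hp : Pos c i j) : dE c i j = dE c' i j := by
  cases i with
  | zero => rfl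
  | succ i =>
    have hp' := hp.mono (Nat.le_succ i) le_rfl
    rw [dE, dE, ← (h.mono (Nat.le_succ i) le_rfl).Phi_eq]
    refine h.gram_eq (Phi_mem hp').shift (MemF.mono (a := 0) (a' := i) (b := 0) (b' := j) ?_)
    exact (Phi_mem hp').revF

theorem AgreeOn.dK1_eq (h : AgreeOn c c' i j) (hp : Pos c i j) : dK1 c i j = dK1 c' i j := by
  rw [dK1, dK1, ← h.Pprev_eq, ← h.Ptprev_eq]
  refine h.gram_eq (shift_Pprev_mem hp) ?_
  cases i with
  | zero => exact fun a => a.elim0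
  | succ i =>
    have h1 : MemF (Ptprev c (i + 1) j) (rect 0 i 0 j) := (Ptprev_mem hp).mono
    have h2 : MemF (revF i j (Ptprev c (i + 1) j)) (rect 0 i 0 j) := h1.revF
    exact h2.mono

/-! ### The orthonormal polynomials determine the moments -/

theorem pair_eq_of_mem_span {s : Set Laurent} (h : ∀ p ∈ s, ∀ q ∈ s, pair c p q = pair c' p q)
    {p q : Laurent} (hp : p ∈ Submodule.span ℂ s) (hq : q ∈ Submodule.span ℂ s) :
    pair c p q = pair c' p q := by
  have h1 : ∀ p ∈ s, pair c p q = pair c' p q := by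
    intro p hp
    induction hq using Submodule.span_induction with
    | mem q hq => exact h p hp q hq
    | zero => rw [pair_zero_right, pair_zero_right]
    | add q q' _ _ h h' => rw [pair_add_right, pair_add_right, h, h']
    | smul a q _ h => rw [pair_smul_right, pair_smul_right, h]
  induction hp using Submodule.span_induction with
  | mem p hp => exact h1 p hp
  | zero => rw [pair_zero_left, pair_zero_left]
  | add p p' _ _ h h' => rw [pair_add_left, pair_add_left, h, h']
  | smul a p _ h => rw [pair_smul_left, pair_smul_left, h]

/-- `Phi_decomp` removes one power of `z` at a time. -/
theorem spc_le_span_Phi (hc : IsHerm c) (h : Pos c n m) (i : ℕ) (hi : i ≤ n) :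
    spc (rect 0 i 0 m) ≤
      Submodule.span ℂ {p | ∃ i' : ℕ, i' ≤ n ∧ ∃ k : Fin (m + 1), p = Phi c i' m k} := by
  set V := Submodule.span ℂ {p | ∃ i' : ℕ, i' ≤ n ∧ ∃ k : Fin (m + 1), p = Phi c i' m k}
  have key : ∀ i : ℕ, i ≤ n → (∀ q ∈ spc (rect 0 ((i : ℤ) - 1) 0 m), q ∈ V) →
      spc (rect 0 i 0 m) ≤ V := by
    intro i hi ih q hq
    have h1 := Phi_decomp hc (h.mono hi le_rfl) (y := fun _ : Fin 1 => q) (fun _ => hq) 0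
    have h0 : ∀ k, Phi c i m k ∈ V := fun k => Submodule.subset_span ⟨i, hi, k, rfl⟩
    have h2 := act_mem (gram c (fun _ : Fin 1 => q) (Phi c i m)) h0 0
    have h3 := V.add_mem (ih _ h1) h2
    rwa [Pi.sub_apply, sub_add_cancel] at h3
  induction i with
  | zero =>
    refine key 0 hi fun q hq => ?_
    have : q = 0 := laurent_ext fun k => hq k fun hk => by
      obtain ⟨h1, h2, h3, h4⟩ := hk
      push_cast at h2
      omega
    rw [this]
    exact V.zero_mem
  | succ i ih =>
    refine key (i + 1) hi fun q hq => ih (by omega) ?_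
    rwa [show ((i + 1 : ℕ) : ℤ) - 1 = i by omega] at hq

theorem gram_Phi_Phi (hc : IsHerm c) (h : Pos c n m) {i i' : ℕ} (hi : i ≤ n) (hi' : i' ≤ n)
    (k l : Fin (m + 1)) :
    pair c (Phi c i m k) (Phi c i' m l) = if i = i' ∧ k = l then 1 else 0 := by
  rcases lt_trichotomy i i' with h1 | h1 | h1
  · have h3 : MemF (Phi c i m) (rect 0 ((i' : ℤ) - 1) 0 m) := (Phi_mem (h.mono hi le_rfl)).mono
    rw [if_neg (by omega), ← star_pair hc, Phi_orth (h.mono hi' le_rfl) _ _ (h3 k), star_zero]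
  · subst h1
    rw [← gram_apply, gram_Phi hc (h.mono hi le_rfl), Matrix.one_apply]
    simp
  · have h3 : MemF (Phi c i' m) (rect 0 ((i : ℤ) - 1) 0 m) := (Phi_mem (h.mono hi' le_rfl)).mono
    rw [if_neg (by omega), Phi_orth (h.mono hi le_rfl) _ _ (h3 l)]

/-- Every exponent in the symmetric rectangle is the difference of its positive and negative parts,
so its moment is a pairing of two monomials of degree at most `(n, m)`. -/
theorem agreeOn_of_pair_eq
    (h : ∀ p ∈ spc (rect 0 n 0 m), ∀ q ∈ spc (rect 0 n 0 m), pair c p q = pair c' p q) :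
    AgreeOn c c' n m := by
  rintro ⟨x, y⟩ ⟨h1, h2, h3, h4⟩
  simp only at h1 h2 h3 h4
  have h5 := h (mono (max x 0) (max y 0)) (mono_mem_spc
    ⟨by simp only; omega, by simp only; omega, by simp only; omega, by simp only; omega⟩)
    (mono (max (-x) 0) (max (-y) 0)) (mono_mem_spc
    ⟨by simp only; omega, by simp only; omega, by simp only; omega, by simp only; omega⟩)
  rw [pair_mono, pair_mono] at h5
  rwa [show max x 0 - max (-x) 0 = x by omega, show max y 0 - max (-y) 0 = y by omega] at h5

/-- The two forms agree on a spanning family. Neither positivity nor hermitian symmetry of `c'` is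
needed. -/
theorem agreeOn_of_orthonormal (hc : IsHerm c) (h : Pos c n m)
    (ho : ∀ i i' : ℕ, i ≤ n → i' ≤ n → ∀ k l : Fin (m + 1),
      pair c' (Phi c i m k) (Phi c i' m l) = if i = i' ∧ k = l then 1 else 0) :
    AgreeOn c c' n m := by
  refine agreeOn_of_pair_eq fun p hp q hq => ?_
  refine pair_eq_of_mem_span ?_ (spc_le_span_Phi hc h n le_rfl hp) (spc_le_span_Phi hc h n le_rfl hq)
  rintro p ⟨i, hi, k, rfl⟩ q ⟨i', hi', l, rfl⟩
  rw [gram_Phi_Phi hc h hi hi', ho i i' hi hi']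

end Moments

section Algorithm

variable {c c' : ℤ × ℤ → ℂ} {u : ℤ → ℤ → ℂ} {i j n m : ℕ}

/-! ## The algorithm computes the data of a functional -/

/-- The parameters `u` are those of the functional with the moments `c`. -/
structure Matches (c : ℤ × ℤ → ℂ) (u : ℤ → ℤ → ℂ) (n m : ℕ) : Prop where
  zero : u 0 0 = c (0, 0)
  left : ∀ a < n, u ((a : ℤ) + 1) 0 = dE c (a + 1) 0 0 0
  right : ∀ b < m, u 0 ((b : ℤ) + 1) = dE (sw c) (b + 1) 0 0 0
  antidiag : ∀ a < n, ∀ b < m, u (-((a : ℤ) + 1)) ((b : ℤ) + 1) = kparam c a b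
  diag : ∀ a < n, ∀ b < m, star (u ((a : ℤ) + 1) ((b : ℤ) + 1)) = dK1 c (a + 1) (b + 1) 0 0

theorem Matches.mono (h : Matches c u n m) (hi : i ≤ n) (hj : j ≤ m) : Matches c u i j :=
  ⟨h.zero, fun a ha => h.left a (by omega), fun b hb => h.right b (by omega),
    fun a ha b hb => h.antidiag a (by omega) b (by omega),
    fun a ha b hb => h.diag a (by omega) b (by omega)⟩

/-- Double induction along the recursion: the matching parameters fix the free entry at each step,
and the remaining data are forced. -/
theorem level_eq_trueL (hc : IsHerm c) : ∀ {n m : ℕ}, Pos c n m → Matches c u n m →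
    level u n m = trueL c n m := by
  intro n
  induction n with
  | zero =>
    intro m
    induction m with
    | zero => exact fun h hu => level00_eq hc h hu.zero
    | succ m ih =>
      intro h hu
      change stepW u (level u 0 m) = _
      rw [ih (h.mono le_rfl (Nat.le_succ m)) (hu.mono le_rfl (Nat.le_succ m)),
        stepW_eq hc h (hu.right m (Nat.lt_succ_self m))]
  | succ n ihn =>
    intro m
    induction m with
    | zero =>
      intro h hu
      change stepZ u (level u n 0) = _
      rw [ihn (h.mono (Nat.le_succ n) le_rfl) (hu.mono (Nat.le_succ n) le_rfl),
        stepZ_eq hc h (hu.left n (Nat.lt_succ_self n))]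
    | succ m ihm =>
      intro h hu
      have h1 : Pos c (n + 1) m := h.mono le_rfl (Nat.le_succ m)
      have h2 : Pos c n (m + 1) := h.mono (Nat.le_succ n) le_rfl
      change stepZW u (level u n (m + 1)) (level u (n + 1) m) = _
      rw [ihn h2 (hu.mono (Nat.le_succ n) le_rfl), ihm h1 (hu.mono le_rfl (Nat.le_succ m))]
      exact stepZW_eq hc h
        ((nextK_eq_iff hc h1 h2 u).mpr (hu.antidiag n (Nat.lt_succ_self n) m (Nat.lt_succ_self m)))
        ((nextK1_eq_iff hc h1 h2 u).mpr (hu.diag n (Nat.lt_succ_self n) m (Nat.lt_succ_self m)))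

theorem AgreeOn.kparam_eq (h : AgreeOn c c' (n + 1) (m + 1)) (h1 : Pos c (n + 1) m)
    (h2 : Pos c n (m + 1)) : kparam c n m = kparam c' n m := by
  have e1 : dK c (n + 1) (m + 1) = dK c' (n + 1) (m + 1) := by
    rw [dK, dK, ← h.Pprev_eq, ← h.Ptprev_eq]
    exact h.gram_eq (Phi_mem h1).mono (Phit_mem h2).mono
  rw [kparam, kparam, monicK, monicK, e1, dQ, dQ, dQ, dQ, ← h.Pprev_eq, ← h.sw.Pprev_eq]

theorem Matches.congr (hu : Matches c u n m) (h : Pos c n m) (ha : AgreeOn c c' n m) :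
    Matches c' u n m := by
  refine ⟨?_, fun a ha' => ?_, fun b hb => ?_, fun a ha' b hb => ?_, fun a ha' b hb => ?_⟩
  · rw [hu.zero]
    exact ha _ ⟨by simp, by simp, by simp, by simp⟩
  · rw [hu.left a ha', (ha.mono ha' (Nat.zero_le m)).dE_eq (h.mono ha' (Nat.zero_le m))]
  · rw [hu.right b hb, (ha.mono (Nat.zero_le n) hb).sw.dE_eq (h.mono (Nat.zero_le n) hb).sw]
  · rw [hu.antidiag a ha' b hb,
      (ha.mono ha' hb).kparam_eq (h.mono ha' hb.le) (h.mono ha'.le hb)]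
  · rw [hu.diag a ha' b hb, (ha.mono ha' hb).dK1_eq (h.mono ha' hb)]

/-! ## Extension of the moments -/

/-- A hermitian array of moments that vanishes except for the exponents `±k₀`. -/
noncomputable def bump (k₀ : ℤ × ℤ) (δ : ℂ) : ℤ × ℤ → ℂ := fun k =>
  (if k = k₀ then δ else 0) + (if -k = k₀ then star δ else 0)

theorem isHerm_bump (k₀ : ℤ × ℤ) (δ : ℂ) : IsHerm (bump k₀ δ) := by
  intro k
  simp only [bump, neg_neg, star_add, apply_ite star, star_zero, star_star]
  exact add_comm _ _

theorem IsHerm.add (hc : IsHerm c) (hc' : IsHerm c') : IsHerm (c + c') := fun k => by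
  rw [Pi.add_apply, hc, hc', ← star_add, Pi.add_apply]

theorem bump_of_ne {k₀ k : ℤ × ℤ} {δ : ℂ} (h1 : k ≠ k₀) (h2 : -k ≠ k₀) : bump k₀ δ k = 0 := by
  rw [bump, if_neg h1, if_neg h2, add_zero]

theorem bump_self {k₀ : ℤ × ℤ} {δ : ℂ} (h : -k₀ ≠ k₀) : bump k₀ δ k₀ = δ := by
  rw [bump, if_pos rfl, if_neg h, add_zero]

theorem eq_or_of_bump_ne_zero {k₀ k : ℤ × ℤ} {δ : ℂ} (h : bump k₀ δ k ≠ 0) :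
    k = k₀ ∨ -k = k₀ := by
  by_contra h0
  rw [not_or] at h0
  exact h (bump_of_ne h0.1 h0.2)

theorem agreeOn_add_bump {k₀ : ℤ × ℤ} {δ : ℂ}
    (h : ¬ (-(i : ℤ) ≤ k₀.1 ∧ k₀.1 ≤ i ∧ -(j : ℤ) ≤ k₀.2 ∧ k₀.2 ≤ j)) :
    AgreeOn c (c + bump k₀ δ) i j := by
  rintro k ⟨h1, h2, h3, h4⟩
  rw [Pi.add_apply, bump_of_ne, add_zero]
  · rintro rfl
    exact h ⟨h1, h2, h3, h4⟩
  · rintro rfl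
    simp only [Prod.fst_neg, Prod.snd_neg] at h
    omega

theorem AgreeOn.trans {c'' : ℤ × ℤ → ℂ} (h : AgreeOn c c' i j) (h' : AgreeOn c' c'' i j) :
    AgreeOn c c'' i j := fun k hk => (h k hk).trans (h' k hk)

/-- The moment at `(n+1, 0)` does not affect `Φ_{n,0}`. In the pairing that defines `Ê_{n+1,0}` it
occurs once, between `z ^ (n+1)` and `1`, with a nonzero factor. -/
theorem exists_moment_boundary (hc : IsHerm c) (h : Pos c n 0) (α : ℂ) :
    ∃ c', IsHerm c' ∧ AgreeOn c c' n 0 ∧ dE c' (n + 1) 0 0 0 = α := by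
  have hx : ((shift 1 0 (Phi c n 0) 0).coeff (((n + 1 : ℕ) : ℤ), 0)) ≠ 0 :=
    (coeff_shift_Phi_pos h).ne'
  have hy : (revF n 0 (Phi c n 0) 0).coeff (0, 0) ≠ 0 := by
    have := (isPhi_phiFam le_rfl (pos_iff_lexSet.mp h) 0).pos
    rw [revF, coeff_rev]
    exact star_ne_zero.mpr this.ne'
  set x := (shift 1 0 (Phi c n 0) 0).coeff (((n + 1 : ℕ) : ℤ), 0)
  set y := (revF n 0 (Phi c n 0) 0).coeff (0, 0)
  set δ := (α - dE c (n + 1) 0 0 0) / (x * star y) with hδ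
  have ha : AgreeOn c (c + bump (((n + 1 : ℕ) : ℤ), 0) δ) n 0 := agreeOn_add_bump (by
    simp only
    omega)
  refine ⟨_, hc.add (isHerm_bump _ δ), ha, ?_⟩
  have h1 : dE (c + bump (((n + 1 : ℕ) : ℤ), 0) δ) (n + 1) 0 0 0 =
      pair (c + bump (((n + 1 : ℕ) : ℤ), 0) δ) (shift 1 0 (Phi c n 0) 0)
        (revF n 0 (Phi c n 0) 0) := by
    rw [dE, ← ha.Phi_eq]
    rfl
  have m1 : MemF (shift 1 0 (Phi c n 0)) (rect 1 ((n + 1 : ℕ) : ℤ) 0 0) := (Phi_mem h).shift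
  have m2 : MemF (revF n 0 (Phi c n 0)) (rect 0 n 0 0) := (Phi_mem h).revF
  rw [h1, pair_add_moments (m1 0) (m2 0) (k₀ := (((n + 1 : ℕ) : ℤ), 0)) (l₀ := (0, 0))]
  · have h2 : (((n + 1 : ℕ) : ℤ), (0 : ℤ)) - (0, 0) = (((n + 1 : ℕ) : ℤ), 0) := sub_zero _
    rw [h2, bump_self, hδ, mul_div_cancel₀ _ (mul_ne_zero hx (star_ne_zero.mpr hy))]
    · exact add_sub_cancel _ _
    · intro h3
      have := congrArg Prod.fst h3
      simp only [Prod.fst_neg] at this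
      omega
  · rintro ⟨k1, k2⟩ ⟨a1, a2, a3, a4⟩ ⟨l1, l2⟩ ⟨b1, b2, b3, b4⟩ h3
    simp only at a1 a2 a3 a4 b1 b2 b3 b4
    rcases eq_or_of_bump_ne_zero h3 with h4 | h4 <;>
      simp only [Prod.mk_sub_mk, Prod.neg_mk, Prod.mk.injEq] at h4 ⊢ <;> omega

/-- The exponents `k₁` and `k₂` lie outside both smaller rectangles, so the columns of those levels
do not change. The pairing for `K` meets only `k₂`, between `z ^ (n+1)` and `w ^ (m+1)`; the one for
`K¹` meets only `k₁`, between `z ^ (n+1) * w ^ (m+1)` and `1`. Hence the two parameters can be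
adjusted independently. -/
theorem exists_moment_interior (hc : IsHerm c) (h1 : Pos c (n + 1) m) (h2 : Pos c n (m + 1))
    (κ α : ℂ) : ∃ c', IsHerm c' ∧ AgreeOn c c' (n + 1) m ∧ AgreeOn c c' n (m + 1) ∧
      kparam c' n m = κ ∧ dK1 c' (n + 1) (m + 1) 0 0 = α := by
  set k₁ : ℤ × ℤ := (((n + 1 : ℕ) : ℤ), ((m + 1 : ℕ) : ℤ)) with hk₁
  set k₂ : ℤ × ℤ := (((n + 1 : ℕ) : ℤ), -((m + 1 : ℕ) : ℤ)) with hk₂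
  set Q := dQ c (n + 1) (m + 1) with hQ
  set Qt := dQ (sw c) (m + 1) (n + 1) with hQt
  have hQu : IsUnit Q.det := isUnit_dQ h1
  have hQtu : IsUnit (Qtᴴ).det := isUnit_det_conjTranspose (isUnit_dQ h2.sw)
  have ha1 : ∀ β γ, AgreeOn c (c + bump k₁ β + bump k₂ γ) (n + 1) m := fun β γ =>
    (agreeOn_add_bump (by simp only [hk₁]; omega)).trans
      (agreeOn_add_bump (by simp only [hk₂]; omega))
  have ha2 : ∀ β γ, AgreeOn c (c + bump k₁ β + bump k₂ γ) n (m + 1) := fun β γ =>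
    (agreeOn_add_bump (by simp only [hk₁]; omega)).trans
      (agreeOn_add_bump (by simp only [hk₂]; omega))
  have hd : ∀ β γ k, (bump k₁ β + bump k₂ γ) k ≠ 0 → k = k₁ ∨ -k = k₁ ∨ k = k₂ ∨ -k = k₂ := by
    intro β γ k hk
    by_contra h0
    simp only [not_or] at h0
    exact hk (by rw [Pi.add_apply, bump_of_ne h0.1 h0.2.1, bump_of_ne h0.2.2.1 h0.2.2.2, add_zero])
  have n1 : -k₁ ≠ k₁ := fun h => by
    have := congrArg Prod.fst h
    simp only [hk₁, Prod.fst_neg] at this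
    omega
  have n2 : -k₂ ≠ k₂ := fun h => by
    have := congrArg Prod.fst h
    simp only [hk₂, Prod.fst_neg] at this
    omega
  have n3 : k₁ ≠ k₂ := fun h => by
    have := congrArg Prod.snd h
    simp only [hk₁, hk₂] at this
    omega
  have n4 : -k₁ ≠ k₂ := fun h => by
    have := congrArg Prod.fst h
    simp only [hk₁, hk₂, Prod.fst_neg] at this
    omega
  have n5 : -k₂ ≠ k₁ := fun h => n4 (by rw [← h, neg_neg])
  have v1 : ∀ β γ, (bump k₁ β + bump k₂ γ) k₁ = β := fun β γ => by
    rw [Pi.add_apply, bump_self n1, bump_of_ne n3 n4, add_zero]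
  have v2 : ∀ β γ, (bump k₁ β + bump k₂ γ) k₂ = γ := fun β γ => by
    rw [Pi.add_apply, bump_self n2, bump_of_ne n3.symm n5, zero_add]
  have hK : ∀ β γ, dK (c + bump k₁ β + bump k₂ γ) (n + 1) (m + 1) =
      dK c (n + 1) (m + 1) + γ • (Q * Matrix.single (Fin.last m) (Fin.last n) (1 : ℂ) * Qtᴴ) := by
    intro β γ
    ext a b
    have e1 : dK (c + bump k₁ β + bump k₂ γ) (n + 1) (m + 1) a b =
        pair (c + (bump k₁ β + bump k₂ γ)) (Phi c (n + 1) m a) (Phit c n (m + 1) b) := by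
      rw [dK, gram_apply, ← add_assoc]
      change pair _ (Phi _ (n + 1) m a) (Phit _ n (m + 1) b) = _
      rw [← (ha1 β γ).Phi_eq, ← (ha2 β γ).Phit_eq]
    rw [e1, pair_add_moments (Phi_mem h1 a) (Phit_mem h2 b) (k₀ := (((n + 1 : ℕ) : ℤ), 0))
      (l₀ := (0, ((m + 1 : ℕ) : ℤ)))]
    · have e2 : (((n + 1 : ℕ) : ℤ), (0 : ℤ)) - (0, ((m + 1 : ℕ) : ℤ)) = k₂ := by
        rw [hk₂, Prod.mk_sub_mk, sub_zero, zero_sub]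
      have e3 : Q a (Fin.last m) = (Phi c (n + 1) m a).coeff (((n + 1 : ℕ) : ℤ), 0) := by
        simp only [hQ, dQ, leadF, of_apply, Fin.val_last]
        rw [show ((m + 1 : ℕ) : ℤ) - 1 - m = 0 by omega]
        rfl
      have e4 : Qt b (Fin.last n) = (Phit c n (m + 1) b).coeff (0, ((m + 1 : ℕ) : ℤ)) := by
        simp only [hQt, dQ, leadF, of_apply, Fin.val_last, Phit, flipF, coeff_flip]
        rw [show ((n + 1 : ℕ) : ℤ) - 1 - n = 0 by omega]
        rfl
      have e5 : (Q * Matrix.single (Fin.last m) (Fin.last n) (1 : ℂ) * Qtᴴ) a b =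
          Q a (Fin.last m) * star (Qt b (Fin.last n)) := by
        rw [Matrix.mul_assoc, Matrix.mul_apply, Finset.sum_eq_single (Fin.last m)]
        · rw [Matrix.single_mul_apply_same, one_mul, conjTranspose_apply]
        · intro x _ hx
          rw [Matrix.single_mul_apply_of_ne _ _ _ _ _ hx, mul_zero]
        · simp
      rw [e2, v2, Matrix.add_apply, Matrix.smul_apply, e5, e3, e4, smul_eq_mul]
      congr 1
      ring
    · rintro ⟨k1, k2⟩ ⟨a1, a2, a3, a4⟩ ⟨l1, l2⟩ ⟨b1, b2, b3, b4⟩ h3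
      simp only at a1 a2 a3 a4 b1 b2 b3 b4
      rcases hd _ _ _ h3 with h4 | h4 | h4 | h4 <;>
        simp only [hk₁, hk₂, Prod.mk_sub_mk, Prod.neg_mk, Prod.mk.injEq] at h4 ⊢ <;> omega
  obtain ⟨β, hβ⟩ : ∃ β, ∀ γ, dK1 (c + bump k₁ β + bump k₂ γ) (n + 1) (m + 1) 0 0 = α := by
    have m1 : MemF (shift 0 1 (Phi c (n + 1) m)) (rect 0 ((n + 1 : ℕ) : ℤ) 1 ((m + 1 : ℕ) : ℤ)) :=
      (Phi_mem h1).shift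
    have m2 : MemF (revF n (m + 1) (Phit c n (m + 1))) (rect 0 n 0 ((m + 1 : ℕ) : ℤ)) :=
      (Phit_mem h2).revF
    set x := (shift 0 1 (Phi c (n + 1) m) 0).coeff k₁ with hx
    set y := (revF n (m + 1) (Phit c n (m + 1)) 0).coeff (0, 0) with hy
    have hx0 : x ≠ 0 := by
      have := (isPhi_phiFam le_rfl (pos_iff_lexSet.mp h1) 0).pos
      rw [hx, shift, coeff_mono_mul, hk₁, Prod.mk_sub_mk, sub_zero,
        show ((m + 1 : ℕ) : ℤ) - 1 = ((m + 1 - 1 - (0 : Fin (m + 1)) : ℕ) : ℤ) by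
          rw [Fin.val_zero]; omega]
      exact this.ne'
    have hy0 : y ≠ 0 := by
      have := (isPhi_phiFam le_rfl (pos_iff_lexSet.mp h2) 0).pos
      rw [hy, revF, coeff_rev, Phit_zero h2]
      exact star_ne_zero.mpr this.ne'
    refine ⟨(α - dK1 c (n + 1) (m + 1) 0 0) / (x * star y), fun γ => ?_⟩
    set β := (α - dK1 c (n + 1) (m + 1) 0 0) / (x * star y) with hβ
    have e1 : dK1 (c + bump k₁ β + bump k₂ γ) (n + 1) (m + 1) 0 0 =
        pair (c + (bump k₁ β + bump k₂ γ)) (shift 0 1 (Phi c (n + 1) m) 0)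
          (revF n (m + 1) (Phit c n (m + 1)) 0) := by
      rw [dK1, gram_apply, ← add_assoc]
      change pair _ (shift 0 1 (Phi _ (n + 1) m) 0) (revF n (m + 1) (Phit _ n (m + 1)) 0) = _
      rw [← (ha1 β γ).Phi_eq, ← (ha2 β γ).Phit_eq]
    rw [e1, pair_add_moments (m1 0) (m2 0) (k₀ := k₁) (l₀ := (0, 0))]
    · have e2 : k₁ - (0, 0) = k₁ := sub_zero _
      rw [e2, v1, hβ, mul_div_cancel₀ _ (mul_ne_zero hx0 (star_ne_zero.mpr hy0))]
      exact add_sub_cancel _ _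
    · rintro ⟨k1, k2⟩ ⟨a1, a2, a3, a4⟩ ⟨l1, l2⟩ ⟨b1, b2, b3, b4⟩ h3
      simp only at a1 a2 a3 a4 b1 b2 b3 b4
      rcases hd _ _ _ h3 with h4 | h4 | h4 | h4 <;>
        simp only [hk₁, hk₂, Prod.mk_sub_mk, Prod.neg_mk, Prod.mk.injEq] at h4 ⊢ <;> omega
  obtain ⟨γ, hγ⟩ : ∃ γ, kparam (c + bump k₁ β + bump k₂ γ) n m = κ := by
    by_cases h0 : n = 0 ∧ m = 0
    · have hQ0 : Q 0 0 ≠ 0 := ((isUpperPos_leadF_phiFam le_rfl (pos_iff_lexSet.mp h1)).pos 0).ne'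
      have hQt0 : Qt 0 0 ≠ 0 :=
        ((isUpperPos_leadF_phiFam le_rfl (pos_iff_lexSet.mp h2.sw)).pos 0).ne'
      -- On level `(1, 1)` the parameter is not normalized, and its slope in `γ` is a product of
      -- leading coefficients.
      refine ⟨(κ - dK c (n + 1) (m + 1) 0 0) / (Q 0 0 * star (Qt 0 0)), ?_⟩
      rw [kparam, if_pos h0, hK, Matrix.add_apply, Matrix.smul_apply]
      have e5 : (Q * Matrix.single (Fin.last m) (Fin.last n) (1 : ℂ) * Qtᴴ) 0 0 =
          Q 0 0 * star (Qt 0 0) := by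
        obtain ⟨rfl, rfl⟩ := h0
        rw [Matrix.mul_assoc]
        simp [Matrix.mul_apply]
      rw [e5, smul_eq_mul, div_mul_cancel₀ _ (mul_ne_zero hQ0 (star_ne_zero.mpr hQt0))]
      exact add_sub_cancel _ _
    -- Relative to the monic polynomials the parameter moves with slope one.
    · refine ⟨κ - kparam c n m, ?_⟩
      set γ := κ - kparam c n m with hγ
      have q1 : dQ (c + bump k₁ β + bump k₂ γ) (n + 1) (m + 1) = Q := by
        rw [hQ, dQ, dQ]
        exact congrArg _ (ha1 β γ).symm.Phi_eq
      have q2 : dQ (sw (c + bump k₁ β + bump k₂ γ)) (m + 1) (n + 1) = Qt := by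
        rw [hQt, dQ, dQ]
        exact congrArg _ (ha2 β γ).symm.sw.Phi_eq
      have e6 : monicK (c + bump k₁ β + bump k₂ γ) n m = monicK c n m +
          γ • Matrix.single (Fin.last m) (Fin.last n) (1 : ℂ) := by
        rw [monicK, q1, q2, hK, Matrix.mul_add, Matrix.add_mul, Matrix.mul_smul, Matrix.smul_mul,
          Matrix.mul_assoc Q, Matrix.nonsing_inv_mul_cancel_left _ _ hQu,
          Matrix.mul_nonsing_inv_cancel_right _ _ hQtu]
        rfl
      rw [kparam, if_neg h0, e6, Matrix.add_apply, Matrix.smul_apply, Matrix.single_apply_same,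
        smul_eq_mul, mul_one, hγ, kparam, if_neg h0]
      exact add_sub_cancel _ _
  exact ⟨_, (hc.add (isHerm_bump _ _)).add (isHerm_bump _ _), ha1 β γ, ha2 β γ, hγ, hβ γ⟩

end Algorithm

section Existence

variable {c c' : ℤ × ℤ → ℂ} {u : ℤ → ℤ → ℂ} {i j n m : ℕ}

/-! ## Existence of a functional for admissible parameters -/

theorem Admissible.mono (h : Admissible n m u) (hi : i ≤ n) (hj : j ≤ m) : Admissible i j u :=
  ⟨h.1, fun a h1 h2 => h.2.1 a h1 (h2.trans hi), fun b h1 h2 => h.2.2.1 b h1 (h2.trans hj),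
    fun a b h1 h2 h3 h4 => h.2.2.2.1 a b h1 (h2.trans hi) h3 (h4.trans hj),
    fun a b h1 h2 => h.2.2.2.2 a b (h1.trans_le hi) (h2.trans_le hj)⟩

/-- Equal parameters give equal output of the algorithm, hence equal orthonormal columns, and these
determine the moments. -/
theorem agreeOn_of_matches (hc : IsHerm c) (hc' : IsHerm c') (h : Pos c n m) (h' : Pos c' n m)
    (hu : Matches c u n m) (hu' : Matches c' u n m) : AgreeOn c c' n m := by
  have key : ∀ i ≤ n, Phi c i m = Phi c' i m := fun i hi => by
    have h1 := level_eq_trueL hc (h.mono hi le_rfl) (hu.mono hi le_rfl)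
    rw [level_eq_trueL hc' (h'.mono hi le_rfl) (hu'.mono hi le_rfl)] at h1
    exact (congrArg Level.P h1).symm
  refine agreeOn_of_orthonormal hc h fun i i' hi hi' k l => ?_
  rw [key i hi, key i' hi', gram_Phi_Phi hc' h' hi hi']

theorem matches_succ_succ (h1 : Matches c u (n + 1) m) (h2 : Matches c u n (m + 1))
    (hK : u (-((n : ℤ) + 1)) ((m : ℤ) + 1) = kparam c n m)
    (hK1 : star (u ((n : ℤ) + 1) ((m : ℤ) + 1)) = dK1 c (n + 1) (m + 1) 0 0) :
    Matches c u (n + 1) (m + 1) := by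
  refine ⟨h1.zero, h1.left, h2.right, fun a ha b hb => ?_, fun a ha b hb => ?_⟩
  · by_cases ha' : a < n
    · exact h2.antidiag a ha' b hb
    · by_cases hb' : b < m
      · exact h1.antidiag a ha b hb'
      · rwa [show a = n by omega, show b = m by omega]
  · by_cases ha' : a < n
    · exact h2.diag a ha' b hb
    · by_cases hb' : b < m
      · exact h1.diag a ha b hb'
      · rwa [show a = n by omega, show b = m by omega]

theorem matches_succ_zero (h : Matches c u n 0) (hE : u ((n : ℤ) + 1) 0 = dE c (n + 1) 0 0 0) :
    Matches c u (n + 1) 0 := by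
  refine ⟨h.zero, fun a ha => ?_, fun b hb => absurd hb (Nat.not_lt_zero b),
    fun a ha b hb => absurd hb (Nat.not_lt_zero b), fun a ha b hb => absurd hb (Nat.not_lt_zero b)⟩
  by_cases ha' : a < n
  · exact h.left a ha'
  · rwa [show a = n by omega]

theorem matches_zero_succ (h : Matches c u 0 m) (hE : u 0 ((m : ℤ) + 1) = dE (sw c) (m + 1) 0 0 0) :
    Matches c u 0 (m + 1) := by
  refine ⟨h.zero, fun a ha => absurd ha (Nat.not_lt_zero a), fun b hb => ?_,
    fun a ha b hb => absurd ha (Nat.not_lt_zero a), fun a ha b hb => absurd ha (Nat.not_lt_zero a)⟩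
  by_cases hb' : b < m
  · exact h.right b hb'
  · rwa [show b = m by omega]

/-- Take `c` on the strip `|k.1| ≤ n` and `c'` elsewhere. On the part of the larger rectangle inside
the strip, the agreement hypothesis makes this choice consistent. -/
theorem exists_glue (hc : IsHerm c) (hc' : IsHerm c') (h : AgreeOn c c' n m) :
    ∃ c₀, IsHerm c₀ ∧ AgreeOn c c₀ n (m + 1) ∧ AgreeOn c' c₀ (n + 1) m := by
  refine ⟨fun k => if -(n : ℤ) ≤ k.1 ∧ k.1 ≤ n then c k else c' k, fun k => ?_, fun k hk => ?_,
    fun k hk => ?_⟩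
  · have h1 : (-(n : ℤ) ≤ (-k).1 ∧ (-k).1 ≤ n) ↔ (-(n : ℤ) ≤ k.1 ∧ k.1 ≤ n) := by
      rw [Prod.fst_neg]
      omega
    simp only [h1, hc k, hc' k]
    split_ifs <;> rfl
  · exact (if_pos ⟨hk.1, hk.2.1⟩).symm
  · simp only
    split_ifs with h1
    · exact (h k ⟨h1.1, h1.2, hk.2.2.1, hk.2.2.2⟩).symm
    · rfl

theorem exists_pos_matches : ∀ {n m : ℕ}, Admissible n m u →
    ∃ c, IsHerm c ∧ Pos c n m ∧ Matches c u n m := by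
  intro n
  induction n with
  | zero =>
    intro m
    induction m with
    | zero =>
      intro h
      have h0 : star (u 0 0) = u 0 0 := by
        rw [← (pos_eq_ofReal h.1).2, Complex.star_def, Complex.conj_ofReal]
      refine ⟨fun k => if k = (0, 0) then u 0 0 else 0, fun k => ?_, ?_, ?_⟩
      · have h1 : -k = (0, 0) ↔ k = (0, 0) := neg_eq_zero
        simp only [h1]
        split_ifs
        · exact h0.symm
        · exact star_zero _ |>.symm
      · rw [pos_zero_iff, if_pos rfl]
        exact h.1
      · exact ⟨(if_pos rfl).symm, fun a ha => absurd ha (Nat.not_lt_zero a),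
          fun b hb => absurd hb (Nat.not_lt_zero b), fun a ha => absurd ha (Nat.not_lt_zero a),
          fun a ha => absurd ha (Nat.not_lt_zero a)⟩
    | succ m ih =>
      intro h
      obtain ⟨c, hc, hp, hu⟩ := ih (h.mono le_rfl (Nat.le_succ m))
      obtain ⟨d, hd, ha, hE⟩ := exists_moment_boundary hc.sw hp.sw (u 0 ((m : ℤ) + 1))
      have ha' : AgreeOn c (sw d) 0 m := ha.sw
      have hp' : Pos (sw d) 0 m := hp.congr ha'
      refine ⟨sw d, hd.sw, Pos.sw ((pos_succ_zero_iff hd hp'.sw).mpr ?_),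
        matches_zero_succ (hu.congr hp ha') hE.symm⟩
      rw [hE]
      exact h.2.2.1 (m + 1) (Nat.le_add_left 1 m) le_rfl
  | succ n ihn =>
    intro m
    induction m with
    | zero =>
      intro h
      obtain ⟨c, hc, hp, hu⟩ := ihn (h.mono (Nat.le_succ n) le_rfl)
      obtain ⟨d, hd, ha, hE⟩ := exists_moment_boundary hc hp (u ((n : ℤ) + 1) 0)
      refine ⟨d, hd, (pos_succ_zero_iff hd (hp.congr ha)).mpr ?_,
        matches_succ_zero (hu.congr hp ha) hE.symm⟩
      rw [hE]
      exact h.2.1 (n + 1) (Nat.le_add_left 1 n) le_rfl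
    | succ m ihm =>
      intro h
      obtain ⟨c₁, hc₁, hp₁, hu₁⟩ := ihn (h.mono (Nat.le_succ n) le_rfl)
      obtain ⟨c₂, hc₂, hp₂, hu₂⟩ := ihm (h.mono le_rfl (Nat.le_succ m))
      -- Both functionals have the parameters `u` on their common rectangle, so uniqueness there
      -- permits gluing.
      obtain ⟨c₀, hc₀, ha₁, ha₂⟩ := exists_glue hc₁ hc₂ (agreeOn_of_matches hc₁ hc₂
        (hp₁.mono le_rfl (Nat.le_succ m)) (hp₂.mono (Nat.le_succ n) le_rfl)
        (hu₁.mono le_rfl (Nat.le_succ m)) (hu₂.mono (Nat.le_succ n) le_rfl))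
      obtain ⟨c, hc, hb₂, hb₁, hK, hK1⟩ := exists_moment_interior hc₀ (hp₂.congr ha₂)
        (hp₁.congr ha₁) (u (-((n : ℤ) + 1)) ((m : ℤ) + 1)) (star (u ((n : ℤ) + 1) ((m : ℤ) + 1)))
      have h1 : Pos c (n + 1) m := (hp₂.congr ha₂).congr hb₂
      have h2 : Pos c n (m + 1) := (hp₁.congr ha₁).congr hb₁
      have g1 : Matches c u (n + 1) m := hu₂.congr hp₂ (ha₂.trans hb₂)
      have g2 : Matches c u n (m + 1) := hu₁.congr hp₁ (ha₁.trans hb₁)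
      have l1 := level_eq_trueL hc h1 g1
      have l2 := level_eq_trueL hc h2 g2
      -- Positivity on the new level is not known yet, so `level_eq_trueL` cannot be used there. `K`
      -- and `K¹` depend only on the two previous levels, which is enough to interpret the
      -- admissibility conditions.
      have eK : (level u (n + 1) (m + 1)).K = dK c (n + 1) (m + 1) := by
        rw [← (nextK_eq_iff hc h1 h2 u).mpr hK.symm, ← l1, ← l2]
        rfl
      have eK1 : (level u (n + 1) (m + 1)).K1 = dK1 c (n + 1) (m + 1) := by
        rw [← (nextK1_eq_iff hc h1 h2 u).mpr hK1.symm,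
          show trueC c n (m + 1) = (level u n (m + 1)).toCoeffs by rw [l2]; rfl,
          show trueC c (n + 1) m = (level u (n + 1) m).toCoeffs by rw [l1]; rfl]
        rfl
      refine ⟨c, hc, (pos_succ_iff hc h1 h2).mpr ⟨?_, ?_⟩,
        matches_succ_succ g1 g2 hK.symm hK1.symm⟩
      · rw [← eK]
        exact h.2.2.2.1 (n + 1) (m + 1) (Nat.le_add_left 1 n) le_rfl (Nat.le_add_left 1 m) le_rfl
      · have h3 := h.2.2.2.2 n m (Nat.lt_succ_self n) (Nat.lt_succ_self m)
        rw [levelH3, eK, eK1, l1, l2] at h3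
        exact h3

end Existence

section Necessity

variable {c : ℤ × ℤ → ℂ} {u : ℤ → ℤ → ℂ} {i j n m : ℕ}

/-! ## Degrees of the polynomials of the algorithm -/

/-- Holds for arbitrary matrices, hence also where default values replace missing inverses and
Cholesky factors. -/
theorem nextP_mem {k l : ℕ} {V : Submodule ℂ Laurent} {x : Laurent} {p : Fin (k + 1) → Laurent}
    {q qr : Fin (l + 1) → Laurent} (hx : ∀ a, x * p a ∈ V) (hp : ∀ a, p a ∈ V)
    (hq : ∀ a, q a ∈ V) (hqr : ∀ a, qr a ∈ V) (K K1 : Matrix (Fin (k + 1)) (Fin (l + 1)) ℂ)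
    (G1 : Matrix (Fin (k + 1)) (Fin (k + 2)) ℂ) (a : Fin (k + 2)) :
    nextP x p q qr K K1 G1 a ∈ V := by
  refine act_mem _ (fun b => ?_) a
  refine Fin.cases ?_ (fun b => ?_) b
  · exact V.sub_mem (hx 0) (act_mem _ hqr 0)
  · exact V.sub_mem (hp b) (act_mem _ hq b)

theorem level_mem (u : ℤ → ℤ → ℂ) : ∀ n m : ℕ, MemF (level u n m).P (rect 0 n 0 m) ∧
    MemF (level u n m).Pt (rect 0 n 0 m) := by
  intro n
  induction n with
  | zero =>
    intro m
    induction m with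
    | zero =>
      have h1 : mono 0 0 ∈ spc (rect 0 ((0 : ℕ) : ℤ) 0 ((0 : ℕ) : ℤ)) :=
        mono_mem_spc ⟨le_rfl, le_rfl, le_rfl, le_rfl⟩
      exact ⟨fun _ => Submodule.smul_mem _ _ h1, fun _ => Submodule.smul_mem _ _ h1⟩
    | succ m ih =>
      obtain ⟨h1, h2⟩ := ih
      have h3 : MemF (shift 0 1 (level u 0 m).Pt)
        (rect 0 ((0 : ℕ) : ℤ) 0 ((m + 1 : ℕ) : ℤ)) := h2.shift
      have h4 : MemF (revF 0 m (level u 0 m).Pt) (rect 0 ((0 : ℕ) : ℤ) 0 m) := h2.revF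
      have h5 : MemF (revF 0 m (level u 0 m).Pt)
        (rect 0 ((0 : ℕ) : ℤ) 0 ((m + 1 : ℕ) : ℤ)) := h4.mono
      have h6 : (stepW u (level u 0 m)).Pt 0 ∈ spc (rect 0 ((0 : ℕ) : ℤ) 0 ((m + 1 : ℕ) : ℤ)) :=
        Submodule.smul_mem _ _ (Submodule.sub_mem _ (h3 0) (Submodule.smul_mem _ _ (h5 0)))
      refine ⟨fun a => ?_, fun a => ?_⟩
      · refine Fin.cases ?_ (fun b => ?_) a
        · exact h6
        · have h7 : MemF (level u 0 m).P (rect 0 ((0 : ℕ) : ℤ) 0 ((m + 1 : ℕ) : ℤ)) := h1.mono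
          exact h7 b
      · exact h6
  | succ n ihn =>
    intro m
    induction m with
    | zero =>
      obtain ⟨h1, h2⟩ := ihn 0
      have h3 : MemF (shift 1 0 (level u n 0).P)
        (rect 0 ((n + 1 : ℕ) : ℤ) 0 ((0 : ℕ) : ℤ)) := h1.shift
      have h4 : MemF (revF n 0 (level u n 0).P) (rect 0 n 0 ((0 : ℕ) : ℤ)) := h1.revF
      have h5 : MemF (revF n 0 (level u n 0).P)
        (rect 0 ((n + 1 : ℕ) : ℤ) 0 ((0 : ℕ) : ℤ)) := h4.mono
      have h6 : (stepZ u (level u n 0)).P 0 ∈ spc (rect 0 ((n + 1 : ℕ) : ℤ) 0 ((0 : ℕ) : ℤ)) :=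
        Submodule.smul_mem _ _ (Submodule.sub_mem _ (h3 0) (Submodule.smul_mem _ _ (h5 0)))
      refine ⟨fun a => ?_, fun a => ?_⟩
      · exact h6
      · refine Fin.cases ?_ (fun b => ?_) a
        · exact h6
        · have h7 : MemF (level u n 0).Pt (rect 0 ((n + 1 : ℕ) : ℤ) 0 ((0 : ℕ) : ℤ)) := h2.mono
          exact h7 b
    | succ m ihm =>
      obtain ⟨-, h2⟩ := ihn (m + 1)
      obtain ⟨h1, -⟩ := ihm
      have h3 : MemF (revF n (m + 1) (level u n (m + 1)).Pt) (rect 0 n 0 ((m + 1 : ℕ) : ℤ)) :=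
        h2.revF
      have h4 : MemF (revF (n + 1) m (level u (n + 1) m).P) (rect 0 ((n + 1 : ℕ) : ℤ) 0 m) :=
        h1.revF
      have g1 : MemF (level u (n + 1) m).P
        (rect 0 ((n + 1 : ℕ) : ℤ) 0 ((m + 1 : ℕ) : ℤ)) := h1.mono
      have g2 : MemF (level u n (m + 1)).Pt
        (rect 0 ((n + 1 : ℕ) : ℤ) 0 ((m + 1 : ℕ) : ℤ)) := h2.mono
      have g3 : MemF (revF n (m + 1) (level u n (m + 1)).Pt)
        (rect 0 ((n + 1 : ℕ) : ℤ) 0 ((m + 1 : ℕ) : ℤ)) := h3.mono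
      have g4 : MemF (revF (n + 1) m (level u (n + 1) m).P)
        (rect 0 ((n + 1 : ℕ) : ℤ) 0 ((m + 1 : ℕ) : ℤ)) := h4.mono
      have g5 : MemF (shift 0 1 (level u (n + 1) m).P)
        (rect 0 ((n + 1 : ℕ) : ℤ) 0 ((m + 1 : ℕ) : ℤ)) := h1.shift
      have g6 : MemF (shift 1 0 (level u n (m + 1)).Pt)
        (rect 0 ((n + 1 : ℕ) : ℤ) 0 ((m + 1 : ℕ) : ℤ)) := h2.shift
      exact ⟨nextP_mem g5 g1 g2 g3 _ _ _, nextP_mem g6 g2 g1 g4 _ _ _⟩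

/-! ## Degenerate levels -/

/-- Once a column lacks the power `z ^ (i+1)`, the steps in `w` cannot restore it: the other
polynomials involved belong to levels `(i, ·)`. -/
theorem P_mem_of_degenerate {i j : ℕ}
    (h : MemF (level u (i + 1) j).P (rect 0 i 0 j)) {m : ℕ} (hm : j ≤ m) :
    MemF (level u (i + 1) m).P (rect 0 i 0 m) := by
  induction m, hm using Nat.le_induction with
  | base => exact h
  | succ m hm h1 =>
    have h2 := (level_mem u i (m + 1)).2
    have g1 : MemF (level u (i + 1) m).P (rect 0 i 0 ((m + 1 : ℕ) : ℤ)) := h1.mono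
    have g3 : MemF (revF i (m + 1) (level u i (m + 1)).Pt) (rect 0 i 0 ((m + 1 : ℕ) : ℤ)) := h2.revF
    have g5 : MemF (shift 0 1 (level u (i + 1) m).P) (rect 0 i 0 ((m + 1 : ℕ) : ℤ)) := h1.shift
    exact nextP_mem g5 g1 h2 g3 _ _ _

theorem Pt_mem_of_degenerate {i j : ℕ}
    (h : MemF (level u i (j + 1)).Pt (rect 0 i 0 j)) {n : ℕ} (hn : i ≤ n) :
    MemF (level u n (j + 1)).Pt (rect 0 n 0 j) := by
  induction n, hn using Nat.le_induction with
  | base => exact h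
  | succ n hn h1 =>
    have h2 := (level_mem u (n + 1) j).1
    have g1 : MemF (level u n (j + 1)).Pt (rect 0 ((n + 1 : ℕ) : ℤ) 0 j) := h1.mono
    have g3 : MemF (revF (n + 1) j (level u (n + 1) j).P) (rect 0 ((n + 1 : ℕ) : ℤ) 0 j) := h2.revF
    have g5 : MemF (shift 1 0 (level u n (j + 1)).Pt) (rect 0 ((n + 1 : ℕ) : ℤ) 0 j) := h1.shift
    exact nextP_mem g5 g1 h2 g3 _ _ _

theorem nextP_eq_zero {k l : ℕ} {x : Laurent} {p : Fin (k + 1) → Laurent}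
    {q qr : Fin (l + 1) → Laurent} {K K1 : Matrix (Fin (k + 1)) (Fin (l + 1)) ℂ}
    {G1 : Matrix (Fin (k + 1)) (Fin (k + 2)) ℂ} (h : (hatGamma G1 (gammaOf K)).det = 0) :
    nextP x p q qr K K1 G1 = 0 := by
  rw [nextP, Matrix.nonsing_inv_apply_not_isUnit _ (by rw [h]; exact not_isUnit_zero),
    act_zero_mat]

/-- A Cholesky factor of `1 - K K†` would force `‖K‖ < 1`, so the default value `0` applies. -/
theorem gammaOf_eq_zero {k l : ℕ} {K : Matrix (Fin k) (Fin l) ℂ} (h : ¬ ‖K‖ < 1) :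
    gammaOf K = 0 := by
  rw [gammaOf, upperCholesky, dif_neg, Matrix.zero_mul]
  rintro ⟨B, h1, h2, h3⟩
  exact h (norm_lt_one_of_mul_conjTranspose (IsUpperPos.isUnit_det ⟨h1, h2⟩) h3)

theorem P_eq_zero_of_norm (h : ¬ ‖(level u (i + 1) (j + 1)).K‖ < 1) :
    (level u (i + 1) (j + 1)).P = 0 := by
  refine nextP_eq_zero (Matrix.det_eq_zero_of_row_eq_zero (0 : Fin (j + 1)).succ fun b => ?_)
  change gammaOf (level u (i + 1) (j + 1)).K 0 b = 0
  rw [gammaOf_eq_zero h]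
  rfl

theorem P_eq_zero_of_H3 (h : ¬ (levelH3 u i j 0 0).re < 1) :
    (level u (i + 1) (j + 1)).P = 0 := by
  -- The first column is zero: the square root of a nonpositive number vanishes, and `Γ` always
  -- starts with a zero column.
  refine nextP_eq_zero (Matrix.det_eq_zero_of_column_eq_zero 0 fun b => ?_)
  refine Fin.cases ?_ (fun b => ?_) b
  · change ((Real.sqrt (1 - (levelH3 u i j 0 0).re) : ℝ) : ℂ) = 0
    rw [Real.sqrt_eq_zero_of_nonpos (by linarith), Complex.ofReal_zero]
  · change gammaOf (level u (i + 1) (j + 1)).K b 0 = 0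
    rw [gammaOf, mul_U]
    rfl

theorem rho_eq_zero {α : ℂ} (h : ¬ ‖α‖ < 1) : rho α = 0 := by
  rw [rho, Real.sqrt_eq_zero_of_nonpos, Complex.ofReal_zero]
  nlinarith

theorem P_eq_zero_of_E (h : ¬ ‖(level u (i + 1) 0).E 0 0‖ < 1) : (level u (i + 1) 0).P = 0 := by
  ext a : 1
  change (rho (u (i + 1) 0))⁻¹ • (_ : Laurent) = 0
  have h1 : rho (u (i + 1) 0) = 0 := rho_eq_zero h
  rw [h1, _root_.inv_zero, zero_smul]

theorem Pt_eq_zero_of_Et (h : ¬ ‖(level u 0 (j + 1)).Et 0 0‖ < 1) :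
    (level u 0 (j + 1)).Pt = 0 := by
  ext a : 1
  change (rho (u 0 (j + 1)))⁻¹ • (_ : Laurent) = 0
  have h1 : rho (u 0 (j + 1)) = 0 := rho_eq_zero h
  rw [h1, _root_.inv_zero, zero_smul]

/-- The normalizing factor is `1 / 0 = 0`, and the homogeneous steps in `z` propagate the zero to
`Φ̃_{n,0}`, to which (2) applies. -/
theorem P_eq_zero_of_u00 (h : (u 0 0).re ≤ 0) (n : ℕ) :
    (level u n 0).P = 0 ∧ (level u n 0).Pt = 0 := by
  induction n with
  | zero =>
    have h1 : (((1 / Real.sqrt (u 0 0).re : ℝ) : ℂ) • mono 0 0 : Laurent) = 0 := by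
      rw [Real.sqrt_eq_zero_of_nonpos h, div_zero, Complex.ofReal_zero, zero_smul]
    exact ⟨funext fun _ => h1, funext fun _ => h1⟩
  | succ n ih =>
    have h1 : (stepZ u (level u n 0)).P 0 = 0 := by
      change (rho (u (n + 1) 0))⁻¹ • (mono 1 0 * (level u n 0).P 0 -
        u (n + 1) 0 • rev n 0 ((level u n 0).P 0)) = 0
      rw [ih.1, Pi.zero_apply, mul_zero, rev_zero, smul_zero, sub_zero, smul_zero]
    refine ⟨funext fun _ => h1, funext fun a => ?_⟩
    refine Fin.cases ?_ (fun b => ?_) a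
    · exact h1
    · exact congrFun ih.2 b

/-- Orthonormality alone gives linear independence, without positivity of the form, and the ambient
space is spanned by `a * b` monomials. -/
theorem card_le_of_orthonormal {ι : Type*} [Fintype ι] [DecidableEq ι] {v : ι → Laurent}
    {a b : ℕ} (hv : ∀ x, v x ∈ spc (rect 0 ((a : ℤ) - 1) 0 ((b : ℤ) - 1)))
    (ho : ∀ x y, pair c (v x) (v y) = if x = y then 1 else 0) : Fintype.card ι ≤ a * b := by
  classical
  have hli : LinearIndependent ℂ v := by
    rw [Fintype.linearIndependent_iff]
    intro g hg x
    have h1 := congrArg (fun p => pair c p (v x)) hg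
    simpa [pair_sum_left, pair_smul_left, ho, pair_zero_left] using h1
  set f : Fin a × Fin b → Laurent := fun k => mono (k.1 : ℕ) (k.2 : ℕ)
  have h1 : Set.range v ≤ Submodule.span ℂ (Set.range f) := by
    rintro _ ⟨x, rfl⟩
    refine mem_of_forall_mono_mem (fun k hk => ?_) (hv x)
    obtain ⟨h1, h2, h3, h4⟩ := hk
    refine Submodule.subset_span ⟨(⟨k.1.toNat, by omega⟩, ⟨k.2.toNat, by omega⟩), ?_⟩
    simp only [f]
    rw [Int.toNat_of_nonneg h1, Int.toNat_of_nonneg h3]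
  have h2 := linearIndependent_le_span' v hli (Set.range f) h1
  rw [Cardinal.mk_fintype, Nat.cast_le] at h2
  refine h2.trans ((Fintype.card_range_le f).trans ?_)
  rw [Fintype.card_prod, Fintype.card_fin, Fintype.card_fin]

/-- Necessity of the conditions. -/
theorem admissible_of_orthonormal (h0 : star (u 0 0) = u 0 0)
    (hP : ∀ i i', i ≤ n → i' ≤ n → ∀ k l : Fin (m + 1),
      pair c ((level u i m).P k) ((level u i' m).P l) = if i = i' ∧ k = l then 1 else 0)
    (hPt : ∀ j j', j ≤ m → j' ≤ m → ∀ k l : Fin (n + 1),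
      pair c ((level u n j).Pt k) ((level u n j').Pt l) = if j = j' ∧ k = l then 1 else 0) :
    Admissible n m u := by
  -- A zero column would confine all `(i+2)(m+1)` polynomials of the levels `(0, m), …, (i+1, m)` to
  -- degree `(i, m)`, a space of dimension `(i+1)(m+1)`.
  have key : ∀ i j, i < n → j ≤ m → (level u (i + 1) j).P ≠ 0 := by
    intro i j hi hj hz
    have h1 : MemF (level u (i + 1) j).P (rect 0 i 0 j) := by
      rw [hz]
      exact fun a => Submodule.zero_mem _
    have h2 := P_mem_of_degenerate h1 hj
    have h3 := card_le_of_orthonormal (c := c) (a := i + 1) (b := m + 1)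
      (v := fun x : Fin (i + 2) × Fin (m + 1) => (level u x.1 m).P x.2) (fun x => ?_)
      (fun x y => ?_)
    · rw [Fintype.card_prod, Fintype.card_fin, Fintype.card_fin] at h3
      nlinarith
    · rw [show ((i + 1 : ℕ) : ℤ) - 1 = i by omega, show ((m + 1 : ℕ) : ℤ) - 1 = m by omega]
      obtain ⟨⟨x, hx⟩, k⟩ := x
      by_cases hx' : x = i + 1
      · subst hx'
        exact h2 k
      · have h4 : MemF (level u x m).P (rect 0 i 0 m) := (level_mem u x m).1.mono
        exact h4 k
    · have hx := x.1.2
      have hy := y.1.2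
      rw [hP x.1 y.1 (by omega) (by omega)]
      simp only [Prod.ext_iff, Fin.ext_iff]
  have keyt : ∀ j, j < m → (level u 0 (j + 1)).Pt ≠ 0 := by
    intro j hj hz
    have h1 : MemF (level u 0 (j + 1)).Pt (rect 0 ((0 : ℕ) : ℤ) 0 j) := by
      rw [hz]
      exact fun a => Submodule.zero_mem _
    have h2 := Pt_mem_of_degenerate h1 (Nat.zero_le n)
    have h3 := card_le_of_orthonormal (c := c) (a := n + 1) (b := j + 1)
      (v := fun x : Fin (j + 2) × Fin (n + 1) => (level u n x.1).Pt x.2) (fun x => ?_)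
      (fun x y => ?_)
    · rw [Fintype.card_prod, Fintype.card_fin, Fintype.card_fin] at h3
      nlinarith
    · rw [show ((n + 1 : ℕ) : ℤ) - 1 = n by omega, show ((j + 1 : ℕ) : ℤ) - 1 = j by omega]
      obtain ⟨⟨x, hx⟩, k⟩ := x
      by_cases hx' : x = j + 1
      · subst hx'
        exact h2 k
      · have h4 : MemF (level u n x).Pt (rect 0 n 0 j) := (level_mem u n x).2.mono
        exact h4 k
    · have hx := x.1.2
      have hy := y.1.2
      rw [hPt x.1 y.1 (by omega) (by omega)]
      simp only [Prod.ext_iff, Fin.ext_iff]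
  refine ⟨?_, fun i h1 h2 => ?_, fun j h1 h2 => ?_, fun i j h1 h2 h3 h4 => ?_, fun i j h1 h2 => ?_⟩
  · by_contra hneg
    -- The symmetry of the array makes `u 0 0` real, so failure of positivity is a statement about
    -- its real part.
    have h1 : (u 0 0).re ≤ 0 := by
      by_contra h2
      refine hneg ?_
      rw [← Complex.conj_eq_iff_re.mp h0]
      exact_mod_cast not_le.mp h2
    have h2 := hPt 0 0 (Nat.zero_le m) (Nat.zero_le m) 0 0
    rw [(P_eq_zero_of_u00 h1 n).2] at h2
    simp [pair_zero_left] at h2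
  · obtain ⟨i, rfl⟩ := Nat.exists_eq_add_of_le' h1
    by_contra h
    exact key i 0 h2 (Nat.zero_le m) (P_eq_zero_of_E h)
  · obtain ⟨j, rfl⟩ := Nat.exists_eq_add_of_le' h1
    by_contra h
    exact keyt j h2 (Pt_eq_zero_of_Et h)
  · obtain ⟨i, rfl⟩ := Nat.exists_eq_add_of_le' h1
    obtain ⟨j, rfl⟩ := Nat.exists_eq_add_of_le' h3
    by_contra h
    exact key i (j + 1) h2 h4 (P_eq_zero_of_norm h)
  · by_contra h
    exact key i (j + 1) h1 h2 (P_eq_zero_of_H3 h)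

end Necessity

/-! ## Functionals on the Laurent space and their moments -/

section Functionals

variable {n m : ℕ} {c c' : ℤ × ℤ → ℂ} {u : ℤ → ℤ → ℂ}

theorem laurentSpace_eq (n m : ℕ) : laurentSpace n m = spc (rect (-n) n (-m) m) := by
  refine le_antisymm (Submodule.span_le.mpr ?_) (mem_of_forall_mono_mem fun k hk => ?_)
  · rintro p ⟨i, j, hi, hj, rfl⟩
    rw [abs_le] at hi hj
    exact mono_mem_spc ⟨hi.1, hi.2, hj.1, hj.2⟩
  · exact Submodule.subset_span
      ⟨k.1, k.2, abs_le.mpr ⟨hk.1, hk.2.1⟩, abs_le.mpr ⟨hk.2.2.1, hk.2.2.2⟩, rfl⟩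

theorem polySpace_eq (n m : ℕ) : polySpace n m = spc (rect 0 n 0 m) := by
  refine le_antisymm (Submodule.span_le.mpr ?_) (mem_of_forall_mono_mem fun k hk => ?_)
  · rintro p ⟨i, j, hi, hj, rfl⟩
    exact mono_mem_spc ⟨by simp, by simpa using hi, by simp, by simpa using hj⟩
  · obtain ⟨h1, h2, h3, h4⟩ := hk
    refine Submodule.subset_span ⟨k.1.toNat, k.2.toNat, by omega, by omega, ?_⟩
    rw [Int.toNat_of_nonneg h1, Int.toNat_of_nonneg h3]

theorem mono_mem_spc_iff {S : Set (ℤ × ℤ)} {i j : ℤ} : mono i j ∈ spc S ↔ (i, j) ∈ S := by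
  refine ⟨fun h => ?_, mono_mem_spc⟩
  by_contra hk
  have h1 := h _ hk
  rw [coeff_mono, if_pos rfl] at h1
  exact one_ne_zero h1

theorem mul_dagger_mem {p q : Laurent} (hp : p ∈ spc (rect 0 n 0 m))
    (hq : q ∈ spc (rect 0 n 0 m)) : p * dagger q ∈ laurentSpace n m := by
  have hq' : dagger q ∈ spc (rect (-n) 0 (-m) 0) := by
    intro k hk
    rw [coeff_dagger, hq, star_zero]
    rintro ⟨h1, h2, h3, h4⟩
    simp only [Prod.fst_neg, Prod.snd_neg] at h1 h2 h3 h4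
    exact hk ⟨by omega, by omega, by omega, by omega⟩
  rw [laurentSpace_eq, laurent_eq_sum_mono p, Finset.sum_mul]
  refine Submodule.sum_mem _ fun k hk => ?_
  obtain ⟨h1, h2, h3, h4⟩ := mem_of_mem_support hp hk
  rw [smul_mul_assoc]
  refine Submodule.smul_mem _ _ (mono_mul_mem_spc hq' ?_)
  rintro l ⟨g1, g2, g3, g4⟩
  exact ⟨by simp only [Prod.fst_add]; omega, by simp only [Prod.fst_add]; omega,
    by simp only [Prod.snd_add]; omega, by simp only [Prod.snd_add]; omega⟩

/-- The functional on `∏^{n,m}` with the moments `c`. -/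
noncomputable def restr (n m : ℕ) (c : ℤ × ℤ → ℂ) : laurentSpace n m →ₗ[ℂ] ℂ :=
  (functional c).domRestrict _

theorem hasValue_restr {x : Laurent} {v : ℂ} (hx : x ∈ laurentSpace n m) :
    HasValue (restr n m c) x v ↔ functional c x = v :=
  ⟨fun ⟨_, h⟩ => h, fun h => ⟨hx, h⟩⟩

theorem hasValue_pair {p q : Laurent} {v : ℂ} (hp : p ∈ spc (rect 0 n 0 m))
    (hq : q ∈ spc (rect 0 n 0 m)) :
    HasValue (restr n m c) (p * dagger q) v ↔ pair c p q = v :=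
  hasValue_restr (mul_dagger_mem hp hq)

theorem isPositive_restr : IsPositive (restr n m c) ↔ Pos c n m := by
  unfold IsPositive
  rw [polySpace_eq]
  refine ⟨fun h p hp hne => ?_, fun h p hp hne => ⟨_, (hasValue_pair hp hp).mpr rfl, h p hp hne⟩⟩
  obtain ⟨v, hv, h0⟩ := h p hp hne
  rwa [(hasValue_pair hp hp).mp hv]

theorem AgreeOn.restr_eq (h : AgreeOn c c' n m) : restr n m c = restr n m c' := by
  ext ⟨x, hx⟩
  change functional c x = functional c' x
  rw [functional_apply, functional_apply]
  rw [laurentSpace_eq] at hx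
  exact Finset.sum_congr rfl fun k hk => by rw [h k (mem_of_mem_support hx hk)]

open Classical in
/-- The values of a functional on the monomials. -/
noncomputable def moments (L : laurentSpace n m →ₗ[ℂ] ℂ) (k : ℤ × ℤ) : ℂ :=
  if h : mono k.1 k.2 ∈ laurentSpace n m then L ⟨_, h⟩ else 0

theorem restr_moments (L : laurentSpace n m →ₗ[ℂ] ℂ) : restr n m (moments L) = L := by
  ext ⟨x, hx⟩
  change functional (moments L) x = L ⟨x, hx⟩
  have hx' := hx
  unfold laurentSpace at hx'
  induction hx' using Submodule.span_induction with
  | mem p hp =>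
    obtain ⟨i, j, -, -, rfl⟩ := hp
    rw [functional_mono, moments, dif_pos hx]
  | zero =>
    rw [map_zero]
    exact (map_zero L).symm
  | add p q hp hq h h' =>
    rw [map_add, h hp, h' hq, ← map_add]
    rfl
  | smul a p hp h =>
    rw [map_smul, h hp, ← map_smul]
    rfl

/-- Nonnegativity of a complex number includes being real; the values at `a = 0, 1, i` give
hermitian symmetry by polarization. -/
theorem pair_symm_of_nonneg {p q : Laurent}
    (h : ∀ a : ℂ, 0 ≤ pair c (p + a • q) (p + a • q)) (hq : 0 ≤ pair c q q) :
    star (pair c p q) = pair c q p := by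
  have h0 := (Complex.le_def.mp (h 0)).2
  have h1 := (Complex.le_def.mp (h 1)).2
  have h2 := (Complex.le_def.mp (h Complex.I)).2
  have h3 := (Complex.le_def.mp hq).2
  simp only [pair_add_left, pair_add_right, pair_smul_left, pair_smul_right] at h0 h1 h2
  simp at h0 h1 h2 h3
  refine Complex.ext ?_ ?_
  · simp
    linarith
  · simp
    linarith

theorem isHerm_moments {L : laurentSpace n m →ₗ[ℂ] ℂ} (hL : IsPositive L) :
    IsHerm (moments L) := by
  rw [← restr_moments L, isPositive_restr] at hL
  rintro ⟨x, y⟩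
  by_cases hk : ((x, y) : ℤ × ℤ) ∈ rect (-n) n (-m) m
  · obtain ⟨h1, h2, h3, h4⟩ := hk
    simp only at h1 h2 h3 h4
    have g1 : mono (max x 0) (max y 0) ∈ spc (rect 0 n 0 m) := mono_mem_spc
      ⟨by simp only; omega, by simp only; omega, by simp only; omega, by simp only; omega⟩
    have g2 : mono (max (-x) 0) (max (-y) 0) ∈ spc (rect 0 n 0 m) := mono_mem_spc
      ⟨by simp only; omega, by simp only; omega, by simp only; omega, by simp only; omega⟩
    have h5 := pair_symm_of_nonneg (c := moments L)
      (fun a => hL.nonneg (Submodule.add_mem _ g1 (Submodule.smul_mem _ a g2))) (hL.nonneg g2)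
    rw [pair_mono, pair_mono] at h5
    rw [show max x 0 - max (-x) 0 = x by omega, show max y 0 - max (-y) 0 = y by omega,
      show max (-x) 0 - max x 0 = -x by omega, show max (-y) 0 - max y 0 = -y by omega] at h5
    exact h5.symm
  -- Outside the rectangle, which is symmetric about the origin, both moments have the default value
  -- zero.
  · have h1 : moments L (x, y) = 0 := dif_neg (by rwa [laurentSpace_eq, mono_mem_spc_iff])
    have h2 : moments L (-(x, y)) = 0 := dif_neg (by
      rw [laurentSpace_eq, mono_mem_spc_iff]
      rintro ⟨g1, g2, g3, g4⟩
      simp only [Prod.fst_neg, Prod.snd_neg] at g1 g2 g3 g4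
      exact hk ⟨by simp only; omega, by simp only; omega, by simp only; omega, by simp only; omega⟩)
    rw [h1, h2, star_zero]

theorem pos_moments {L : laurentSpace n m →ₗ[ℂ] ℂ} (hL : IsPositive L) :
    Pos (moments L) n m := by
  rwa [← isPositive_restr, restr_moments]

/-! ## Orthonormality and parameters -/

theorem orthonormalFor_restr_iff : OrthonormalFor u (restr n m c) ↔
    (∀ i i', i ≤ n → i' ≤ n → ∀ k l : Fin (m + 1),
      pair c ((level u i m).P k) ((level u i' m).P l) = if i = i' ∧ k = l then 1 else 0) ∧
    (∀ j j', j ≤ m → j' ≤ m → ∀ k l : Fin (n + 1),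
      pair c ((level u n j).Pt k) ((level u n j').Pt l) = if j = j' ∧ k = l then 1 else 0) := by
  have h1 : ∀ i, i ≤ n → MemF (level u i m).P (rect 0 n 0 m) := fun i hi =>
    (level_mem u i m).1.mono
  have h2 : ∀ j, j ≤ m → MemF (level u n j).Pt (rect 0 n 0 m) := fun j hj =>
    (level_mem u n j).2.mono
  refine and_congr ?_ ?_
  · exact forall₂_congr fun i i' => forall₂_congr fun hi hi' => forall₂_congr fun k l =>
      hasValue_pair (h1 i hi k) (h1 i' hi' l)
  · exact forall₂_congr fun i i' => forall₂_congr fun hi hi' => forall₂_congr fun k l =>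
      hasValue_pair (h2 i hi k) (h2 i' hi' l)

theorem orthonormalFor_of_matches (hc : IsHerm c) (h : Pos c n m) (hu : Matches c u n m) :
    OrthonormalFor u (restr n m c) := by
  refine orthonormalFor_restr_iff.mpr ⟨fun i i' hi hi' k l => ?_, fun j j' hj hj' k l => ?_⟩
  · rw [level_eq_trueL hc (h.mono hi le_rfl) (hu.mono hi le_rfl),
      level_eq_trueL hc (h.mono hi' le_rfl) (hu.mono hi' le_rfl)]
    exact gram_Phi_Phi hc h hi hi' k l
  · rw [level_eq_trueL hc (h.mono le_rfl hj) (hu.mono le_rfl hj),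
      level_eq_trueL hc (h.mono le_rfl hj') (hu.mono le_rfl hj')]
    exact (pair_flip (sw c) _ _).trans (gram_Phi_Phi hc.sw h.sw hj hj' k l)

theorem agreeOn_of_orthonormalFor (hc : IsHerm c) (h : Pos c n m) (hu : Matches c u n m)
    (ho : OrthonormalFor u (restr n m c')) : AgreeOn c c' n m := by
  refine agreeOn_of_orthonormal hc h fun i i' hi hi' k l => ?_
  have h1 := (orthonormalFor_restr_iff.mp ho).1 i i' hi hi' k l
  rwa [level_eq_trueL hc (h.mono hi le_rfl) (hu.mono hi le_rfl),
    level_eq_trueL hc (h.mono hi' le_rfl) (hu.mono hi' le_rfl)] at h1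

/-- Orthonormality yields the conditions on `u`, and these yield a positive `c'` with parameters
`u`. Its orthonormal columns are the polynomials of the algorithm, so `c` and `c'` agree and `c` has
the parameters `u`. Positivity of `c` is a consequence rather than an assumption. -/
theorem matches_of_orthonormalFor (hu : IsParameterArray n m u)
    (ho : OrthonormalFor u (restr n m c)) : Admissible n m u ∧ Matches c u n m := by
  have h0 : star (u 0 0) = u 0 0 := by
    have := hu 0 0 (by simp) (by simp)
    rwa [neg_zero, eq_comm] at this
  obtain ⟨h1, h2⟩ := orthonormalFor_restr_iff.mp ho
  have ha := admissible_of_orthonormal h0 h1 h2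
  obtain ⟨c', hc', hp', hm'⟩ := exists_pos_matches ha
  exact ⟨ha, hm'.congr hp' (agreeOn_of_orthonormalFor hc' hp' hm' ho)⟩

theorem isLexOrthonormal_of_isPhi {i j l : ℕ} (hi : i ≤ n) (hj : j ≤ m) {p : Laurent}
    (h : IsPhi c i j l p) : IsLexOrthonormal (restr n m c) i j l p := by
  have hS : ∀ s : ℤ, lexSet i j s ⊆ rect 0 n 0 m := fun s =>
    (lexSet_subset_box i j s).trans (box_mono (by omega) (by omega))
  have hp := spc_mono (hS _) h.mem
  refine ⟨fun a b hab => ?_, h.pos, fun a b hb hab => ?_, (hasValue_pair hp hp).mpr h.norm⟩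
  · by_contra hk
    refine hab (h.mem _ fun h' => hk ?_)
    obtain ⟨h1, h2, h3, h4⟩ := h'
    simp only at h1 h2 h3 h4
    exact ⟨h1, h2, h3, by omega⟩
  · have hk : ((a : ℤ), (b : ℤ)) ∈ lexSet i j l :=
      ⟨by simp, by simp, by simpa using hb, by simp only; omega⟩
    exact (hasValue_pair hp (mono_mem_spc (hS _ hk))).mpr (h.orth _ (mono_mem_spc hk))

theorem isRevLexOrthonormal_of_isPhi {i j l : ℕ} (hi : i ≤ n) (hj : j ≤ m) {p : Laurent}
    (h : IsPhi (sw c) j i l p) : IsRevLexOrthonormal (restr n m c) i j l (flip p) := by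
  have hS : ∀ s : ℤ, lexSet j i s ⊆ rect 0 m 0 n := fun s =>
    (lexSet_subset_box j i s).trans (box_mono (by omega) (by omega))
  have hflip : ∀ {q : Laurent}, q ∈ spc (rect 0 m 0 n) → flip q ∈ spc (rect 0 n 0 m) :=
    fun {q} hq => MemF.flipF (y := fun _ : Fin 1 => q) (fun _ => hq) 0
  have hp := spc_mono (hS _) h.mem
  refine ⟨fun a b hab => ?_, ?_, fun a b hb hab => ?_,
    (hasValue_pair (hflip hp) (hflip hp)).mpr ((pair_flip (sw c) p p).trans h.norm)⟩
  · rw [coeff_flip] at hab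
    by_contra hk
    refine hab (h.mem _ fun h' => hk ?_)
    obtain ⟨h1, h2, h3, h4⟩ := h'
    simp only at h1 h2 h3 h4
    exact ⟨h2, h1, h3, by omega⟩
  · rw [coeff_flip]
    exact h.pos
  · have hk : ((b : ℤ), (a : ℤ)) ∈ lexSet j i l :=
      ⟨by simp, by simp, by simpa using hb, by simp only; omega⟩
    rw [← flip_mono]
    exact (hasValue_pair (hflip hp) (hflip (mono_mem_spc (hS _ hk)))).mpr
      ((pair_flip (sw c) _ _).trans (h.orth _ (mono_mem_spc hk)))

theorem isPhi_Phi {i j : ℕ} (h : Pos c i j) (k : Fin (j + 1)) :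
    IsPhi c i j (j - k) (Phi c i j k) :=
  isPhi_phiFam le_rfl (pos_iff_lexSet.mp h) k

theorem isRecurrenceDataOf_of_matches (hc : IsHerm c) (h : Pos c n m) (hu : Matches c u n m) :
    IsRecurrenceDataOf u (restr n m c) := by
  have hl : ∀ i j, i ≤ n → j ≤ m → level u i j = trueL c i j := fun i j hi hj =>
    level_eq_trueL hc (h.mono hi hj) (hu.mono hi hj)
  refine ⟨fun i j hi hj => ⟨fun k => ?_, fun k => ?_⟩, ?_, fun i hi => ?_, fun j hj => ?_,
    fun i j hi hj k l => ⟨?_, ?_⟩⟩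
  · rw [hl i j hi hj]
    exact isLexOrthonormal_of_isPhi hi hj (isPhi_Phi (h.mono hi hj) k)
  · rw [hl i j hi hj]
    exact isRevLexOrthonormal_of_isPhi hi hj (isPhi_Phi (h.mono hi hj).sw k)
  · rw [← mono_zero_zero, hasValue_restr, functional_mono, hu.zero]
    rw [laurentSpace_eq]
    exact mono_mem_spc ⟨by simp, by simp, by simp, by simp⟩
  · rw [hl i 0 hi.le (Nat.zero_le m), hl (i + 1) 0 hi (Nat.zero_le m)]
    have h1 : MemF (Phi c i 0) (rect 0 i 0 0) := Phi_mem (h.mono hi.le (Nat.zero_le m))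
    have h2 : MemF (shift 1 0 (Phi c i 0)) (rect 0 n 0 m) := h1.shift
    have h3 : MemF (revF i 0 (Phi c i 0)) (rect 0 n 0 m) := h1.revF
    exact (hasValue_pair (h2 0) (h3 0)).mpr rfl
  · rw [hl 0 j (Nat.zero_le n) hj.le, hl 0 (j + 1) (Nat.zero_le n) hj]
    have h1 : MemF (Phit c 0 j) (rect 0 0 0 j) := Phit_mem (h.mono (Nat.zero_le n) hj.le)
    have h2 : MemF (shift 0 1 (Phit c 0 j)) (rect 0 n 0 m) := h1.shift
    have h3 : MemF (revF 0 j (Phit c 0 j)) (rect 0 n 0 m) := h1.revF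
    exact (hasValue_pair (h2 0) (h3 0)).mpr (congrFun (congrFun (dEt_eq c 0 j) 0) 0).symm
  · rw [hl (i + 1) j hi hj.le, hl i (j + 1) hi.le hj, hl (i + 1) (j + 1) hi hj]
    have h1 : MemF (Phi c (i + 1) j) (rect 0 n 0 m) := (Phi_mem (h.mono hi hj.le)).mono
    have h2 : MemF (Phit c i (j + 1)) (rect 0 n 0 m) := (Phit_mem (h.mono hi.le hj)).mono
    exact (hasValue_pair (h1 k) (h2 l)).mpr rfl
  · rw [hl (i + 1) j hi hj.le, hl i (j + 1) hi.le hj, hl (i + 1) (j + 1) hi hj]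
    have h1 : MemF (shift 0 1 (Phi c (i + 1) j)) (rect 0 n 0 m) :=
      (Phi_mem (h.mono hi hj.le)).shift
    have h2 : MemF (revF i (j + 1) (Phit c i (j + 1))) (rect 0 n 0 m) :=
      (Phit_mem (h.mono hi.le hj)).revF
    exact (hasValue_pair (h1 k) (h2 l)).mpr rfl

/-- The parameters of the functional with moments `c`, for exponents in a half plane. -/
noncomputable def halfParam (c : ℤ × ℤ → ℂ) (i j : ℤ) : ℂ :=
  if j = 0 then dE c i.toNat 0 0 0
  else if i = 0 then dE (sw c) j.toNat 0 0 0
  else if i < 0 then kparam c (-i - 1).toNat (j - 1).toNat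
  else star (dK1 c ((i - 1).toNat + 1) ((j - 1).toNat + 1) 0 0)

/-- The parameters of the functional with moments `c`. -/
noncomputable def params (c : ℤ × ℤ → ℂ) (i j : ℤ) : ℂ :=
  if i = 0 ∧ j = 0 then c (0, 0)
  else if 0 < j ∨ (j = 0 ∧ 0 < i) then halfParam c i j
  else star (halfParam c (-i) (-j))

theorem isParameterArray_params (hc : IsHerm c) : IsParameterArray n m (params c) := by
  intro i j _ _
  unfold params
  by_cases h0 : i = 0 ∧ j = 0
  · rw [if_pos (by omega), if_pos (by omega)]
    exact hc (0, 0)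
  · rw [if_neg (show ¬(-i = 0 ∧ j = 0) by omega), if_neg (show ¬(i = 0 ∧ -j = 0) by omega)]
    by_cases h1 : 0 < j ∨ (j = 0 ∧ 0 < -i)
    · rw [if_pos h1, if_neg (show ¬(0 < -j ∨ (-j = 0 ∧ 0 < i)) by omega), neg_neg, star_star]
    · rw [if_neg h1, if_pos (show 0 < -j ∨ (-j = 0 ∧ 0 < i) by omega), neg_neg]

theorem matches_params (c : ℤ × ℤ → ℂ) (n m : ℕ) : Matches c (params c) n m := by
  refine ⟨if_pos (by simp), fun a _ => ?_, fun b _ => ?_, fun a _ b _ => ?_, fun a _ b _ => ?_⟩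
  · rw [params, if_neg (by omega), if_pos (by omega), halfParam, if_pos rfl,
      show ((a : ℤ) + 1).toNat = a + 1 by omega]
  · rw [params, if_neg (by omega), if_pos (by omega), halfParam, if_neg (by omega), if_pos rfl,
      show ((b : ℤ) + 1).toNat = b + 1 by omega]
  · rw [params, if_neg (by omega), if_pos (by omega), halfParam, if_neg (by omega),
      if_neg (by omega), if_pos (by omega), show (-(-((a : ℤ) + 1)) - 1).toNat = a by omega,
      show ((b : ℤ) + 1 - 1).toNat = b by omega]
  · rw [params, if_neg (by omega), if_pos (by omega), halfParam, if_neg (by omega),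
      if_neg (by omega), if_neg (by omega), star_star]
    have key : ∀ x y : ℕ, x = a → y = b → dK1 c (x + 1) (y + 1) 0 0 = dK1 c (a + 1) (b + 1) 0 0 := by
      rintro _ _ rfl rfl
      rfl
    exact key _ _ (by omega) (by omega)

/-- Matching fixes the array on a half plane and at the origin; the conjugation symmetry supplies
the other half. -/
theorem Matches.eq {v : ℤ → ℤ → ℂ} (hu : Matches c u n m) (hv : Matches c v n m)
    (pu : IsParameterArray n m u) (pv : IsParameterArray n m v) {i j : ℤ} (hi : |i| ≤ n)
    (hj : |j| ≤ m) : v i j = u i j := by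
  have key : ∀ i j : ℤ, |i| ≤ n → |j| ≤ m → 0 < j ∨ (j = 0 ∧ 0 < i) → v i j = u i j := by
    intro i j hi hj h
    rw [abs_le] at hi hj
    rcases eq_or_ne j 0 with rfl | hj0
    · obtain ⟨a, rfl⟩ : ∃ a : ℕ, i = a + 1 := ⟨(i - 1).toNat, by omega⟩
      rw [hu.left a (by omega), hv.left a (by omega)]
    obtain ⟨b, rfl⟩ : ∃ b : ℕ, j = b + 1 := ⟨(j - 1).toNat, by omega⟩
    rcases lt_trichotomy i 0 with hi0 | rfl | hi0
    · obtain ⟨a, rfl⟩ : ∃ a : ℕ, i = -(a + 1) := ⟨(-i - 1).toNat, by omega⟩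
      rw [hu.antidiag a (by omega) b (by omega), hv.antidiag a (by omega) b (by omega)]
    · rw [hu.right b (by omega), hv.right b (by omega)]
    · obtain ⟨a, rfl⟩ : ∃ a : ℕ, i = a + 1 := ⟨(i - 1).toNat, by omega⟩
      rw [← star_inj, hu.diag a (by omega) b (by omega), hv.diag a (by omega) b (by omega)]
  by_cases h0 : i = 0 ∧ j = 0
  · rw [h0.1, h0.2, hu.zero, hv.zero]
  by_cases h : 0 < j ∨ (j = 0 ∧ 0 < i)
  · exact key i j hi hj h
  · have hi' : |-i| ≤ (n : ℤ) := by rwa [abs_neg]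
    have hj' : |-j| ≤ (m : ℤ) := by rwa [abs_neg]
    have h1 := pu (-i) j hi' hj
    have h2 := pv (-i) j hi' hj
    rw [neg_neg] at h1 h2
    rw [h1, h2, key (-i) (-j) hi' hj' (by omega)]

theorem exists_params {L : laurentSpace n m →ₗ[ℂ] ℂ} (hL : IsPositive L) :
    ∃ u : ℤ → ℤ → ℂ, IsParameterArray n m u ∧ Admissible n m u ∧ OrthonormalFor u L ∧
      ∀ v : ℤ → ℤ → ℂ, IsParameterArray n m v → OrthonormalFor v L →
        ∀ i j : ℤ, |i| ≤ n → |j| ≤ m → v i j = u i j := by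
  have hc := isHerm_moments hL
  have hu := isParameterArray_params (n := n) (m := m) hc
  have hm := matches_params (moments L) n m
  have ho := orthonormalFor_of_matches hc (pos_moments hL) hm
  refine ⟨params (moments L), hu, (matches_of_orthonormalFor hu ho).1, ?_,
    fun v hv hov i j hi hj => ?_⟩
  · rwa [restr_moments] at ho
  · rw [← restr_moments L] at hov
    exact hm.eq (matches_of_orthonormalFor hv hov).2 hu hv hi hj

/-! ## Doubly Toeplitz matrices -/

/-- The polynomial of degree at most `(n, m)` with coefficients `x`. -/
noncomputable def poly (x : Fin (n + 1) × Fin (m + 1) → ℂ) : Laurent :=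
  ∑ s, x s • mono (s.1 : ℕ) (s.2 : ℕ)

theorem poly_mem (x : Fin (n + 1) × Fin (m + 1) → ℂ) : poly x ∈ spc (rect 0 n 0 m) :=
  Submodule.sum_mem _ fun s _ => Submodule.smul_mem _ _ (mono_mem_spc
    ⟨by simp, by simp only; omega, by simp, by simp only; omega⟩)

theorem coeff_poly (x : Fin (n + 1) × Fin (m + 1) → ℂ) (s : Fin (n + 1) × Fin (m + 1)) :
    (poly x).coeff (((s.1 : ℕ) : ℤ), ((s.2 : ℕ) : ℤ)) = x s := by
  simp only [poly, AddMonoidAlgebra.coeff_sum, Finsupp.finsetSum_apply,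
    AddMonoidAlgebra.coeff_smul_apply, coeff_mono]
  rw [Finset.sum_eq_single s]
  · simp
  · intro t _ hts
    rw [if_neg, smul_zero]
    intro h'
    simp only [Prod.mk.injEq, Nat.cast_inj] at h'
    exact hts (Prod.ext (Fin.ext h'.1) (Fin.ext h'.2))
  · simp

theorem exists_poly_eq {p : Laurent} (hp : p ∈ spc (rect 0 n 0 m)) :
    ∃ x : Fin (n + 1) × Fin (m + 1) → ℂ, poly x = p := by
  refine ⟨fun s => p.coeff ((s.1 : ℕ), (s.2 : ℕ)), laurent_ext fun k => ?_⟩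
  by_cases hk : k ∈ rect 0 n 0 m
  · obtain ⟨h1, h2, h3, h4⟩ := hk
    have h := coeff_poly (fun s : Fin (n + 1) × Fin (m + 1) => p.coeff ((s.1 : ℕ), (s.2 : ℕ)))
      (⟨k.1.toNat, by omega⟩, ⟨k.2.toNat, by omega⟩)
    simpa only [Int.toNat_of_nonneg h1, Int.toNat_of_nonneg h3] using h
  · rw [hp k hk, poly_mem _ k hk]

theorem pair_poly {C : Matrix (Fin (n + 1) × Fin (m + 1)) (Fin (n + 1) × Fin (m + 1)) ℂ}
    (hC : ∀ s t, C s t = c ((t.1 : ℤ) - (s.1 : ℤ), (t.2 : ℤ) - (s.2 : ℤ)))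
    (x : Fin (n + 1) × Fin (m + 1) → ℂ) : pair c (poly x) (poly x) = star x ⬝ᵥ (C *ᵥ x) := by
  simp only [poly, pair_sum_left, pair_sum_right, pair_smul_left, pair_smul_right, pair_mono,
    dotProduct, mulVec, Finset.mul_sum, hC, Pi.star_apply]
  refine Finset.sum_congr rfl fun s _ => Finset.sum_congr rfl fun t _ => ?_
  ring

theorem posDef_iff_pos
    {C : Matrix (Fin (n + 1) × Fin (m + 1)) (Fin (n + 1) × Fin (m + 1)) ℂ} (hc : IsHerm c)
    (hC : ∀ s t, C s t = c ((t.1 : ℤ) - (s.1 : ℤ), (t.2 : ℤ) - (s.2 : ℤ))) :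
    C.PosDef ↔ Pos c n m := by
  refine ⟨fun h p hp hne => ?_, fun h => Matrix.PosDef.of_dotProduct_mulVec_pos ?_ fun x hx => ?_⟩
  · obtain ⟨x, rfl⟩ := exists_poly_eq hp
    rw [pair_poly hC]
    refine h.dotProduct_mulVec_pos fun hx => hne ?_
    simp [hx, poly]
  · refine Matrix.IsHermitian.ext fun s t => ?_
    rw [hC, hC, ← hc]
    simp
  · rw [← pair_poly hC]
    refine h _ (poly_mem x) fun h0 => hx (funext fun s => ?_)
    rw [← coeff_poly x s, h0]
    simp

theorem isMomentMatrix_restr_iff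
    {C : Matrix (Fin (n + 1) × Fin (m + 1)) (Fin (n + 1) × Fin (m + 1)) ℂ} :
    IsMomentMatrix (restr n m c) C ↔
      ∀ s t, C s t = c ((t.1 : ℤ) - (s.1 : ℤ), (t.2 : ℤ) - (s.2 : ℤ)) := by
  have h : ∀ s t : Fin (n + 1) × Fin (m + 1),
      mono ((t.1 : ℤ) - (s.1 : ℤ)) ((t.2 : ℤ) - (s.2 : ℤ)) ∈ laurentSpace n m := by
    intro s t
    rw [laurentSpace_eq]
    exact mono_mem_spc ⟨by simp only; omega, by simp only; omega, by simp only; omega,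
      by simp only; omega⟩
  refine ⟨fun hC s t => ?_, fun hC a a' b b' => ?_⟩
  · have h1 := (hasValue_restr (h s t)).mp (hC s.1 t.1 s.2 t.2)
    rw [functional_mono] at h1
    exact h1.symm
  · refine (hasValue_restr (h (a, b) (a', b'))).mpr ?_
    rw [functional_mono, hC]

theorem exists_functional_of_posDef
    {C : Matrix (Fin (n + 1) × Fin (m + 1)) (Fin (n + 1) × Fin (m + 1)) ℂ}
    (hT : IsDoublyToeplitz C) (hC : C.PosDef) :
    ∃ L : laurentSpace n m →ₗ[ℂ] ℂ, IsPositive L ∧ IsMomentMatrix L C := by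
  classical
  obtain ⟨t, ht⟩ := hT
  -- The matrix says nothing about `t` outside the rectangle, so truncation is needed to obtain a
  -- hermitian array.
  let c : ℤ × ℤ → ℂ := fun k => if k ∈ rect (-n) n (-m) m then t (-k.1) (-k.2) else 0
  have hcC : ∀ s t, C s t = c ((t.1 : ℤ) - (s.1 : ℤ), (t.2 : ℤ) - (s.2 : ℤ)) := by
    intro s s'
    have h : c ((s'.1 : ℤ) - (s.1 : ℤ), (s'.2 : ℤ) - (s.2 : ℤ)) = t _ _ := if_pos
      ⟨by simp only; omega, by simp only; omega, by simp only; omega, by simp only; omega⟩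
    rw [h, neg_sub, neg_sub]
    exact ht s.1 s'.1 s.2 s'.2
  have hc : IsHerm c := by
    rintro ⟨x, y⟩
    by_cases hk : ((x, y) : ℤ × ℤ) ∈ rect (-n) n (-m) m
    · obtain ⟨h1, h2, h3, h4⟩ := hk
      simp only at h1 h2 h3 h4
      -- The positive and negative parts of `(x, y)` are admissible index pairs whose difference is
      -- `(x, y)`, so hermitian symmetry of the matrix becomes that of the moments.
      have h5 := hC.isHermitian.apply
        (⟨(max x 0).toNat, by omega⟩, ⟨(max y 0).toNat, by omega⟩)
        (⟨(max (-x) 0).toNat, by omega⟩, ⟨(max (-y) 0).toNat, by omega⟩)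
      rw [hcC, hcC] at h5
      simp only [Int.toNat_of_nonneg (le_max_right _ (0 : ℤ))] at h5
      rw [show max x 0 - max (-x) 0 = x by omega, show max y 0 - max (-y) 0 = y by omega,
        show max (-x) 0 - max x 0 = -x by omega, show max (-y) 0 - max y 0 = -y by omega] at h5
      exact h5.symm
    · have h1 : c (x, y) = 0 := if_neg hk
      have h2 : c (-(x, y)) = 0 := if_neg fun h' => hk (by
        obtain ⟨g1, g2, g3, g4⟩ := h'
        simp only [Prod.fst_neg, Prod.snd_neg] at g1 g2 g3 g4
        exact ⟨by simp only; omega, by simp only; omega, by simp only; omega, by simp only; omega⟩)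
      rw [h1, h2, star_zero]
  exact ⟨restr n m c, isPositive_restr.mpr ((posDef_iff_pos hc hcC).mp hC),
    isMomentMatrix_restr_iff.mpr hcC⟩

theorem IsMomentMatrix.isDoublyToeplitz_posDef {L : laurentSpace n m →ₗ[ℂ] ℂ} (hL : IsPositive L)
    {C : Matrix (Fin (n + 1) × Fin (m + 1)) (Fin (n + 1) × Fin (m + 1)) ℂ}
    (hC : IsMomentMatrix L C) : IsDoublyToeplitz C ∧ C.PosDef := by
  rw [← restr_moments L, isMomentMatrix_restr_iff] at hC
  refine ⟨⟨fun x y => moments L (-x, -y), fun a a' b b' => ?_⟩,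
    (posDef_iff_pos (isHerm_moments hL) hC).mpr (pos_moments hL)⟩
  simp only [hC, neg_sub]

end Functionals

end Bicircle

/-- Necessary and sufficient conditions on the parameters for the existence of a positive linear
functional, and the resulting parametrization of the positive definite functionals on `∏^{n,m}` and
of the positive definite doubly Toeplitz matrices. -/
theorem mainTheorem1 (n m : ℕ) :
    -- sufficiency of the conditions, with uniqueness of the functional
    (∀ u : ℤ → ℤ → ℂ, Bicircle.IsParameterArray n m u → Bicircle.Admissible n m u →
      ∃! L : Bicircle.laurentSpace n m →ₗ[ℂ] ℂ,
        Bicircle.IsPositive L ∧ Bicircle.OrthonormalFor u L) ∧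
    -- necessity of the conditions for the given parameters
    (∀ u : ℤ → ℤ → ℂ, Bicircle.IsParameterArray n m u →
      ∀ L : Bicircle.laurentSpace n m →ₗ[ℂ] ℂ,
        Bicircle.IsPositive L → Bicircle.OrthonormalFor u L →
          Bicircle.Admissible n m u ∧ Bicircle.IsRecurrenceDataOf u L) ∧
    -- every positive functional comes from exactly one array of parameters
    (∀ L : Bicircle.laurentSpace n m →ₗ[ℂ] ℂ, Bicircle.IsPositive L →
      ∃ u : ℤ → ℤ → ℂ, Bicircle.IsParameterArray n m u ∧ Bicircle.Admissible n m u ∧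
        Bicircle.OrthonormalFor u L ∧
        ∀ v : ℤ → ℤ → ℂ, Bicircle.IsParameterArray n m v → Bicircle.OrthonormalFor v L →
          ∀ i j : ℤ, |i| ≤ n → |j| ≤ m → v i j = u i j) ∧
    -- characterization of the positive definite doubly Toeplitz matrices
    (∀ C : Matrix (Fin (n + 1) × Fin (m + 1)) (Fin (n + 1) × Fin (m + 1)) ℂ,
      (Bicircle.IsDoublyToeplitz C ∧ C.PosDef) ↔
        ∃ (u : ℤ → ℤ → ℂ) (L : Bicircle.laurentSpace n m →ₗ[ℂ] ℂ),
          Bicircle.IsParameterArray n m u ∧ Bicircle.Admissible n m u ∧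
          Bicircle.IsPositive L ∧ Bicircle.OrthonormalFor u L ∧
          Bicircle.IsMomentMatrix L C) := by
  open Bicircle in
  refine ⟨fun u hu ha => ?_, fun u hu L hL ho => ?_, fun L hL => exists_params hL,
    fun C => ⟨fun ⟨hT, hC⟩ => ?_, fun ⟨u, L, _, _, hL, _, hM⟩ => hM.isDoublyToeplitz_posDef hL⟩⟩
  · obtain ⟨c, hc, h, hm⟩ := exists_pos_matches ha
    refine ⟨restr n m c, ⟨isPositive_restr.mpr h, orthonormalFor_of_matches hc h hm⟩, ?_⟩
    rintro L ⟨-, hL⟩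
    rw [← restr_moments L] at hL
    rw [(agreeOn_of_orthonormalFor hc h hm hL).restr_eq, restr_moments]
  · rw [← restr_moments L] at ho
    obtain ⟨ha, hm⟩ := matches_of_orthonormalFor hu ho
    have h := isRecurrenceDataOf_of_matches (isHerm_moments hL) (pos_moments hL) hm
    rw [restr_moments] at h
    exact ⟨ha, h⟩
  · obtain ⟨L, hL, hM⟩ := exists_functional_of_posDef hT hC
    obtain ⟨u, hu, ha, ho, -⟩ := exists_params hL
    exact ⟨u, L, hu, ha, hL, ho, hM⟩
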